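/- **Setting.** Let $\aleph_0\le\kappa<\lambda\le\mu^+$ be cardinals. For $n\ge 1$ let $IS_n$ be the set of isomorphism types of pairs $(A,\bar g)$, where $A\neq\emptyset$ and $\bar g=(g_1,\dots,g_n)$ is a tuple of permutations of $A$ (acting on the right) that generates a transitive group; if $\lambda\le\mu$, the type with all $g_i=\mathrm{id}$ is left out. Let $Card^-$ be the set of cardinals $\nu<\lambda$ with $\nu=0$ or $\nu\ge\kappa$. Let $F_n$ be the set of functions $h$ from $IS_n$ to the cardinals below $\lambda$ with $\sum_t h(t)<\lambda$ (and $\sum_t h(t)=\mu$ if $\lambda=\mu^+$), modulo the equivalence relation $\sum_t|h(t)-h'(t)|<\kappa$, where $|a-b|$ is the least cardinal which added to $\min(a,b)$ gives $\max(a,b)$. Let $App_n:F_n\times IS_n\to Card^-$ send (the class of $h$, $t$) to $h(t)$ if $h(t)\ge\kappa$, and to $0$ otherwise. Let $Eq^1\subseteq IS_2$ be given by $g_1=g_2$, let $Prod^1\subseteq IS_3$ be given by $g_1g_2=g_3$, and let $Proj^1_n\subseteq IS_{n+1}\times IS_n$ consist of the $(t_1,t_2)$ such that $t_2$ is the type of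 $(g_1,\dots,g_n)$ on one of its orbits in a tuple of type $t_1$. Put $$\mathcal M^*_{\kappa\lambda\mu}=\big((IS_n)_{n\ge1},Card^-,(F_n)_{n\ge1};Eq^1,Prod^1,(Proj^1_n)_{n\ge1},<,(App_n)_{n\ge1}\big),$$ a many-sorted first-order structure. Let $\Omega=(2^{\aleph_0})^+$, and let $\alpha$ be the order type of $Card^-$, written as $\alpha=\Omega^\omega\alpha_\omega+\dots+\Omega^n\alpha_{[n]}+\dots+\Omega\alpha_{[1]}+\alpha_{[0]}$ with all $\alpha_{[n]}<\Omega$ and only finitely many of them non-zero. Put $\alpha[n]=\Omega^\omega\alpha_\omega+\dots+\Omega^{n+1}\alpha_{[n+1]}$, and let $\alpha^{[n]}=1+cf(\alpha[n])$ if $cf(\alpha[n])<\Omega$, and $\alpha^{[n]}=0$ otherwise (with $cf(0)=0$ and $cf(\beta+1)=1$). Let $\mathcal N^2_{\kappa\lambda\mu}$ be the structure with the pairwise disjoint sorts $(IS_n)_{n\ge1}$, $(\alpha_{[n]})_{n\ge0}$, $(\alpha^{[n]})_{n\ge0}$, the relations $Eq^1,Prod^1,Proj^1_n$ and the usual orders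 on the ordinals $\alpha_{[n]},\alpha^{[n]}$, taken with full second-order logic: for every finite tuple of these sorts there is a further sort, consisting of all relations on the product of the tuple, with the membership relation. A many-sorted structure $\mathcal A$ is *interpretable* in $\mathcal B$ if the elements of each sort of $\mathcal A$ are represented by the tuples (of a fixed length and fixed sorts) in a definable set of $\mathcal B$, every element being represented, such that equality of the represented elements on each sort and every basic relation of $\mathcal A$ are given by first-order formulas in $\mathcal B$. Unless parameters are mentioned, the formulas contain none. **Theorem.** Let $cf(\kappa)>2^{\aleph_0}$. 1. If $cf(\lambda)>2^{\aleph_0}$, then $\mathcal N^2_{\kappa\lambda\mu}$ is interpretable in $\mathcal M^*_{\kappa\lambda\mu}$ without parameters, by formulas that do not depend on $\kappa,\lambda,\mu$. 2. If $\alpha_{[n]}\ne0$ for some $n$, then $\mathcal N^2_{\kappa\lambda\mu}$ is interpretable in $\mathcal M^*_{\kappa\lambda\mu}$ without parameters (whatever $cf(\lambda)$ is). 3. In every case $\mathcal N^2_{\kappa\lambda\mu}$ is interpretable in $\mathcal M^*_{\kappa\lambda\mu}$ with finitely many parameters. -/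

import Mathlib

open Cardinal Ordinal

universe u w

namespace PermQuot

/-! ### Many-sorted first-order logic

Languages are relational; an `n`-ary function symbol is represented by the `(n+1)`-ary relation
symbol for its graph, which gives the same definable relations.  Sorts may be empty. -/

/-- A many-sorted relational language. -/
structure Lang where
  /-- the sorts -/
  Srt : Type
  /-- the relation symbols -/
  Rel : Type
  /-- the number of places of a relation symbol -/
  arity : Rel → ℕ
  /-- the sort of each place of a relation symbol -/
  relSort : (R : Rel) → Fin (arity R) → Srt

/-- A structure for a many-sorted language. -/
structure Struc (L : Lang) where
  /-- the domain of each sort -/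
  carrier : L.Srt → Type w
  /-- the interpretation of the relation symbols -/
  rel : (R : L.Rel) → (∀ i, carrier (L.relSort R i)) → Prop

/-- `extend σ s` is the sorted variable context `σ` with one new variable `none` of sort `s`. -/
def extend {S ι : Type} (σ : ι → S) (s : S) : Option ι → S
  | none => s
  | some i => σ i

/-- First-order formulas whose free variables are the `i : ι`, the variable `i` having sort `σ i`.
There are equality, the relation symbols, `⊥`, implication and universal quantification over each
sort; all other connectives and the existential quantifier are definable from these. -/
inductive Fml (L : Lang) : {ι : Type} → (ι → L.Srt) → Type 1
  | falsum {ι : Type} {σ : ι → L.Srt} : Fml L σ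
  | eq {ι : Type} {σ : ι → L.Srt} (i j : ι) (h : σ i = σ j) : Fml L σ
  | rel {ι : Type} {σ : ι → L.Srt} (R : L.Rel) (v : Fin (L.arity R) → ι)
      (h : ∀ a, σ (v a) = L.relSort R a) : Fml L σ
  | imp {ι : Type} {σ : ι → L.Srt} (φ ψ : Fml L σ) : Fml L σ
  | all {ι : Type} {σ : ι → L.Srt} (s : L.Srt) (φ : Fml L (extend σ s)) : Fml L σ

namespace Struc

variable {L : Lang} (A : Struc.{w} L)

/-- An assignment of elements of the right sorts to the variables of a context. -/
abbrev Env {ι : Type} (σ : ι → L.Srt) : Type w := ∀ i, A.carrier (σ i)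

/-- Extend an assignment by a value for the new variable. -/
def snoc {ι : Type} {σ : ι → L.Srt} {s : L.Srt} (e : A.Env σ) (a : A.carrier s) :
    A.Env (extend σ s)
  | none => a
  | some i => e i

/-- Satisfaction of a formula in a structure under an assignment. -/
def Sat : {ι : Type} → {σ : ι → L.Srt} → Fml L σ → A.Env σ → Prop
  | _, _, .falsum, _ => False
  | _, _, .eq i j h, e => cast (congrArg A.carrier h) (e i) = e j
  | _, _, .rel R v h, e => A.rel R fun a => cast (congrArg A.carrier (h a)) (e (v a))
  | _, _, .imp φ ψ, e => Sat φ e → Sat ψ e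
  | _, _, .all s φ, e => ∀ a : A.carrier s, Sat φ (A.snoc e a)

/-- Concatenation of two assignments. -/
def append {ι κ : Type} {σ : ι → L.Srt} {τ : κ → L.Srt} (e : A.Env σ) (f : A.Env τ) :
    A.Env (Sum.elim σ τ)
  | .inl i => e i
  | .inr j => f j

/-- Concatenation of a family of assignments. -/
def sigma {ι : Type} {κ : ι → Type} {τ : (i : ι) → κ i → L.Srt} (f : ∀ i, A.Env (τ i)) :
    A.Env (fun x : (i : ι) × κ i => τ x.1 x.2) :=
  fun x => f x.1 x.2

end Struc

/-- The formulas of an (explicit) interpretation of `L`-structures in `L'`-structures, with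
parameters of the sorts `π`.  Elements of sort `s` are represented by finite tuples of fixed length
`dim s` and fixed sorts `srt s`, namely by those satisfying `dom s`; `eqv s` says that two tuples
represent the same element; `rel R` says that `R` holds of the represented elements. -/
structure Scheme (L L' : Lang) {np : ℕ} (π : Fin np → L'.Srt) where
  dim : L.Srt → ℕ
  srt : (s : L.Srt) → Fin (dim s) → L'.Srt
  dom : (s : L.Srt) → Fml L' (Sum.elim π (srt s))
  eqv : (s : L.Srt) → Fml L' (Sum.elim π (Sum.elim (srt s) (srt s)))
  rel : (R : L.Rel) → Fml L' (Sum.elim π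
    (fun x : (i : Fin (L.arity R)) × Fin (dim (L.relSort R i)) => srt (L.relSort R x.1) x.2))

/-- The scheme `I`, with the parameters `p`, interprets the structure `A` in the structure `B`:
for every sort there is a map from the tuples in its domain onto that sort of `A` (the coordinate
map) such that equality and all basic relations of `A` pull back to the relations defined in `B` by
the formulas of `I`. -/
def Scheme.Interprets {L L' : Lang} {np : ℕ} {π : Fin np → L'.Srt} (I : Scheme L L' π)
    (A : Struc.{w} L) (B : Struc.{w} L') (p : B.Env π) : Prop :=
  ∃ f : (s : L.Srt) → {x : B.Env (I.srt s) // B.Sat (I.dom s) (B.append p x)} → A.carrier s,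
    (∀ s, Function.Surjective (f s)) ∧
    (∀ s x y, B.Sat (I.eqv s) (B.append p (B.append x.1 y.1)) ↔ f s x = f s y) ∧
    ∀ (R : L.Rel)
      (x : ∀ i, {x : B.Env (I.srt (L.relSort R i)) //
        B.Sat (I.dom (L.relSort R i)) (B.append p x)}),
      B.Sat (I.rel R) (B.append p (B.sigma fun i => (x i).1)) ↔ A.rel R fun i => f _ (x i)

/-- The empty list of parameter sorts. -/
def noParam (L : Lang) : Fin 0 → L.Srt := fun i => i.elim0

/-- The empty list of parameters. -/
def noArg {L : Lang} (B : Struc.{w} L) : B.Env (noParam L) := fun i => i.elim0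

/-- `A` is interpretable in `B` without parameters. -/
def Interpretable {L L' : Lang} (A : Struc.{w} L) (B : Struc.{w} L') : Prop :=
  ∃ I : Scheme L L' (noParam L'), I.Interprets A B (noArg B)

/-- `A` is interpretable in `B` with finitely many parameters from `B`. -/
def InterpretableWithParams {L L' : Lang} (A : Struc.{w} L) (B : Struc.{w} L') : Prop :=
  ∃ (np : ℕ) (π : Fin np → L'.Srt) (I : Scheme L L' π) (p : B.Env π), I.Interprets A B p

/-! ### Isomorphism types of transitive tuples of permutations -/

/-- A nonempty set with an `n`-tuple of permutations generating a transitive group.  Such a set is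
countable, so up to isomorphism its points may be taken to be natural numbers. -/
structure TransTuple (n : ℕ) where
  carrier : Set ℕ
  nonempty : carrier.Nonempty
  perm : Fin n → Equiv.Perm carrier
  transitive : ∀ x y : carrier, ∃ g ∈ Subgroup.closure (Set.range perm), g x = y

/-- Isomorphism of sets with an `n`-tuple of permutations. -/
instance transTupleSetoid (n : ℕ) : Setoid (TransTuple n) where
  r a b := ∃ e : a.carrier ≃ b.carrier, ∀ i x, e (a.perm i x) = b.perm i (e x)
  iseqv :=
    { refl := fun _ => ⟨Equiv.refl _, fun _ _ => rfl⟩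
      symm := fun {a b} ⟨e, he⟩ => ⟨e.symm, fun i x => by
        rw [Equiv.symm_apply_eq, he, Equiv.apply_symm_apply]⟩
      trans := fun ⟨e, he⟩ ⟨f, hf⟩ => ⟨e.trans f, fun i x => by
        simp [he, hf]⟩ }

/-- Isomorphism types of transitive `n`-tuples of permutations. -/
def IsoType (n : ℕ) : Type := Quotient (transTupleSetoid n)

/-- The isomorphism type of a transitive tuple. -/
def TransTuple.type {n : ℕ} (a : TransTuple n) : IsoType n := Quotient.mk _ a

/-- The type in which all entries of the tuple are the identity. -/
def IsoType.IsTrivial {n : ℕ} (t : IsoType n) : Prop :=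
  ∃ a : TransTuple n, a.type = t ∧ ∀ i, a.perm i = 1

/-! ### Cardinal arithmetic -/

/-- `|a - b|`: the least cardinal which added to the smaller of `a`, `b` gives the larger. -/
noncomputable def cardDist (a b : Cardinal.{u}) : Cardinal.{u} :=
  sInf {c | min a b + c = max a b}

theorem cardDist_comm (a b : Cardinal.{u}) : cardDist a b = cardDist b a := by
  simp only [cardDist, min_comm, max_comm]

theorem min_add_cardDist (a b : Cardinal.{u}) : min a b + cardDist a b = max a b := by
  have h : {c | min a b + c = max a b}.Nonempty := by
    obtain ⟨c, hc⟩ := exists_add_of_le (min_le_max : min a b ≤ max a b)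
    exact ⟨c, hc.symm⟩
  exact csInf_mem h

theorem cardDist_le {a b d : Cardinal.{u}} (hab : b ≤ a + d) (hba : a ≤ b + d) :
    cardDist a b ≤ d := by
  have h : max a b ≤ min a b + d := by
    rcases le_total a b with h | h
    · rwa [max_eq_right h, min_eq_left h]
    · rwa [max_eq_left h, min_eq_right h]
  by_contra hlt
  push Not at hlt
  refine absurd hlt (not_lt.2 (csInf_le' ?_))
  refine le_antisymm ?_ h
  rw [← min_add_cardDist a b]
  gcongr

theorem le_add_cardDist (a b : Cardinal.{u}) : b ≤ a + cardDist a b :=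
  calc b ≤ max a b := le_max_right _ _
    _ = min a b + cardDist a b := (min_add_cardDist a b).symm
    _ ≤ a + cardDist a b := by gcongr; exact min_le_left _ _

theorem cardDist_self (a : Cardinal.{u}) : cardDist a a = 0 :=
  le_antisymm (cardDist_le (by simp) (by simp)) zero_le

theorem cardDist_triangle (a b c : Cardinal.{u}) :
    cardDist a c ≤ cardDist a b + cardDist b c := by
  apply cardDist_le
  · calc c ≤ b + cardDist b c := le_add_cardDist b c
      _ ≤ (a + cardDist a b) + cardDist b c := by gcongr; exact le_add_cardDist a b
      _ = _ := add_assoc _ _ _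
  · calc a ≤ b + cardDist b a := le_add_cardDist b a
      _ ≤ (c + cardDist c b) + cardDist b a := by gcongr; exact le_add_cardDist c b
      _ = _ := by rw [cardDist_comm c b, cardDist_comm b a, add_assoc, add_comm (cardDist b c)]

theorem eq_of_cardDist_lt {k a b : Cardinal.{u}} (hk : ℵ₀ ≤ k) (ha : k ≤ a)
    (h : cardDist a b < k) : a = b := by
  have h1 : b ≤ a := by
    refine (le_add_cardDist a b).trans ?_
    exact (add_eq_left (hk.trans ha) (h.le.trans ha)).le
  refine le_antisymm (not_lt.1 fun hlt => ?_) h1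
  have h2 := le_add_cardDist b a
  rw [cardDist_comm] at h2
  exact absurd h2 (not_le.2 (add_lt_of_lt (hk.trans ha) hlt (h.trans_le ha)))

/-! ### The structures -/

/-- Infinite cardinals `κ < λ ≤ μ⁺`. -/
structure Triple where
  kappa : Cardinal.{u}
  lam : Cardinal.{u}
  mu : Cardinal.{u}
  aleph0_le : ℵ₀ ≤ kappa
  kappa_lt : kappa < lam
  lam_le : lam ≤ Order.succ mu

namespace Triple

variable (P : Triple.{u})

/-- The set `IS_n`; the trivial type is left out if `λ ≤ μ`. -/
abbrev IS (n : ℕ) : Type := {t : IsoType n // P.lam ≤ P.mu → ¬ t.IsTrivial}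

/-- The set `Card⁻` of the cardinals `ν < λ` with `ν = 0` or `κ ≤ ν`. -/
abbrev CardMinus : Type (u + 1) := {ν : Cardinal.{u} // ν < P.lam ∧ (ν = 0 ∨ P.kappa ≤ ν)}

/-- Replace a cardinal below `κ` by `0`. -/
noncomputable def trunc (ν : Cardinal.{u}) (h : ν < P.lam) : P.CardMinus :=
  open Classical in
  if hk : P.kappa ≤ ν then ⟨ν, h, Or.inr hk⟩ else ⟨0, zero_le.trans_lt h, Or.inl rfl⟩

/-- The functions `h` from `IS_n` to the cardinals below `λ` with sum less than `λ`, and with sum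
equal to `μ` if `λ = μ⁺`. -/
structure PreF (n : ℕ) where
  val : P.IS n → Cardinal.{u}
  val_lt : ∀ t, val t < P.lam
  sum_lt : Cardinal.sum val < P.lam
  sum_eq : P.lam = Order.succ P.mu → Cardinal.sum val = P.mu

/-- The equivalence relation `∑ |h(t) - h'(t)| < κ` (the appropriate one for `κ > ℵ₀`). -/
instance preFSetoid (n : ℕ) : Setoid (P.PreF n) where
  r h h' := Cardinal.sum (fun t => cardDist (h.val t) (h'.val t)) < P.kappa
  iseqv :=
    { refl := fun h => by
        simp only [cardDist_self, Cardinal.sum_const, mul_zero, Cardinal.lift_zero]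
        exact Cardinal.aleph0_pos.trans_le P.aleph0_le
      symm := fun {h h'} hh => by
        simpa only [cardDist_comm] using hh
      trans := fun {h h' h''} h1 h2 => by
        refine lt_of_le_of_lt ?_ (Cardinal.add_lt_of_lt P.aleph0_le h1 h2)
        rw [← Cardinal.sum_add_distrib']
        exact Cardinal.sum_le_sum _ _ fun t => cardDist_triangle _ _ _ }

/-- The set `F_n`. -/
def F (n : ℕ) : Type (u + 1) := Quotient (P.preFSetoid n)

theorem trunc_eq {a b : Cardinal.{u}} (ha : a < P.lam) (hb : b < P.lam)
    (hd : cardDist a b < P.kappa) : P.trunc a ha = P.trunc b hb := by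
  by_cases h1 : P.kappa ≤ a
  · have := eq_of_cardDist_lt P.aleph0_le h1 hd
    subst this
    rfl
  · by_cases h2 : P.kappa ≤ b
    · rw [cardDist_comm] at hd
      exact absurd (eq_of_cardDist_lt P.aleph0_le h2 hd ▸ h2) h1
    · rw [trunc, trunc, dif_neg h1, dif_neg h2]

/-- The function `App_n : F_n × IS_n → Card⁻`. -/
noncomputable def app {n : ℕ} (x : P.F n) (t : P.IS n) : P.CardMinus :=
  Quotient.lift (fun h : P.PreF n => P.trunc (h.val t) (h.val_lt t)) (fun h h' hh =>
    P.trunc_eq _ _ ((Cardinal.le_sum (fun t => cardDist (h.val t) (h'.val t)) t).trans_lt hh)) x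

/-- `Eq¹`: the pairs of equal permutations. -/
def Eq1 (t : P.IS 2) : Prop := ∃ a : TransTuple 2, a.type = t.1 ∧ a.perm 0 = a.perm 1

/-- `Prod¹`: the triples with `g₁ g₂ = g₃`, permutations acting on the right. -/
def Prod1 (t : P.IS 3) : Prop :=
  ∃ a : TransTuple 3, a.type = t.1 ∧ ∀ x, a.perm 1 (a.perm 0 x) = a.perm 2 x

/-- `Proj¹_n`: `t₂` is the type of an orbit of the first `n` entries of a tuple of type `t₁`. -/
def Proj1 {n : ℕ} (t₁ : P.IS (n + 1)) (t₂ : P.IS n) : Prop :=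
  ∃ (a₁ : TransTuple (n + 1)) (a₂ : TransTuple n), a₁.type = t₁.1 ∧ a₂.type = t₂.1 ∧
    ∃ hsub : a₂.carrier ⊆ a₁.carrier, ∀ (i : Fin n) (x : a₂.carrier),
      (a₂.perm i x : ℕ) = a₁.perm i.castSucc ⟨x, hsub x.2⟩

end Triple

/-- The sorts of `M*`; `is n` and `f n` stand for `IS_{n+1}` and `F_{n+1}`. -/
inductive MSort
  | is (n : ℕ)
  | card
  | f (n : ℕ)

/-- The signature of `M*`; `proj1 n` and `app n` stand for `Proj¹_{n+1}` and (the graph of)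
`App_{n+1}`. -/
inductive MRel
  | eq1
  | prod1
  | proj1 (n : ℕ)
  | lt
  | app (n : ℕ)

/-- The language of `M*`. -/
def langM : Lang where
  Srt := MSort
  Rel := MRel
  arity
    | .eq1 => 1
    | .prod1 => 1
    | .proj1 _ => 2
    | .lt => 2
    | .app _ => 3
  relSort
    | .eq1 => ![.is 1]
    | .prod1 => ![.is 2]
    | .proj1 n => ![.is (n + 1), .is n]
    | .lt => ![.card, .card]
    | .app n => ![.f n, .is n, .card]

/-- The domains of the sorts of `M*`. -/
def Triple.MCarrier (P : Triple.{u}) : MSort → Type (u + 1)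
  | .is n => ULift.{u + 1} (P.IS (n + 1))
  | .card => P.CardMinus
  | .f n => P.F (n + 1)

/-- The structure `M*_{κλμ}`. -/
noncomputable def Triple.MStar (P : Triple.{u}) : Struc.{u + 1} langM where
  carrier := P.MCarrier
  rel
    | .eq1, x => P.Eq1 (show ULift (P.IS 2) from x (0 : Fin 1)).down
    | .prod1, x => P.Prod1 (show ULift (P.IS 3) from x (0 : Fin 1)).down
    | .proj1 n, x => P.Proj1 (show ULift (P.IS (n + 2)) from x (0 : Fin 2)).down
        (show ULift (P.IS (n + 1)) from x (1 : Fin 2)).down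
    | .lt, x => (show P.CardMinus from x (0 : Fin 2)) < (show P.CardMinus from x (1 : Fin 2))
    | .app n, x => P.app (show P.F (n + 1) from x (0 : Fin 3)) (show ULift (P.IS (n + 1)) from x (1 : Fin 3)).down =
        (show P.CardMinus from x (2 : Fin 3))

/-! ### Cantor normal form to the base `Ω` -/

/-- `Ω = (2^ℵ₀)⁺`. -/
noncomputable def Omega : Ordinal.{w} := (Order.succ (2 ^ ℵ₀ : Cardinal.{w})).ord

/-- The coefficient `α_[n]` of `Ωⁿ` in the normal form of `α` to the base `Ω`. -/
noncomputable def coeff (α : Ordinal.{w}) (n : ℕ) : Ordinal.{w} := α / Omega ^ n % Omega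

/-- `α[n] = Ω^ω α_ω + ⋯ + Ω^{n+1} α_[n+1]`: the part of the normal form of `α` above `Ωⁿ`. -/
noncomputable def head (α : Ordinal.{w}) (n : ℕ) : Ordinal.{w} :=
  Omega ^ (n + 1) * (α / Omega ^ (n + 1))

theorem Omega_ne_zero : Omega.{w} ≠ 0 := by
  rw [Omega, Ne, Cardinal.ord_eq_zero]
  exact (Order.bot_lt_succ _).ne'

theorem div_mul_eq (a b c : Ordinal.{w}) (hb : b ≠ 0) : a / (b * c) = a / b / c := by
  conv_lhs => rw [← Ordinal.div_add_mod a b]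
  exact Ordinal.mul_add_div_mul (Ordinal.mod_lt _ hb) _ _

theorem coeff_lt (α : Ordinal.{w}) (n : ℕ) : coeff α n < Omega :=
  Ordinal.mod_lt _ Omega_ne_zero

theorem head_zero_add (α : Ordinal.{w}) : head α 0 + coeff α 0 = α := by
  simp [head, coeff, Ordinal.div_add_mod]

theorem head_succ_add (α : Ordinal.{w}) (n : ℕ) :
    head α (n + 1) + Omega ^ (n + 1) * coeff α (n + 1) = head α n := by
  rw [head, coeff, head, pow_succ Omega (n + 1), div_mul_eq _ _ _ (pow_ne_zero _ Omega_ne_zero),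
    mul_assoc, ← mul_add, Ordinal.div_add_mod]

theorem exists_head_eq (α : Ordinal.{w}) :
    ∃ N, ∀ n, N ≤ n → head α n = Omega ^ Ordinal.omega0 * (α / Omega ^ Ordinal.omega0) := by
  have hw : (Omega.{w} ^ Ordinal.omega0) ≠ 0 := Ordinal.opow_ne_zero _ Omega_ne_zero
  have h1 : α % Omega ^ Ordinal.omega0 < Omega ^ Ordinal.omega0 := Ordinal.mod_lt _ hw
  rw [Ordinal.lt_opow_of_isSuccLimit Omega_ne_zero Ordinal.isSuccLimit_omega0] at h1
  obtain ⟨c, hc, h2⟩ := h1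
  obtain ⟨N, rfl⟩ := Ordinal.lt_omega0.1 hc
  refine ⟨N, fun n hn => ?_⟩
  rw [Ordinal.opow_natCast] at h2
  have h3 : α % Omega ^ Ordinal.omega0 < Omega ^ (n + 1) :=
    h2.trans_le (pow_le_pow_right₀ (Order.one_le_iff_ne_zero.2 Omega_ne_zero) (by lia))
  have h4 : Omega.{w} ^ Ordinal.omega0 = Omega ^ (n + 1) * Omega ^ Ordinal.omega0 := by
    rw [← Ordinal.opow_natCast, ← Ordinal.opow_add, Ordinal.natCast_add_omega0]
  have hp : Omega.{w} ^ (n + 1) ≠ 0 := pow_ne_zero _ Omega_ne_zero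
  have h5 : α / Omega ^ (n + 1) = Omega ^ Ordinal.omega0 * (α / Omega ^ Ordinal.omega0) := by
    conv_lhs => rw [← Ordinal.div_add_mod α (Omega ^ Ordinal.omega0)]
    generalize α / Omega ^ Ordinal.omega0 = q at *
    rw [show Omega ^ Ordinal.omega0 * q = Omega ^ (n + 1) * (Omega ^ Ordinal.omega0 * q) by
      rw [← mul_assoc, ← h4], Ordinal.mul_add_div _ hp, Ordinal.div_eq_zero_of_lt h3, add_zero, ← mul_assoc, ← h4]
  rw [head, h5, ← mul_assoc, ← h4]

/-- `α^[n]`: this is `1 + cf(α[n])` if `cf(α[n]) < Ω`, and `0` otherwise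
(where `cf 0 = 0` and `cf (β + 1) = 1`). -/
noncomputable def cofCoeff (α : Ordinal.{w}) (n : ℕ) : Ordinal.{w} :=
  open Classical in
  if (head α n).cof.ord < Omega then 1 + (head α n).cof.ord else 0

/-- The order type `α(κ,λ,μ)` of `Card⁻`. -/
noncomputable def Triple.alpha (P : Triple.{u}) : Ordinal.{u + 1} :=
  Ordinal.type (fun x y : P.CardMinus => x < y)

/-! ### The second-order structure -/

/-- The basic sorts of `N²`; `is n`, `coeff n`, `cof n` stand for `IS_{n+1}`, `α_[n]`, `α^[n]`. -/
inductive NBase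
  | is (n : ℕ)
  | coeff (n : ℕ)
  | cof (n : ℕ)

/-- The sorts of `N²`: the basic ones and, for every tuple of basic sorts, a sort of relations. -/
inductive NSort
  | base (b : NBase)
  | rel (k : ℕ) (τ : Fin k → NBase)

/-- The signature of `N²`; `mem k τ` is the membership of a tuple of elements of the sorts `τ` in
a relation. -/
inductive NRel
  | eq1
  | prod1
  | proj1 (n : ℕ)
  | ltCoeff (n : ℕ)
  | ltCof (n : ℕ)
  | mem (k : ℕ) (τ : Fin k → NBase)

/-- The language of `N²`. -/
def langN : Lang where
  Srt := NSort
  Rel := NRel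
  arity
    | .eq1 => 1
    | .prod1 => 1
    | .proj1 _ => 2
    | .ltCoeff _ => 2
    | .ltCof _ => 2
    | .mem k _ => k + 1
  relSort
    | .eq1 => ![.base (.is 1)]
    | .prod1 => ![.base (.is 2)]
    | .proj1 n => ![.base (.is (n + 1)), .base (.is n)]
    | .ltCoeff n => ![.base (.coeff n), .base (.coeff n)]
    | .ltCof n => ![.base (.cof n), .base (.cof n)]
    | .mem k τ => Fin.cons (.rel k τ) fun i => .base (τ i)

/-- The domains of the basic sorts of `N²`; an ordinal is represented by a well-ordered set of that
order type. -/
def Triple.NBaseCarrier (P : Triple.{u}) : NBase → Type (u + 1)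
  | .is n => ULift.{u + 1} (P.IS (n + 1))
  | .coeff n => (coeff P.alpha n).ToType
  | .cof n => (cofCoeff P.alpha n).ToType

/-- The domains of the sorts of `N²`; a relation sort consists of all relations. -/
def Triple.NCarrier (P : Triple.{u}) : NSort → Type (u + 1)
  | .base b => P.NBaseCarrier b
  | .rel _ τ => Set (∀ i, P.NBaseCarrier (τ i))

/-- The structure `N²_{κλμ}` (for `cf κ > 2^ℵ₀`), the second-order variables being treated as
variables of the relation sorts. -/
noncomputable def Triple.NTwo (P : Triple.{u}) : Struc.{u + 1} langN where
  carrier := P.NCarrier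
  rel
    | .eq1, x => P.Eq1 (show ULift (P.IS 2) from x (0 : Fin 1)).down
    | .prod1, x => P.Prod1 (show ULift (P.IS 3) from x (0 : Fin 1)).down
    | .proj1 n, x => P.Proj1 (show ULift (P.IS (n + 2)) from x (0 : Fin 2)).down
        (show ULift (P.IS (n + 1)) from x (1 : Fin 2)).down
    | .ltCoeff n, x => (show (coeff P.alpha n).ToType from x (0 : Fin 2)) <
        (show (coeff P.alpha n).ToType from x (1 : Fin 2))
    | .ltCof n, x => (show (cofCoeff P.alpha n).ToType from x (0 : Fin 2)) <
        (show (cofCoeff P.alpha n).ToType from x (1 : Fin 2))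
    | .mem k τ, x => (fun i => (show P.NBaseCarrier (τ i) from x (Fin.succ i : Fin (k + 1)))) ∈
        (show Set (∀ i, P.NBaseCarrier (τ i)) from x (0 : Fin (k + 1)))

end PermQuot

/-! Every $IS_n$ has at most $2^{\aleph_0}$ elements, $IS_2$ has exactly that many, and
$2^{\aleph_0}<\kappa$. The sum conditions in the definition of $F_n$ therefore collapse: a function
from $IS_n$ to $Card^-$ that is bounded below $\lambda$ is $App_n(x,\cdot)$ for some $x$, provided
that it takes the value $\mu$ if $\lambda=\mu^+$ (`Triple.exists_app_eq`). So quantification over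
$F_n$ is quantification over bounded functions on a set of at most continuum size, and zero sets of
such functions code all proper subsets of $IS_n$.

Second-order objects. Two types can be paired into one type with one more permutation, whose
projections are these two (`Triple.exists_join`). Hence binary relations between the $IS_n$ are
coded by sets of types (`Triple.exists_codeRel`). All basic sorts of $\mathcal N^2$ have at most
$2^{\aleph_0}$ elements, so a relation on them is a family indexed by a proper subset of $IS_2$, and
it suffices to code each coordinate as a function on $IS_2$ (`Triple.exists_codeTuple`).

Ordinals. A bounded set $S\subseteq Card^-$ has at most $2^{\aleph_0}$ elements iff the values of
some $x\in F_2$ cover it (`Triple.exists_cover_iff`). The interval $[\gamma,\beta)$ contains more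
than $2^{\aleph_0}$ multiples of $\Omega^k$ iff $\gamma+\Omega^{k+1}\le\beta$
(`Triple.mk_multiples_le_iff`). By induction divisibility by $\Omega^k$ becomes definable, then the
initial segment $\alpha[n]$, and then the set of the $\alpha[n]+\Omega^n i$ with $i<\alpha_{[n]}$.
Comparing initial segments of $Card^-$ with this set defines $\alpha_{[n]}$ as an initial segment
(`Triple.inCoeff_iff`).

Cofinalities. If $\alpha[n]<\alpha$, all small families in $\alpha[n]$ are bounded in $Card^-$, so
its cofinality can be computed with elements of $F_2$ (`Triple.cofLt_iff`). The case
$\alpha[n]=\alpha$ separates the three claims. If $cf(\lambda)>2^{\aleph_0}$, then $\alpha^{[n]}=0$.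
Otherwise $\alpha^{[n]}=cf(\alpha)$, and cofinal families are unbounded, hence invisible to $F_2$.
If some coefficient is non-zero and $\alpha_{[m]}$ is the lowest such one, then
$cf(\alpha)=cf(\alpha_{[m]})$ can be computed in a proper initial segment
(`Triple.cofLt_inCoeff_iff`). If there is none, the element of rank $cf(\alpha)$ is taken as a
parameter.

Definability is shown for families of structures, one formula serving all members; the family of all
triples gives the uniformity in the first claim. -/

namespace PermQuot

/-! ### Definability in families of structures -/

section Definability

variable {L : Lang} {I : Type*} {A : I → Struc.{w} L}

theorem extend_map {S ι κ : Type} {σ : ι → S} {τ : κ → S} (f : ι → κ) (hf : ∀ j, τ (f j) = σ j)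
    (s : S) : ∀ j, extend τ s (Option.map f j) = extend σ s j
  | none => rfl
  | some j => hf j

/-- Rename the variables of a formula. -/
def Fml.rename : {ι κ : Type} → {σ : ι → L.Srt} → {τ : κ → L.Srt} → (f : ι → κ) →
    (∀ j, τ (f j) = σ j) → Fml L σ → Fml L τ
  | _, _, _, _, _, _, .falsum => .falsum
  | _, _, _, _, f, hf, .eq i j h => .eq (f i) (f j) (by rw [hf, hf, h])
  | _, _, _, _, f, hf, .rel R v h => .rel R (fun a => f (v a)) fun a => by rw [hf, h]
  | _, _, _, _, f, hf, .imp φ ψ => .imp (φ.rename f hf) (ψ.rename f hf)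
  | _, _, _, _, f, hf, .all s φ => .all s (φ.rename (Option.map f) (extend_map f hf s))

theorem Struc.sat_rename (B : Struc.{w} L) {ι : Type} {σ : ι → L.Srt} (φ : Fml L σ) :
    ∀ {κ : Type} {τ : κ → L.Srt} (f : ι → κ) (hf : ∀ j, τ (f j) = σ j) (e : B.Env τ),
      B.Sat (φ.rename f hf) e ↔ B.Sat φ fun j => cast (congrArg B.carrier (hf j)) (e (f j)) := by
  induction φ with
  | falsum => intros; rfl
  | eq i j h =>
    intro κ τ f hf e
    simp only [Fml.rename, Struc.Sat, cast_cast]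
    constructor
    · intro H
      rw [← H, cast_cast]
    · intro H
      have := congrArg (cast (congrArg B.carrier (hf j)).symm) H
      simpa only [cast_cast, cast_eq] using this
  | rel R v h =>
    intro κ τ f hf e
    simp only [Fml.rename, Struc.Sat, cast_cast]
  | imp φ ψ h1 h2 =>
    intro κ τ f hf e
    simp only [Fml.rename, Struc.Sat, h1, h2]
  | all s φ ih =>
    intro κ τ f hf e
    simp only [Fml.rename, Struc.Sat, ih]
    refine forall_congr' fun a => iff_of_eq (congrArg _ ?_)
    funext j
    cases j <;> rfl

/-- The functions of an assignment which return the value of a fixed variable. -/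
def IsVar (A : I → Struc.{w} L) {ι : Type} {σ : ι → L.Srt} (s : L.Srt)
    (t : ∀ i, (A i).Env σ → (A i).carrier s) : Prop :=
  ∃ j, ∃ h : σ j = s, ∀ i e, t i e = cast (congrArg (A i).carrier h) (e j)

/-- Uniform definability of a relation in a family of structures. -/
def Definable (A : I → Struc.{w} L) {ι : Type} {σ : ι → L.Srt}
    (S : ∀ i, (A i).Env σ → Prop) : Prop :=
  ∃ φ : Fml L σ, ∀ i e, (A i).Sat φ e ↔ S i e

theorem IsVar.proj {ι : Type} {σ : ι → L.Srt} (j : ι) :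
    IsVar A (σ := σ) (σ j) fun _ e => e j := ⟨j, rfl, fun _ _ => rfl⟩

theorem IsVar.last {ι : Type} {σ : ι → L.Srt} {s : L.Srt} :
    IsVar A (σ := extend σ s) s fun _ e => e none := ⟨none, rfl, fun _ _ => rfl⟩

theorem IsVar.weaken {ι : Type} {σ : ι → L.Srt} {s s' : L.Srt}
    {t : ∀ i, (A i).Env σ → (A i).carrier s} (ht : IsVar A s t) :
    IsVar A (σ := extend σ s') s fun i e => t i fun j => e (some j) := by
  obtain ⟨j, h, hj⟩ := ht
  exact ⟨some j, h, fun i e => hj i _⟩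

namespace Definable

variable {ι : Type} {σ : ι → L.Srt} {S T : ∀ i, (A i).Env σ → Prop}

theorem congr (hS : Definable A S) (h : ∀ i e, S i e ↔ T i e) : Definable A T := by
  obtain ⟨φ, hφ⟩ := hS
  exact ⟨φ, fun i e => (hφ i e).trans (h i e)⟩

theorem false : Definable A (σ := σ) fun _ _ => False := ⟨.falsum, fun _ _ => Iff.rfl⟩

theorem imp (hS : Definable A S) (hT : Definable A T) : Definable A fun i e => S i e → T i e := by
  obtain ⟨φ, hφ⟩ := hS
  obtain ⟨ψ, hψ⟩ := hT
  exact ⟨.imp φ ψ, fun i e => by rw [Struc.Sat, hφ, hψ]⟩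

theorem not (hS : Definable A S) : Definable A fun i e => ¬ S i e := hS.imp false

theorem true : Definable A (σ := σ) fun _ _ => True :=
  false.not.congr fun _ _ => by simp

theorem or (hS : Definable A S) (hT : Definable A T) : Definable A fun i e => S i e ∨ T i e :=
  (hS.not.imp hT).congr fun _ _ => by tauto

theorem and (hS : Definable A S) (hT : Definable A T) : Definable A fun i e => S i e ∧ T i e :=
  (hS.imp hT.not).not.congr fun _ _ => by tauto

theorem iff (hS : Definable A S) (hT : Definable A T) : Definable A fun i e => (S i e ↔ T i e) :=
  ((hS.imp hT).and (hT.imp hS)).congr fun _ _ => by tauto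

theorem all (s : L.Srt) {Q : ∀ i, (A i).Env σ → (A i).carrier s → Prop}
    (h : Definable A (σ := extend σ s) fun i e => Q i (fun j => e (some j)) (e none)) :
    Definable A fun i e => ∀ a, Q i e a := by
  obtain ⟨φ, hφ⟩ := h
  refine ⟨.all s φ, fun i e => ?_⟩
  rw [Struc.Sat]
  exact forall_congr' fun a => hφ i _

theorem ex (s : L.Srt) {Q : ∀ i, (A i).Env σ → (A i).carrier s → Prop}
    (h : Definable A (σ := extend σ s) fun i e => Q i (fun j => e (some j)) (e none)) :
    Definable A fun i e => ∃ a, Q i e a :=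
  (all s (Q := fun i e a => ¬ Q i e a) h.not).not.congr fun _ _ => by simp

theorem eq {s : L.Srt} {x y : ∀ i, (A i).Env σ → (A i).carrier s} (hx : IsVar A s x)
    (hy : IsVar A s y) : Definable A fun i e => x i e = y i e := by
  obtain ⟨j, rfl, hj⟩ := hx
  obtain ⟨k, h, hk⟩ := hy
  refine ⟨.eq j k h.symm, fun i e => ?_⟩
  show _ ↔ x i e = y i e
  rw [Struc.Sat, hj, hk, cast_eq, cast_eq_iff_heq, eq_comm (a := e j), cast_eq_iff_heq]
  exact ⟨HEq.symm, HEq.symm⟩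

theorem rel (R : L.Rel) {x : ∀ a, ∀ i, (A i).Env σ → (A i).carrier (L.relSort R a)}
    (hx : ∀ a, IsVar A _ (x a)) : Definable A fun i e => (A i).rel R fun a => x a i e := by
  choose v h hv using hx
  refine ⟨.rel R v h, fun i e => ?_⟩
  rw [Struc.Sat]
  simp only [hv]

theorem subst {κ : Type} {τ : κ → L.Srt} {S : ∀ i, (A i).Env τ → Prop} (hS : Definable A S)
    {t : ∀ k, ∀ i, (A i).Env σ → (A i).carrier (τ k)} (ht : ∀ k, IsVar A _ (t k)) :
    Definable A fun i e => S i fun k => t k i e := by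
  obtain ⟨φ, hφ⟩ := hS
  choose f hf h using ht
  refine ⟨φ.rename f hf, fun i e => ?_⟩
  rw [Struc.sat_rename, hφ]
  simp only [h]

/-- Needed for equality of coded relations, where the number of quantified variables depends on the
sort. The induction moves the first entry of the tuple into the context. -/
theorem all_pi : ∀ {k : ℕ} {ι : Type} {σ : ι → L.Srt} (τ : Fin k → L.Srt)
    {Q : ∀ i, (A i).Env σ → (A i).Env τ → Prop},
    Definable A (σ := Sum.elim σ τ) (fun i e => Q i (fun j => e (.inl j)) fun j => e (.inr j)) →
    Definable A fun i e => ∀ y, Q i e y := by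
  intro k
  induction k with
  | zero =>
    intro ι σ τ Q h
    refine (h.subst (σ := σ)
      (t := fun j => match j with
        | .inl j => fun _ e => e j
        | .inr a => a.elim0)
      (by rintro (j | a); exacts [IsVar.proj j, a.elim0])).congr fun i e => ?_
    exact ⟨fun H y => (congrArg (Q i e) (Subsingleton.elim _ _)).mp H, fun H => H _⟩
  | succ k ih =>
    intro ι σ τ Q h
    have h1 := h.subst (σ := Sum.elim (extend σ (τ 0)) fun j : Fin k => τ j.succ)
      (t := fun j => match j with
        | .inl j => fun _ e => e (.inl (some j))
        | .inr a => fun i e => Fin.cons (α := fun a => (A i).carrier (τ a)) (e (.inl none))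
            (fun b => e (.inr b)) a)
      (by
        rintro (j | a)
        · exact ⟨.inl (some j), rfl, fun _ _ => rfl⟩
        · refine Fin.cases ?_ (fun b => ?_) a
          · exact ⟨.inl none, rfl, fun _ _ => rfl⟩
          · exact ⟨.inr b, rfl, fun _ _ => rfl⟩)
    have h2 := Definable.all (τ 0) (Q := fun i e y => ∀ z : (A i).Env fun j : Fin k => τ j.succ,
      Q i e (Fin.cons (α := fun a => (A i).carrier (τ a)) y z)) (ih _
        (Q := fun i (e : (A i).Env (extend σ (τ 0))) z => Q i (fun j => e (some j))
          (Fin.cons (α := fun a => (A i).carrier (τ a)) (e none) z)) (h1.congr fun i e => by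
            refine iff_of_eq (congrArg _ ?_)
            funext a
            exact Fin.cases rfl (fun _ => rfl) a))
    refine h2.congr fun i e => ?_
    constructor
    · intro H y
      have := H (y 0) fun j => y j.succ
      convert this using 1
      funext a
      exact Fin.cases rfl (fun _ => rfl) a
    · intro H y z
      exact H _

theorem forall_fin : ∀ {k : ℕ} {S : Fin k → ∀ i, (A i).Env σ → Prop},
    (∀ a, Definable A (S a)) → Definable A fun i e => ∀ a, S a i e := by
  intro k
  induction k with
  | zero => intro S _; exact true.congr fun _ _ => by simp
  | succ k ih =>
    intro S h
    exact ((h 0).and (ih fun a => h a.succ)).congr fun _ _ => by rw [Fin.forall_fin_succ]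

end Definable

end Definability

/-! ### Realizations of isomorphism types -/

section Types

/-- A tuple of permutations generates a transitive group iff every nonempty invariant set is the
whole space. -/
theorem transitive_iff {X ι : Type} (g : ι → Equiv.Perm X) :
    (∀ x y, ∃ p ∈ Subgroup.closure (Set.range g), p x = y) ↔
      ∀ S : Set X, (∀ i x, g i x ∈ S ↔ x ∈ S) → ∀ x ∈ S, ∀ y, y ∈ S := by
  constructor
  · intro h S hS x hx y
    obtain ⟨p, hp, rfl⟩ := h x y
    have : ∀ z, p z ∈ S ↔ z ∈ S := by
      induction hp using Subgroup.closure_induction with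
      | mem p hp => obtain ⟨i, rfl⟩ := hp; exact hS i
      | one => simp
      | mul p q _ _ hp hq => intro z; rw [Equiv.Perm.mul_apply, hp, hq]
      | inv p _ hp => intro z; rw [← hp (p⁻¹ z)]; simp
    exact (this x).2 hx
  · intro h x y
    refine h {y | ∃ p ∈ Subgroup.closure (Set.range g), p x = y} ?_ x ⟨1, one_mem _, rfl⟩ y
    intro i z
    have hi : g i ∈ Subgroup.closure (Set.range g) := Subgroup.subset_closure ⟨i, rfl⟩
    constructor
    · rintro ⟨p, hp, h⟩
      exact ⟨(g i)⁻¹ * p, mul_mem (inv_mem hi) hp, by simp [h]⟩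
    · rintro ⟨p, hp, rfl⟩
      exact ⟨g i * p, mul_mem hi hp, rfl⟩

/-- The tuple `g` of permutations is of type `t`. -/
def Realizes {n : ℕ} (t : IsoType n) {X : Type} (g : Fin n → Equiv.Perm X) : Prop :=
  ∃ a : TransTuple n, a.type = t ∧ ∃ e : a.carrier ≃ X, ∀ i x, e (a.perm i x) = g i (e x)

variable {n : ℕ} {X Y : Type} {g : Fin n → Equiv.Perm X} {h : Fin n → Equiv.Perm Y}
  {t t' : IsoType n}

theorem TransTuple.realizes (a : TransTuple n) : Realizes a.type a.perm :=
  ⟨a, rfl, Equiv.refl _, fun _ _ => rfl⟩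

/-- Types can thus be built on any countable set, such as a disjoint union; the set is copied into
`ℕ` along an injection. -/
theorem exists_realizes [Countable X] [Nonempty X]
    (hg : ∀ S : Set X, (∀ i x, g i x ∈ S ↔ x ∈ S) → ∀ x ∈ S, ∀ y, y ∈ S) :
    ∃ t, Realizes t g := by
  obtain ⟨f, hf⟩ := exists_injective_nat X
  let e := Equiv.ofInjective f hf
  refine ⟨_, ⟨Set.range f, Set.range_nonempty f, fun i => e.symm.trans ((g i).trans e),
    (transitive_iff _).2 fun S hS x hx y => ?_⟩, rfl, e.symm, fun i x => by simp⟩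
  have := hg (e ⁻¹' S) (fun i z => by simpa using hS i (e z)) (e.symm x) (by simpa) (e.symm y)
  simpa using this

theorem Realizes.exists_equiv (hg : Realizes t g) (hh : Realizes t h) :
    ∃ e : X ≃ Y, ∀ i x, e (g i x) = h i (e x) := by
  obtain ⟨a, rfl, e, he⟩ := hg
  obtain ⟨b, hb, f, hf⟩ := hh
  obtain ⟨k, hk⟩ : b ≈ a := Quotient.exact hb
  refine ⟨e.symm.trans (k.symm.trans f), fun i x => ?_⟩
  have h1 : e.symm (g i x) = a.perm i (e.symm x) := by
    rw [Equiv.symm_apply_eq, he, Equiv.apply_symm_apply]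
  have h2 : ∀ y, k.symm (a.perm i y) = b.perm i (k.symm y) := fun y => by
    rw [Equiv.symm_apply_eq, hk, Equiv.apply_symm_apply]
  simp [h1, h2, hf]

theorem Realizes.eq_of_equiv (hg : Realizes t g) (hh : Realizes t' h)
    (e : X ≃ Y) (he : ∀ i x, e (g i x) = h i (e x)) : t = t' := by
  obtain ⟨a, rfl, k, hk⟩ := hg
  obtain ⟨b, rfl, l, hl⟩ := hh
  refine Quotient.sound ⟨k.trans (e.trans l.symm), fun i x => ?_⟩
  simp [hk, he, Equiv.symm_apply_eq, hl]

theorem Realizes.nonempty (hg : Realizes t g) : Nonempty X := by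
  obtain ⟨a, -, e, -⟩ := hg
  exact ⟨e ⟨_, a.nonempty.some_mem⟩⟩

theorem Realizes.countable (hg : Realizes t g) : Countable X := by
  obtain ⟨a, -, e, -⟩ := hg
  exact e.symm.injective.countable

theorem Realizes.mem_of_invariant (hg : Realizes t g) (S : Set X) (hS : ∀ i x, g i x ∈ S ↔ x ∈ S)
    {x : X} (hx : x ∈ S) (y : X) : y ∈ S := by
  obtain ⟨a, -, e, he⟩ := hg
  have := (transitive_iff a.perm).1 a.transitive (e ⁻¹' S)
    (fun i z => by simp only [Set.mem_preimage, he, hS]) (e.symm x) (by simpa) (e.symm y)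
  simpa using this

/-- The image of an equivariant injection is invariant and nonempty, so by transitivity it is
everything. -/
theorem Realizes.eq_of_injective (hg : Realizes t g) (hh : Realizes t' h) (f : X → Y)
    (hf : Function.Injective f) (he : ∀ i x, f (g i x) = h i (f x)) : t = t' := by
  refine hg.eq_of_equiv hh (Equiv.ofBijective f ⟨hf, fun y => ?_⟩) he
  obtain ⟨x⟩ := hg.nonempty
  refine hh.mem_of_invariant (Set.range f) (fun i z => ?_) ⟨x, rfl⟩ y
  constructor
  · rintro ⟨w, hw⟩
    exact ⟨(g i).symm w, (h i).injective (by rw [← he, Equiv.apply_symm_apply, hw])⟩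
  · rintro ⟨w, rfl⟩
    exact ⟨g i w, he i w⟩

theorem Realizes.isTrivial_iff (hg : Realizes t g) : t.IsTrivial ↔ ∀ i, g i = 1 := by
  constructor
  · rintro ⟨a, rfl, ha⟩ i
    obtain ⟨e, he⟩ := a.realizes.exists_equiv hg
    ext x
    rw [← e.apply_symm_apply x, ← he, ha]
    rfl
  · intro h1
    obtain ⟨a, rfl, e, he⟩ := hg
    refine ⟨a, rfl, fun i => ?_⟩
    ext x
    have : e (a.perm i x) = e x := by rw [he, h1]; rfl
    rw [e.injective this]
    rfl

theorem IsoType.exists_realizes (t : IsoType n) :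
    ∃ (X : Type) (g : Fin n → Equiv.Perm X), Realizes t g := by
  induction t using Quotient.inductionOn with
  | _ a => exact ⟨_, _, a.realizes⟩

/-- The last permutation is the identity. -/
def IsoType.LastId (t : IsoType (n + 1)) : Prop :=
  ∃ (X : Type) (g : Fin (n + 1) → Equiv.Perm X), Realizes t g ∧ g (Fin.last n) = 1

theorem Realizes.lastId_iff {t : IsoType (n + 1)} {g : Fin (n + 1) → Equiv.Perm X}
    (hg : Realizes t g) : t.LastId ↔ g (Fin.last n) = 1 := by
  refine ⟨fun ⟨Y, h, hh, h1⟩ => ?_, fun h => ⟨X, g, hg, h⟩⟩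
  obtain ⟨e, he⟩ := hh.exists_equiv hg
  ext x
  rw [← e.apply_symm_apply x, ← he, h1]
  rfl

end Types

/-! ### Projections of types, pairing of types, and the number of types -/

namespace Triple

variable (P : Triple.{u}) {n : ℕ}

/-- An orbit is the image of an equivariant embedding of a transitive tuple. This form can be
checked on arbitrary realizations instead of subsets of `ℕ`. -/
theorem proj1_iff {X Y : Type} {t₁ : P.IS (n + 1)} {t₂ : P.IS n} {g : Fin (n + 1) → Equiv.Perm X}
    {h : Fin n → Equiv.Perm Y} (hg : Realizes t₁.1 g) (hh : Realizes t₂.1 h) :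
    P.Proj1 t₁ t₂ ↔
      ∃ f : Y → X, Function.Injective f ∧ ∀ i y, f (h i y) = g i.castSucc (f y) := by
  constructor
  · rintro ⟨a, b, ha, hb, hsub, hp⟩
    obtain ⟨e, he⟩ := (ha ▸ a.realizes).exists_equiv hg
    obtain ⟨k, hk⟩ := hh.exists_equiv (hb ▸ b.realizes)
    refine ⟨fun y => e ⟨k y, hsub (k y).2⟩, fun y z hyz => ?_, fun i y => ?_⟩
    · have := e.injective hyz
      simp only [Subtype.mk.injEq] at this
      exact k.injective (Subtype.ext this)
    · rw [← he]
      exact congrArg e (Subtype.ext ((congrArg Subtype.val (hk i y)).trans (hp i (k y))))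
  · rintro ⟨f, hf, hp⟩
    obtain ⟨a, ha, e, he⟩ := hg
    let φ : Y → ℕ := fun y => (e.symm (f y) : ℕ)
    have hφ : Function.Injective φ := Subtype.val_injective.comp (e.symm.injective.comp hf)
    let k := Equiv.ofInjective φ hφ
    have := hh.nonempty
    refine ⟨a, ⟨Set.range φ, Set.range_nonempty φ, fun i => k.symm.trans ((h i).trans k),
      (transitive_iff _).2 fun S hS x hx y => ?_⟩, ha, ?_, ?_, ?_⟩
    · have := hh.mem_of_invariant (k ⁻¹' S) (fun i z => by simpa using hS i (k z))
        (x := k.symm x) (by simpa) (k.symm y)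
      simpa using this
    · exact ((TransTuple.realizes _).eq_of_equiv hh k.symm fun i x => by simp)
    · rintro _ ⟨y, rfl⟩
      exact Subtype.coe_prop _
    · rintro i ⟨_, ⟨y, rfl⟩⟩
      have h1 : k.symm ⟨φ y, y, rfl⟩ = y := by rw [Equiv.symm_apply_eq]; rfl
      simp only [Equiv.trans_apply, h1]
      change ((e.symm (f (h i y)) : a.carrier) : ℕ) = _
      congr 1
      rw [Equiv.symm_apply_eq, he, hp]
      exact congrArg _ (e.apply_symm_apply (f y)).symm

/-- Append the identity: the first $n$ permutations keep their single orbit. -/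
theorem exists_lift (t : P.IS n) :
    ∃ l : P.IS (n + 1), l.1.LastId ∧ ∀ z, P.Proj1 l z ↔ z = t := by
  obtain ⟨X, g, hg⟩ := t.1.exists_realizes
  have := hg.nonempty
  have := hg.countable
  obtain ⟨l, hl⟩ := exists_realizes (X := X) (g := (Fin.snoc g 1 : Fin (n + 1) → Equiv.Perm X))
    fun S hS x hx y => hg.mem_of_invariant S (fun i x => by simpa using hS i.castSucc x) hx y
  refine ⟨⟨l, fun hP h => t.2 hP ?_⟩, hl.lastId_iff.2 (by simp), fun z => ?_⟩
  · rw [hl.isTrivial_iff] at h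
    rw [hg.isTrivial_iff]
    intro i
    simpa using h i.castSucc
  · obtain ⟨Y, k, hk⟩ := z.1.exists_realizes
    rw [P.proj1_iff (t₁ := ⟨l, _⟩) hl hk]
    constructor
    · rintro ⟨f, hf, hp⟩
      exact Subtype.ext (hk.eq_of_injective hg f hf fun i y => by simpa using hp i y)
    · rintro rfl
      obtain ⟨e, he⟩ := hk.exists_equiv hg
      exact ⟨e, e.injective, fun i y => by simpa using he i y⟩

/-- On the disjoint union of realizations of `c` and `d` let the new permutation swap one point of
each. This makes the tuple transitive, while the first $n$ entries have the two summands as orbits.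
The swap is not the identity, so the result is never the omitted type, and it differs from every
lift by the identity. An embedding of a transitive tuple stays in one summand, since the side of the
image is invariant. -/
theorem exists_join (c d : P.IS n) :
    ∃ l : P.IS (n + 1), ¬ l.1.LastId ∧ ∀ z, P.Proj1 l z ↔ z = c ∨ z = d := by
  classical
  obtain ⟨X, g, hg⟩ := c.1.exists_realizes
  obtain ⟨Y, h, hh⟩ := d.1.exists_realizes
  have := hg.countable
  have := hh.countable
  obtain ⟨x₀⟩ := hg.nonempty
  obtain ⟨y₀⟩ := hh.nonempty
  have : Nonempty (X ⊕ Y) := ⟨.inl x₀⟩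
  let p : Fin (n + 1) → Equiv.Perm (X ⊕ Y) :=
    Fin.snoc (fun i => Equiv.sumCongr (g i) (h i)) (Equiv.swap (.inl x₀) (.inr y₀))
  have hp1 : ∀ i : Fin n, p i.castSucc = Equiv.sumCongr (g i) (h i) := fun i => by simp [p]
  have hp2 : p (Fin.last n) = Equiv.swap (.inl x₀) (.inr y₀) := by simp [p]
  have hp3 : p (Fin.last n) ≠ 1 := by
    intro hp
    have := congrArg (fun q : Equiv.Perm (X ⊕ Y) => q (.inl x₀)) (hp2.symm.trans hp)
    simp at this
  obtain ⟨l, hl⟩ := exists_realizes (g := p) <| by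
    intro S hS x hx y
    have h1 : ∀ x x', Sum.inl x ∈ S → Sum.inl x' ∈ S := fun x x' hx =>
      hg.mem_of_invariant (Sum.inl ⁻¹' S) (fun i z => by simpa [hp1] using hS i.castSucc (.inl z)) hx x'
    have h2 : ∀ x x', Sum.inr x ∈ S → Sum.inr x' ∈ S := fun x x' hx =>
      hh.mem_of_invariant (Sum.inr ⁻¹' S) (fun i z => by simpa [hp1] using hS i.castSucc (.inr z)) hx x'
    have h3 : Sum.inr y₀ ∈ S ↔ Sum.inl x₀ ∈ S := by simpa [hp2] using hS (Fin.last n) (.inl x₀)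
    rcases x with x | x <;> rcases y with y | y
    · exact h1 _ _ hx
    · exact h2 _ _ (h3.2 (h1 _ _ hx))
    · exact h1 _ _ (h3.1 (h2 _ _ hx))
    · exact h2 _ _ hx
  refine ⟨⟨l, fun hP ht => hp3 (hl.isTrivial_iff.1 ht _)⟩, fun h => hp3 (hl.lastId_iff.1 h), fun z => ?_⟩
  obtain ⟨Z, k, hk⟩ := z.1.exists_realizes
  rw [P.proj1_iff (t₁ := ⟨l, _⟩) hl hk]
  constructor
  · rintro ⟨f, hf, hp⟩
    simp only [hp1] at hp
    have hinv : ∀ i x, k i x ∈ {z | (f z).isLeft} ↔ x ∈ {z | (f z).isLeft} := by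
      intro i x
      change (f (k i x)).isLeft ↔ (f x).isLeft
      rw [hp]
      rcases f x with y | y <;> simp
    by_cases hz : ∃ z, (f z).isLeft
    · obtain ⟨z₀, hz⟩ := hz
      have hall : ∀ z, ∃ x, f z = .inl x := fun z =>
        Sum.isLeft_iff.1 (hk.mem_of_invariant {z | (f z).isLeft} hinv hz z)
      choose f' hf' using hall
      refine Or.inl (Subtype.ext (hk.eq_of_injective hg f' (fun a b hab => hf ?_) fun i y => ?_))
      · rw [hf', hf', hab]
      · have := hp i y
        rw [hf', hf'] at this
        simpa using this
    · push Not at hz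
      have hall : ∀ z, ∃ x, f z = .inr x := fun z => Sum.isRight_iff.1 (by simpa using hz z)
      choose f' hf' using hall
      refine Or.inr (Subtype.ext (hk.eq_of_injective hh f' (fun a b hab => hf ?_) fun i y => ?_))
      · rw [hf', hf', hab]
      · have := hp i y
        rw [hf', hf'] at this
        simpa using this
  · rintro (rfl | rfl)
    · obtain ⟨e, he⟩ := hk.exists_equiv hg
      exact ⟨fun z => .inl (e z), Sum.inl_injective.comp e.injective, fun i y => by simp [hp1, he]⟩
    · obtain ⟨e, he⟩ := hk.exists_equiv hh
      exact ⟨fun z => .inr (e z), Sum.inr_injective.comp e.injective, fun i y => by simp [hp1, he]⟩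

open Classical in
/-- Move the point `0` of each part by `d` parts. -/
noncomputable def moveZero (f : ℤ → ℕ) (d : ℤ) (x : Σ k : ℤ, ZMod (f k)) : Σ k : ℤ, ZMod (f k) :=
  if x.2 = 0 then ⟨x.1 + d, 0⟩ else x

theorem moveZero_zero (f : ℤ → ℕ) (d k : ℤ) : moveZero f d ⟨k, 0⟩ = ⟨k + d, 0⟩ := if_pos rfl

theorem moveZero_moveZero {f : ℤ → ℕ} {d d' : ℤ} (h : d + d' = 0) (x : Σ k : ℤ, ZMod (f k)) :
    moveZero f d' (moveZero f d x) = x := by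
  obtain ⟨k, i⟩ := x
  by_cases hi : i = 0
  · subst hi
    rw [moveZero_zero, moveZero_zero, add_assoc, h, add_zero]
  · have : ∀ d, moveZero f d ⟨k, i⟩ = ⟨k, i⟩ := fun d => if_neg hi
    rw [this, this]

/-- The permutation moving the point `0` of each part to the next part. -/
noncomputable def shiftZero (f : ℤ → ℕ) : Equiv.Perm (Σ k : ℤ, ZMod (f k)) where
  toFun := moveZero f 1
  invFun := moveZero f (-1)
  left_inv := moveZero_moveZero (by simp)
  right_inv := moveZero_moveZero (by simp)

/-- The set `S` is stored as the set of cycle lengths of the first permutation, an infinite cycle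
having length `0` in accordance with `ZMod 0 = ℤ`. The second permutation links the cycles through
their zero points. -/
theorem exists_injective_IS : ∃ f : {S : Set ℕ // S.Nonempty} → P.IS 2, Function.Injective f := by
  have key : ∀ S : {S : Set ℕ // S.Nonempty}, ∃ t : P.IS 2, ∀ (X : Type) (g : Fin 2 → Equiv.Perm X),
      Realizes t.1 g → ∀ m, m ∈ S.1 ↔ ∃ x, ∀ j, (g 0)^[j] x = x ↔ m ∣ j := by
    rintro ⟨S, hS⟩
    have := hS.to_subtype
    obtain ⟨f, hf⟩ := exists_surjective_nat S
    -- The cycles are indexed by `ℤ` instead of `ℕ` so that the shift to the next cycle is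
    -- invertible; each length may occur many times.
    let F : ℤ → ℕ := fun k => f k.natAbs
    let p : Fin 2 → Equiv.Perm (Σ k : ℤ, ZMod (F k)) :=
      ![Equiv.sigmaCongrRight fun k => Equiv.addLeft 1, shiftZero F]
    have hc : ∀ k, Countable (ZMod (F k)) := fun k => by
      rcases hk : F k with _ | m
      · exact inferInstanceAs (Countable ℤ)
      · exact inferInstanceAs (Countable (Fin (m + 1)))
    have h0 : ∀ k i, p 0 ⟨k, i⟩ = ⟨k, 1 + i⟩ := fun k i => rfl
    have h1 : ∀ k, p 1 ⟨k, 0⟩ = ⟨k + 1, 0⟩ := fun k => moveZero_zero F 1 k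
    obtain ⟨t, ht⟩ := exists_realizes (g := p) <| by
      intro S hS x hx y
      have a1 : ∀ k, ∀ i : ZMod (F k), (⟨k, i⟩ : Σ k : ℤ, ZMod (F k)) ∈ S ↔ ⟨k, 0⟩ ∈ S := by
        intro k i
        obtain ⟨m, rfl⟩ := ZMod.intCast_surjective i
        induction m using Int.induction_on with
        | zero => simp
        | succ m ih => 
          rw [← ih, ← hS 0 ⟨k, ((m : ℤ) : ZMod _)⟩, h0]
          push_cast
          rw [add_comm]
        | pred m ih => 
          rw [← ih, ← hS 0 ⟨k, ((-(m : ℤ) - 1 : ℤ) : ZMod _)⟩, h0]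
          push_cast
          ring_nf
      have a2 : ∀ k : ℤ, (⟨k, 0⟩ : Σ k : ℤ, ZMod (F k)) ∈ S ↔ ⟨0, 0⟩ ∈ S := by
        intro k
        induction k using Int.induction_on with
        | zero => rfl
        | succ m ih => rw [← ih, ← hS 1 ⟨m, 0⟩, h1]
        | pred m ih => rw [← ih, ← hS 1 ⟨-m - 1, 0⟩, h1, sub_add_cancel]
      rw [a1, a2, ← a2 x.1, ← a1 x.1 x.2]
      exact hx
    refine ⟨⟨t, fun _ h => ?_⟩, fun X g hg m => ?_⟩
    · have h2 := h1 0
      rw [ht.isTrivial_iff.1 h 1] at h2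
      have := congrArg Sigma.fst h2
      simp at this
    · obtain ⟨e, he⟩ := ht.exists_equiv hg
      have hper : ∀ x j, (g 0)^[j] (e x) = e x ↔ (p 0)^[j] x = x := by
        intro x j
        rw [← ((Function.Semiconj.iterate_right (f := e) (fun x => he 0 x) j) x), e.injective.eq_iff]
      have hper2 : ∀ k i j, (p 0)^[j] ⟨k, i⟩ = ⟨k, i⟩ ↔ F k ∣ j := by
        intro k i j
        have : ∀ m : ℕ, (p 0)^[m] ⟨k, i⟩ = ⟨k, m + i⟩ := by
          intro m
          induction m with
          | zero => simp
          | succ m ih => rw [Function.iterate_succ_apply', ih, h0]; push_cast; ring_nf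
        rw [this, Sigma.mk.injEq, heq_eq_eq, ← ZMod.natCast_eq_zero_iff]
        simp
      constructor
      · intro hm
        obtain ⟨k, hk⟩ := hf ⟨m, hm⟩
        refine ⟨e ⟨k, 0⟩, fun j => ?_⟩
        rw [hper, hper2]
        simp [F, hk]
      · rintro ⟨x, hx⟩
        obtain ⟨⟨k, i⟩, rfl⟩ := e.surjective x
        simp only [hper, hper2] at hx
        have : F k = m := Nat.dvd_antisymm ((hx m).2 dvd_rfl) ((hx (F k)).1 dvd_rfl)
        exact this ▸ (f k.natAbs).2
  choose f hf using key
  refine ⟨f, fun S T hST => ?_⟩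
  obtain ⟨X, g, hg⟩ := (f S).1.exists_realizes
  refine Subtype.ext (Set.ext fun m => ?_)
  rw [hf S X g hg, hf T X g (hST ▸ hg)]

/-- A tuple is determined by a subset of `ℕ` and the graphs of $n$ permutations. -/
theorem mk_IS_le : #(P.IS n) ≤ 2 ^ ℵ₀ := by
  let c : TransTuple n → Set ℕ × (Fin n → Set (ℕ × ℕ)) := fun a =>
    (a.carrier, fun i => {x | ∃ h : x.1 ∈ a.carrier, (a.perm i ⟨x.1, h⟩ : ℕ) = x.2})
  have hc : Function.Injective c := by
    rintro ⟨A, hA, p, hp⟩ ⟨B, hB, q, hq⟩ h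
    obtain rfl : A = B := congrArg Prod.fst h
    have h2 : ∀ i, {x : ℕ × ℕ | ∃ h : x.1 ∈ A, (p i ⟨x.1, h⟩ : ℕ) = x.2} =
        {x : ℕ × ℕ | ∃ h : x.1 ∈ A, (q i ⟨x.1, h⟩ : ℕ) = x.2} := fun i =>
      congrFun (congrArg Prod.snd h) i
    have : p = q := by
      funext i
      ext x
      have : ((x : ℕ), (p i x : ℕ)) ∈ {x : ℕ × ℕ | ∃ h : x.1 ∈ A, (q i ⟨x.1, h⟩ : ℕ) = x.2} :=
        h2 i ▸ ⟨x.2, rfl⟩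
      obtain ⟨_, h⟩ := this
      exact h.symm
    subst this
    rfl
  have h1 : #(P.IS n) ≤ #(TransTuple n) :=
    (mk_subtype_le _).trans (mk_le_of_surjective (Quotient.mk_surjective))
  refine h1.trans ((mk_le_of_injective hc).trans ?_)
  have h2 : (2 ^ ℵ₀ : Cardinal.{0}) ^ n ≤ 2 ^ ℵ₀ := by
    rw [← Cardinal.power_natCast, ← Cardinal.power_mul]
    exact power_le_power_left two_ne_zero (by
      rcases n with _ | n
      · simp
      · rw [aleph0_mul_nat n.succ_ne_zero])
  have h3 : #(Set (ℕ × ℕ)) = 2 ^ ℵ₀ := by rw [mk_set]; simp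
  rw [mk_prod, Cardinal.lift_id, Cardinal.lift_id, mk_arrow, Cardinal.lift_id, Cardinal.lift_id, h3, mk_set, mk_nat, mk_fin, Cardinal.power_natCast]
  exact (mul_le_mul' le_rfl h2).trans (mul_eq_self (aleph0_le_continuum)).le

end Triple

/-! ### Coding by elements of `F_n` -/

namespace Triple

variable (P : Triple.{u}) {n : ℕ}

/-- The second argument is obtained from the first one by repeated projection. -/
def ProjIter : (m n : ℕ) → P.IS (m + 1) → P.IS (n + 1) → Prop
  | 0, n, a, b => 0 = n ∧ HEq a b
  | m + 1, n, a, b => (m + 1 = n ∧ HEq a b) ∨ ∃ z, P.Proj1 a z ∧ ProjIter m n z b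

theorem not_projIter : ∀ {m n : ℕ}, m < n → ∀ (a : P.IS (m + 1)) (b : P.IS (n + 1)),
    ¬ P.ProjIter m n a b
  | 0, _, h, _, _ => fun H => h.ne H.1
  | m + 1, n, h, a, b => by
    rintro (H | ⟨z, -, H⟩)
    · exact h.ne H.1
    · exact not_projIter (by lia) _ _ H

theorem projIter_self (a b : P.IS (n + 1)) : P.ProjIter n n a b ↔ a = b := by
  cases n with
  | zero => simp [ProjIter]
  | succ n =>
    rw [ProjIter]
    constructor
    · rintro (H | ⟨z, -, H⟩)
      · exact eq_of_heq H.2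
      · exact absurd H (P.not_projIter (Nat.lt_succ_self n) _ _)
    · rintro rfl
      exact Or.inl ⟨rfl, HEq.rfl⟩

theorem projIter_succ {m n : ℕ} (h : n ≤ m) (a : P.IS (m + 1 + 1)) (b : P.IS (n + 1)) :
    P.ProjIter (m + 1) n a b ↔ ∃ z, P.Proj1 a z ∧ P.ProjIter m n z b := by
  rw [ProjIter]
  exact or_iff_right fun h' => by lia

theorem exists_iterLift {m n : ℕ} (h : n ≤ m) (a : P.IS (n + 1)) :
    ∃ l : P.IS (m + 1), ∀ z, P.ProjIter m n l z ↔ z = a := by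
  induction m, h using Nat.le_induction with
  | base => exact ⟨a, fun z => by rw [projIter_self, eq_comm]⟩
  | succ m h ih =>
    obtain ⟨l, hl⟩ := ih
    obtain ⟨k, -, hk⟩ := P.exists_lift l
    refine ⟨k, fun z => ?_⟩
    rw [P.projIter_succ h]
    simp [hk, hl]

theorem aleph0_le_two_power : ℵ₀ ≤ (2 : Cardinal.{u}) ^ ℵ₀ := (cantor _).le

theorem two_power_lt (hκ : (2 : Cardinal.{u}) ^ ℵ₀ < P.kappa.ord.cof) : 2 ^ ℵ₀ < P.kappa :=
  hκ.trans_le ((cof_le_card _).trans (by rw [card_ord]))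

theorem lift_mk_IS_le : Cardinal.lift.{u} #(P.IS n) ≤ 2 ^ ℵ₀ := by
  have := Cardinal.lift_le.{u}.2 (P.mk_IS_le (n := n))
  simpa using this

theorem val_app_mk (h : P.PreF n) (t : P.IS n) :
    P.app (Quotient.mk _ h) t = P.trunc (h.val t) (h.val_lt t) := rfl

theorem trunc_val (ν : P.CardMinus) : P.trunc ν.1 ν.2.1 = ν := by
  unfold trunc
  split_ifs with h
  · rfl
  · exact Subtype.ext (ν.2.2.resolve_right h).symm

/-- There are at most $2^{\aleph_0}<\kappa$ summands, so a bound $b\ge\kappa$ on the values also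
bounds the sum. Thus boundedness gives a sum below $\lambda$, and for $\lambda=\mu^+$ the sum is
$\mu$ as soon as one value is. Truncation does not change values in $Card^-$. -/
theorem exists_app_eq (hκ : (2 : Cardinal.{u}) ^ ℵ₀ < P.kappa.ord.cof) (v : P.IS n → P.CardMinus)
    (hb : ∃ b, ∀ t, v t ≤ b) (hμ : P.lam = Order.succ P.mu → ∃ t, (v t).1 = P.mu) :
    ∃ x : P.F n, ∀ t, P.app x t = v t := by
  obtain ⟨b, hb⟩ := hb
  have h1 : ∀ b : Cardinal.{u}, P.kappa ≤ b → (∀ t, (v t).1 ≤ b) →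
      Cardinal.sum (fun t => (v t).1) ≤ b := by
    intro b hκb hb
    refine (Cardinal.sum_le_sum _ (fun _ => b) hb).trans ?_
    rw [Cardinal.sum_const, Cardinal.lift_id'.{0, u}]
    refine (mul_le_mul_left (P.lift_mk_IS_le.trans ((P.two_power_lt hκ).le.trans hκb)) _).trans ?_
    exact (mul_eq_self (P.aleph0_le.trans hκb)).le
  refine ⟨Quotient.mk _ ⟨fun t => (v t).1, fun t => (v t).2.1, ?_, fun hl => ?_⟩, fun t => ?_⟩
  · exact (h1 (max b.1 P.kappa) (le_max_right _ _) fun t => le_max_of_le_left (hb t)).trans_lt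
      (max_lt b.2.1 P.kappa_lt)
  · refine le_antisymm (h1 _ ?_ fun t => ?_) ?_
    · exact Order.lt_succ_iff.1 (hl ▸ P.kappa_lt)
    · exact Order.lt_succ_iff.1 (hl ▸ (v t).2.1)
    · obtain ⟨t, ht⟩ := hμ hl
      exact ht ▸ Cardinal.le_sum (fun t => (v t).1) t
  · rw [val_app_mk, trunc_val]

/-- A function given on a proper subset of `IS_n` is represented by an element of `F_n`, if it is
bounded. -/
theorem exists_app_eqOn (hκ : (2 : Cardinal.{u}) ^ ℵ₀ < P.kappa.ord.cof) {D : Set (P.IS n)}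
    (hD : D ≠ Set.univ) (v : P.IS n → P.CardMinus) (hb : ∃ b, ∀ t ∈ D, v t ≤ b) :
    ∃ x : P.F n, (∀ t ∈ D, P.app x t = v t) ∧ ∀ t ∉ D, (P.app x t).1 ≠ 0 := by
  classical
  -- The value `c` is assigned off `D`. It is non-zero, so that zero sets can code subsets, and it
  -- is $\mu$ if $\lambda=\mu^+$, which supplies the required sum. The latter is why `D` has to be
  -- proper.
  have hc : ∃ c : P.CardMinus, c.1 ≠ 0 ∧ (P.lam = Order.succ P.mu → c.1 = P.mu) := by
    by_cases hl : P.lam = Order.succ P.mu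
    · have h : P.kappa ≤ P.mu := Order.lt_succ_iff.1 (hl ▸ P.kappa_lt)
      exact ⟨⟨P.mu, hl ▸ Order.lt_succ _, Or.inr h⟩,
        (aleph0_pos.trans_le (P.aleph0_le.trans h)).ne', fun _ => rfl⟩
    · exact ⟨⟨P.kappa, P.kappa_lt, Or.inr le_rfl⟩, (aleph0_pos.trans_le P.aleph0_le).ne',
        fun h => absurd h hl⟩
  obtain ⟨c, hc0, hc⟩ := hc
  obtain ⟨b, hb⟩ := hb
  obtain ⟨t₀, ht₀⟩ := (Set.ne_univ_iff_exists_notMem D).1 hD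
  obtain ⟨x, hx⟩ := P.exists_app_eq hκ (fun t => if t ∈ D then v t else c)
    ⟨max b c, fun t => by
      split_ifs with h
      · exact le_max_of_le_left (hb t h)
      · exact le_max_right _ _⟩
    (fun h => ⟨t₀, by rw [if_neg ht₀, hc h]⟩)
  exact ⟨x, fun t ht => by rw [hx, if_pos ht], fun t ht => by rwa [hx, if_neg ht]⟩

/-- Membership in the subset of `IS_n` represented by an element of `F_n`. -/
def CodeMem (x : P.F n) (t : P.IS n) : Prop := ∃ z, P.app x t = z ∧ ∀ c, ¬ c < z

variable {P} in
theorem codeMem_iff {x : P.F n} {t : P.IS n} : P.CodeMem x t ↔ (P.app x t).1 = 0 := by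
  constructor
  · rintro ⟨z, rfl, h⟩
    by_contra h0
    refine h ⟨0, zero_le.trans_lt P.kappa_lt, Or.inl rfl⟩ ?_
    exact pos_iff_ne_zero.2 h0
  · intro h
    refine ⟨_, rfl, fun c hc => ?_⟩
    have : c.1 < (P.app x t).1 := hc
    rw [h] at this
    exact not_lt_zero this

theorem exists_code (hκ : (2 : Cardinal.{u}) ^ ℵ₀ < P.kappa.ord.cof) {D : Set (P.IS n)}
    (hD : D ≠ Set.univ) : ∃ x : P.F n, ∀ t, P.CodeMem x t ↔ t ∈ D := by
  let z : P.CardMinus := ⟨0, zero_le.trans_lt P.kappa_lt, Or.inl rfl⟩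
  obtain ⟨x, hx, hx'⟩ := P.exists_app_eqOn hκ hD (fun _ => z) ⟨z, fun _ _ => le_rfl⟩
  refine ⟨x, fun t => ?_⟩
  rw [codeMem_iff]
  exact ⟨fun h => by_contra fun ht => hx' t ht h, fun h => by rw [hx t h]⟩

/-- Only proper subsets of $IS_2$ are coded, so one type is kept in reserve by embedding `Option X`
and dropping `none`. -/
theorem exists_injective {X : Type w} (hX : Cardinal.lift.{0} #X ≤ 2 ^ ℵ₀) :
    ∃ f : X → P.IS 2, Function.Injective f ∧ Set.range f ≠ Set.univ := by
  obtain ⟨g, hg⟩ := P.exists_injective_IS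
  have h1 : (2 : Cardinal.{0}) ^ ℵ₀ ≤ #{S : Set ℕ // S.Nonempty} := by
    rw [← mk_nat, ← mk_set]
    -- Shifting by one makes room for the additional element `0`, which turns arbitrary subsets into
    -- nonempty ones.
    refine mk_le_of_injective (f := fun S => ⟨insert 0 (Nat.succ '' S), Set.insert_nonempty _ _⟩) ?_
    intro S T h
    have h := congrArg Subtype.val h
    ext m
    have := Set.ext_iff.1 h (m + 1)
    simpa using this
  have h2 : Cardinal.lift.{0} #(Option X) ≤ 2 ^ ℵ₀ := by
    rw [mk_option, Cardinal.lift_add, Cardinal.lift_one]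
    exact add_le_of_le aleph0_le_two_power hX (one_le_aleph0.trans aleph0_le_two_power)
  have h3 : Cardinal.lift.{0} #(Option X) ≤ Cardinal.lift.{w} #{S : Set ℕ // S.Nonempty} := by
    refine h2.trans ?_
    have := Cardinal.lift_le.{w}.2 h1
    simpa using this
  obtain ⟨f⟩ := Cardinal.lift_mk_le'.1 h3
  refine ⟨fun x => g (f (some x)), fun x y h => by simpa using f.injective (hg h), fun h => ?_⟩
  obtain ⟨x, hx⟩ := h.symm ▸ Set.mem_univ (g (f none))
  have := f.injective (hg hx)
  simp at this

theorem nonempty_IS : ∀ n, Nonempty (P.IS (n + 2))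
  | 0 => ⟨P.exists_injective_IS.choose ⟨Set.univ, Set.univ_nonempty⟩⟩
  | n + 1 => by
    obtain ⟨a⟩ := nonempty_IS n
    exact ⟨(P.exists_lift a).choose⟩

/-- The binary relation between `IS_{p+1}` and `IS_{q+1}` represented by two elements of
`F_{m+2}` and an element of `F_{m+3}`. -/
def CodeRel (m p q : ℕ) (l r : P.F (m + 2)) (e : P.F (m + 3)) (a : P.IS (p + 1))
    (b : P.IS (q + 1)) : Prop :=
  ∃ (L R : P.IS (m + 2)) (E : P.IS (m + 3)), P.CodeMem l L ∧ P.CodeMem r R ∧ P.CodeMem e E ∧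
    P.Proj1 E L ∧ P.Proj1 E R ∧ P.ProjIter (m + 1) p L a ∧ P.ProjIter (m + 1) q R b

/-- Both arguments are lifted to the same level and joined. The projections of a join form an
unordered pair, so the two sides are marked: the left argument is lifted with last permutation the
identity, the right one with another last permutation. The codes `l` and `r` name these two kinds of
types and `e` names the joins that belong to `Q`. -/
theorem exists_codeRel (hκ : (2 : Cardinal.{u}) ^ ℵ₀ < P.kappa.ord.cof) {m p q : ℕ} (hm : 1 ≤ m)
    (hp : p ≤ m) (hq : q ≤ m) (Q : P.IS (p + 1) → P.IS (q + 1) → Prop) :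
    ∃ l r e, ∀ a b, P.CodeRel m p q l r e a b ↔ Q a b := by
  obtain ⟨m, rfl⟩ := Nat.exists_eq_add_of_le' hm
  -- The types `d'`, `c'`, `c''` derived from `c` lie outside the sets coded by `l`, `r`, `e`,
  -- respectively, which makes these sets proper.
  obtain ⟨c⟩ := P.nonempty_IS m
  obtain ⟨c', hc', -⟩ := P.exists_lift c
  obtain ⟨d', hd', -⟩ := P.exists_join c c
  obtain ⟨c'', hc'', -⟩ := P.exists_lift c'
  have hL : ∀ a : P.IS (p + 1), ∃ l : P.IS (m + 1 + 2), l.1.LastId ∧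
      ∀ z, P.ProjIter (m + 1 + 1) p l z ↔ z = a := by
    intro a
    obtain ⟨k, hk⟩ := P.exists_iterLift hp a
    obtain ⟨l, hl, hl'⟩ := P.exists_lift k
    exact ⟨l, hl, fun z => by rw [P.projIter_succ hp]; simp [hl', hk]⟩
  have hR : ∀ a : P.IS (q + 1), ∃ l : P.IS (m + 1 + 2), ¬ l.1.LastId ∧
      ∀ z, P.ProjIter (m + 1 + 1) q l z ↔ z = a := by
    intro a
    obtain ⟨k, hk⟩ := P.exists_iterLift hq a
    obtain ⟨l, hl, hl'⟩ := P.exists_join k k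
    exact ⟨l, hl, fun z => by rw [P.projIter_succ hq]; simp [hl', hk]⟩
  choose L hL hL' using hL
  choose R hR hR' using hR
  choose J hJ hJ' using P.exists_join (n := m + 1 + 2)
  obtain ⟨l, hl⟩ := P.exists_code hκ (D := {t : P.IS (m + 1 + 2) | t.1.LastId})
    ((Set.ne_univ_iff_exists_notMem _).2 ⟨d', hd'⟩)
  obtain ⟨r, hr⟩ := P.exists_code hκ (D := {t : P.IS (m + 1 + 2) | ¬ t.1.LastId})
    ((Set.ne_univ_iff_exists_notMem _).2 ⟨c', fun h => h hc'⟩)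
  obtain ⟨e, he⟩ := P.exists_code hκ (D := {t : P.IS (m + 1 + 3) | ∃ a b, Q a b ∧ J (L a) (R b) = t})
    ((Set.ne_univ_iff_exists_notMem _).2 ⟨c'', by
      rintro ⟨a, b, -, h⟩
      exact hJ _ _ (h ▸ hc'')⟩)
  refine ⟨l, r, e, fun a b => ⟨?_, fun h => ?_⟩⟩
  · rintro ⟨L', R', E, h1, h2, h3, h4, h5, h6, h7⟩
    obtain ⟨a', b', hQ, rfl⟩ := (he _).1 h3
    have h1 : L'.1.LastId := (hl _).1 h1
    have h2 : ¬ R'.1.LastId := (hr _).1 h2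
    rcases (hJ' _ _ _).1 h4 with rfl | rfl
    · rcases (hJ' _ _ _).1 h5 with rfl | rfl
      · exact absurd h1 h2
      · rw [hL'] at h6
        rw [hR'] at h7
        exact h6 ▸ h7 ▸ hQ
    · exact absurd h1 (hR _)
  · exact ⟨L a, R b, J (L a) (R b), (hl _).2 (hL a), (hr _).2 (hR b), (he _).2 ⟨a, b, h, rfl⟩,
      (hJ' _ _ _).2 (Or.inl rfl), (hJ' _ _ _).2 (Or.inr rfl), (hL' _ _).2 rfl, (hR' _ _).2 rfl⟩

end Triple

/-! ### Ordinals below `Ω` -/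

theorem card_le_of_lt_Omega {o : Ordinal.{w}} (h : o < Omega) : o.card ≤ 2 ^ ℵ₀ := by
  rwa [Omega, Cardinal.lt_ord, Order.lt_succ_iff] at h

theorem Omega_le_of_lt_card {o : Ordinal.{w}} (h : 2 ^ ℵ₀ < o.card) : Omega ≤ o := by
  rwa [Omega, Cardinal.ord_le, Order.succ_le_iff]

theorem lt_Omega_of_card_le {o : Ordinal.{w}} (h : o.card ≤ 2 ^ ℵ₀) : o < Omega := by
  rwa [Omega, Cardinal.lt_ord, Order.lt_succ_iff]

theorem omega0_lt_Omega : ω < Omega.{w} := by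
  rw [Omega, Cardinal.lt_ord, card_omega0]
  exact (cantor _).trans (Order.lt_succ _)

theorem add_lt_Omega {a b : Ordinal.{w}} (ha : a < Omega) (hb : b < Omega) : a + b < Omega := by
  apply lt_Omega_of_card_le
  rw [card_add]
  exact add_le_of_le Triple.aleph0_le_two_power (card_le_of_lt_Omega ha) (card_le_of_lt_Omega hb)

theorem one_lt_Omega : 1 < Omega.{w} := one_lt_omega0.trans omega0_lt_Omega

theorem cofCoeff_lt (α : Ordinal.{w}) (n : ℕ) : cofCoeff α n < Omega := by
  unfold cofCoeff
  split_ifs with h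
  · exact add_lt_Omega one_lt_Omega h
  · exact _root_.pos_iff_ne_zero.2 Omega_ne_zero

/-! ### Ranks in `Card⁻` and coding of functions with values in `Card⁻` -/

namespace Triple

variable (P : Triple.{u})

/-- The rank of an element of `Card⁻` in the well-order `Card⁻`. -/
noncomputable def rk (ν : P.CardMinus) : Ordinal.{u + 1} := typein (fun x y : P.CardMinus => x < y) ν

variable {P}

theorem rk_lt_rk {ν ξ : P.CardMinus} : P.rk ν < P.rk ξ ↔ ν < ξ :=
  typein_lt_typein (fun x y : P.CardMinus => x < y)

theorem rk_le_rk {ν ξ : P.CardMinus} : P.rk ν ≤ P.rk ξ ↔ ν ≤ ξ := by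
  rw [← not_lt, rk_lt_rk, not_lt]

theorem rk_injective : Function.Injective P.rk :=
  typein_injective _

theorem rk_lt_alpha (ν : P.CardMinus) : P.rk ν < P.alpha := typein_lt_type _ _

theorem exists_rk {o : Ordinal.{u + 1}} (h : o < P.alpha) : ∃ ν, P.rk ν = o :=
  typein_surj _ h

theorem mk_rk_lt_le {o : Ordinal.{u + 1}} (h : o < Omega) :
    #{ν : P.CardMinus // P.rk ν < o} ≤ 2 ^ ℵ₀ := by
  refine le_trans ?_ (card_le_of_lt_Omega h)
  rw [← mk_toType]
  refine mk_le_of_injective (f := fun ν => ToType.mk ⟨P.rk ν.1, ν.2⟩) fun ν ξ hνξ => ?_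
  have := ToType.mk.injective hνξ
  exact Subtype.ext (rk_injective (congrArg Subtype.val this))

variable (P)

/-- The relation on `IS_2 × Card⁻` represented by six codes: three code a relation `Q` on `IS_2`
and three code an ordering `W` of a part of `IS_2`; the relation consists of the `(j, ν)` such that
`{c | Q j c}` is ordered by `W` like the set of predecessors of `ν`. -/
def CodeOrd (l r : P.F 3) (e : P.F 4) (l' r' : P.F 3) (e' : P.F 4) (j : P.IS 2)
    (ν : P.CardMinus) : Prop :=
  ∃ x : P.F 2, (∀ c c', P.CodeRel 1 1 1 l r e j c → P.CodeRel 1 1 1 l r e j c' →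
    P.CodeRel 1 1 1 l' r' e' c c' → P.app x c < P.app x c') ∧
    ∀ ξ, ξ < ν ↔ ∃ c, P.CodeRel 1 1 1 l r e j c ∧ P.app x c = ξ

/-- The function `v` may be unbounded in $Card^-$, so it need not be given by $App_2$. Instead the
set of predecessors of each value is copied into $IS_2$ and coded with its order. The decoding map
for a single value `v x` is bounded by `v x`, hence available in $F_2$. It determines the value
because isomorphic initial segments of a well-order are equal. -/
theorem exists_codeOrd (hκ : (2 : Cardinal.{u}) ^ ℵ₀ < P.kappa.ord.cof) {X : Type w}
    {ι : X → P.IS 2} (hι : Function.Injective ι) {o : Ordinal.{u + 1}} (ho : o < Omega)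
    (v : X → P.CardMinus) (hv : ∀ x, P.rk (v x) < o) :
    ∃ l r e l' r' e', ∀ x ν, P.CodeOrd l r e l' r' e' (ι x) ν ↔ ν = v x := by
  obtain ⟨em, hem, hem'⟩ := P.exists_injective (X := {ν : P.CardMinus // P.rk ν < o})
    (by rw [Cardinal.lift_id'.{0, u + 1}]; exact mk_rk_lt_le ho)
  obtain ⟨l, r, e, hQ⟩ := P.exists_codeRel hκ (le_refl 1) (le_refl 1) (le_refl 1)
    fun j c => ∃ x y, ι x = j ∧ em y = c ∧ y.1 < v x
  obtain ⟨l', r', e', hW⟩ := P.exists_codeRel hκ (le_refl 1) (le_refl 1) (le_refl 1)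
    fun c c' => ∃ y y', em y = c ∧ em y' = c' ∧ y < y'
  have hQ' : ∀ x y, P.CodeRel 1 1 1 l r e (ι x) (em y) ↔ y.1 < v x := by
    intro x y
    rw [hQ]
    constructor
    · rintro ⟨x', y', h1, h2, h3⟩
      rwa [hι h1, hem h2] at h3
    · intro h
      exact ⟨x, y, rfl, rfl, h⟩
  have hW' : ∀ y y', P.CodeRel 1 1 1 l' r' e' (em y) (em y') ↔ y < y' := by
    intro x y
    rw [hW]
    constructor
    · rintro ⟨x', y', h1, h2, h3⟩
      rwa [hem h1, hem h2] at h3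
    · intro h
      exact ⟨x, y, rfl, rfl, h⟩
  have hrange : ∀ x c, P.CodeRel 1 1 1 l r e (ι x) c → ∃ y, em y = c := by
    intro x c h
    obtain ⟨-, y, -, h, -⟩ := (hQ _ _).1 h
    exact ⟨y, h⟩
  refine ⟨l, r, e, l', r', e', fun x ν => ⟨?_, ?_⟩⟩
  · rintro ⟨f, hf1, hf2⟩
    have hmono : ∀ y y', y.1 < v x → y'.1 < v x → y < y' → P.app f (em y) < P.app f (em y') :=
      fun y y' h h' hlt => hf1 _ _ ((hQ' _ _).2 h) ((hQ' _ _).2 h') ((hW' _ _).2 hlt)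
    have hsurj : ∀ ξ, ξ < ν ↔ ∃ y, y.1 < v x ∧ P.app f (em y) = ξ := by
      intro ξ
      rw [hf2]
      constructor
      · rintro ⟨c, hc, h⟩
        obtain ⟨y, rfl⟩ := hrange _ _ hc
        exact ⟨y, (hQ' _ _).1 hc, h⟩
      · rintro ⟨y, hy, h⟩
        exact ⟨em y, (hQ' _ _).2 hy, h⟩
    -- An increasing map from one initial segment of a well-order onto another is the identity.
    have hid : ∀ y, y.1 < v x → P.app f (em y) = y.1 := by
      intro y
      induction y using WellFoundedLT.induction with
      | ind y ih =>
        intro hy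
        refine le_antisymm (not_lt.1 fun hlt => ?_) (not_lt.1 fun hlt => ?_)
        · obtain ⟨z, hz, hzy⟩ := (hsurj y.1).1 (hlt.trans ((hsurj _).2 ⟨y, hy, rfl⟩))
          rcases lt_trichotomy z y with h | rfl | h
          · exact h.ne (Subtype.ext ((ih z h hz).symm.trans hzy))
          · exact hlt.ne hzy.symm
          · exact (hlt.trans (hmono _ _ hy hz h)).ne hzy.symm
        · have hlt' := rk_lt_rk.2 hlt
          let z : {ν : P.CardMinus // P.rk ν < o} := ⟨P.app f (em y), hlt'.trans y.2⟩
          have h := hmono z y (hlt.trans hy) hy hlt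
          rw [ih z hlt (hlt.trans hy)] at h
          exact lt_irrefl _ h
    refine le_antisymm (not_lt.1 fun hlt => ?_) (not_lt.1 fun hlt => ?_)
    · obtain ⟨y, hy, h⟩ := (hsurj _).1 hlt
      rw [hid y hy] at h
      exact hy.ne h
    · have h := (hsurj ν).2 ⟨⟨ν, (rk_lt_rk.2 hlt).trans (hv x)⟩, hlt, hid _ hlt⟩
      exact lt_irrefl _ h
  · rintro rfl
    have hD : em '' {y | y.1 < v x} ≠ Set.univ := fun h =>
      hem' (Set.univ_subset_iff.1 (h ▸ Set.image_subset_range em _))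
    obtain ⟨f, hf, -⟩ := P.exists_app_eqOn hκ hD (Function.extend em Subtype.val fun _ => v x)
      ⟨v x, by
        rintro _ ⟨y, hy, rfl⟩
        rw [hem.extend_apply]
        exact le_of_lt hy⟩
    have hf' : ∀ y, y.1 < v x → P.app f (em y) = y.1 := fun y hy => by
      rw [hf _ ⟨y, hy, rfl⟩, hem.extend_apply]
    refine ⟨f, fun c c' hc hc' hcc => ?_, fun ξ => ⟨fun h => ?_, ?_⟩⟩
    · obtain ⟨y, rfl⟩ := hrange _ _ hc
      obtain ⟨y', rfl⟩ := hrange _ _ hc'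
      rw [hf' y ((hQ' _ _).1 hc), hf' y' ((hQ' _ _).1 hc')]
      exact (hW' _ _).1 hcc
    · exact ⟨em ⟨ξ, (rk_lt_rk.2 h).trans (hv x)⟩, (hQ' _ _).2 h, hf' _ h⟩
    · rintro ⟨c, hc, rfl⟩
      obtain ⟨y, rfl⟩ := hrange _ _ hc
      rw [hf' y ((hQ' _ _).1 hc)]
      exact (hQ' _ _).1 hc

end Triple

/-! ### The representation of the sorts of `N²` -/

/-- The sort of `M*` representing a basic sort of `N²`. -/
def NBase.srt : NBase → MSort
  | .is n => .is n
  | .coeff _ => .card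
  | .cof _ => .card

/-- A level at which relations between `IS_2` and a basic sort can be coded. -/
def NBase.level : NBase → ℕ
  | .is n => max 1 n
  | .coeff _ => 1
  | .cof _ => 1

/-- The sorts of the codes for a relation between `IS_2` and a basic sort. -/
def NBase.codeSrt (b : NBase) : Fin 6 → MSort :=
  ![.f (b.level + 1), .f (b.level + 1), .f (b.level + 2), .f 2, .f 2, .f 3]

namespace Triple

variable (P : Triple.{u})

/-- The elements which represent an element of a basic sort. -/
def InBase : (b : NBase) → P.MCarrier b.srt → Prop
  | .is _, _ => True
  | .coeff n, ν => P.rk ν < coeff P.alpha n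
  | .cof n, ν => P.rk ν < cofCoeff P.alpha n

/-- The relation between `IS_2` and a basic sort represented by a tuple of codes. -/
def CodeBase : (b : NBase) → (∀ a, P.MCarrier (b.codeSrt a)) → P.IS 2 → P.MCarrier b.srt → Prop
  | .is n, x, j, y => P.CodeRel (max 1 n) 1 n (x 0) (x 1) (x 2) j (ULift.down y)
  | .coeff _, x, j, y => P.CodeOrd (x 0) (x 1) (x 2) (x 3) (x 4) (x 5) j y
  | .cof _, x, j, y => P.CodeOrd (x 0) (x 1) (x 2) (x 3) (x 4) (x 5) j y

theorem mk_inBase_le : ∀ b, #{y // P.InBase b y} ≤ 2 ^ ℵ₀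
  | .is n => (mk_subtype_le _).trans ((mk_uLift _).trans_le (by
      have := Cardinal.lift_le.{u + 1}.2 (P.mk_IS_le (n := n + 1))
      simpa using this))
  | .coeff n => mk_rk_lt_le (coeff_lt _ n)
  | .cof n => mk_rk_lt_le (cofCoeff_lt _ n)

theorem exists_codeBase (hκ : (2 : Cardinal.{u}) ^ ℵ₀ < P.kappa.ord.cof) {X : Type w}
    {ι : X → P.IS 2} (hι : Function.Injective ι) (b : NBase) (v : X → P.MCarrier b.srt)
    (hv : ∀ x, P.InBase b (v x)) :
    ∃ c, ∀ x y, P.CodeBase b c (ι x) y ↔ y = v x := by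
  -- Stated for `coeff` only; for `cof` the codes and their meaning are definitionally the same.
  have hord : ∀ (n : ℕ) (o : Ordinal.{u + 1}), o < Omega → ∀ (v : X → P.CardMinus),
      (∀ x, P.rk (v x) < o) → ∃ c : ∀ a, P.MCarrier ((NBase.coeff n).codeSrt a), ∀ x y,
        P.CodeBase (.coeff n) c (ι x) y ↔ y = v x := by
    intro n o ho v hv
    obtain ⟨l, r, e, l', r', e', h⟩ := P.exists_codeOrd hκ hι ho v hv
    exact ⟨Fin.cons l (Fin.cons r (Fin.cons e (Fin.cons l' (Fin.cons r'
      (Fin.cons e' fun a => a.elim0))))), fun x y => h x y⟩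
  cases b with
  | is n =>
    -- Relations with values in a sort of types use three of the six codes; the other places are
    -- filled with arbitrary elements.
    have : Nonempty (P.F 3) := ⟨(P.exists_code hκ (D := (∅ : Set (P.IS 3)))
      (by have := P.nonempty_IS 1; exact Set.empty_ne_univ)).choose⟩
    have : Nonempty (P.F 4) := ⟨(P.exists_code hκ (D := (∅ : Set (P.IS 4)))
      (by have := P.nonempty_IS 2; exact Set.empty_ne_univ)).choose⟩
    obtain ⟨z⟩ := ‹Nonempty (P.F 3)›
    obtain ⟨z'⟩ := ‹Nonempty (P.F 4)›
    obtain ⟨l, r, e, h⟩ := P.exists_codeRel hκ (le_max_left 1 n) (le_max_left 1 n)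
      (le_max_right 1 n) fun j y => ∃ x, ι x = j ∧ v x = ⟨y⟩
    refine ⟨Fin.cons l (Fin.cons r (Fin.cons e (Fin.cons z (Fin.cons z
      (Fin.cons z' fun a => a.elim0))))), fun x y => (h _ _).trans ⟨?_, ?_⟩⟩
    · rintro ⟨x', h1, h2⟩
      rw [hι h1] at h2
      exact h2.symm
    · rintro rfl
      exact ⟨x, rfl, rfl⟩
  | coeff n => exact hord n _ (coeff_lt _ n) v hv
  | cof n => exact hord n _ (cofCoeff_lt _ n) v hv

/-- The relation represented by a tuple of codes. -/
def CodeTuple {k : ℕ} (τ : Fin k → NBase) (x : P.F 2) (c : ∀ i a, P.MCarrier ((τ i).codeSrt a))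
    (y : ∀ i, P.MCarrier (τ i).srt) : Prop :=
  ∃ j, P.CodeMem x j ∧ ∀ i, P.CodeBase (τ i) (c i) j (y i)

/-- A finite product of sets of size at most the continuum is again that small. So `A` is indexed by
a proper subset of $IS_2$, and the coordinates are coded separately as functions of the index. -/
theorem exists_codeTuple (hκ : (2 : Cardinal.{u}) ^ ℵ₀ < P.kappa.ord.cof) {k : ℕ}
    (τ : Fin k → NBase) (A : Set (∀ i, P.MCarrier (τ i).srt))
    (hA : ∀ y ∈ A, ∀ i, P.InBase (τ i) (y i)) :
    ∃ x c, ∀ y, P.CodeTuple τ x c y ↔ y ∈ A := by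
  have hcard : #A ≤ 2 ^ ℵ₀ := by
    refine (mk_le_of_injective (β := ∀ i, {y // P.InBase (τ i) y})
      (f := fun y i => ⟨y.1 i, hA y.1 y.2 i⟩) ?_).trans ?_
    · intro y z h
      refine Subtype.ext (funext fun i => ?_)
      exact congrArg Subtype.val (congrFun h i)
    · rw [mk_pi]
      refine (Cardinal.prod_le_prod _ (fun _ => 2 ^ ℵ₀) fun i => P.mk_inBase_le (τ i)).trans ?_
      rw [Cardinal.prod_const, Cardinal.mk_fin, Cardinal.lift_natCast, Cardinal.lift_id'.{0, u + 1},
        ← Cardinal.power_mul]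
      refine power_le_power_left two_ne_zero ?_
      rcases k with _ | k
      · simp
      · rw [aleph0_mul_nat k.succ_ne_zero]
  obtain ⟨ι, hι, hι'⟩ := P.exists_injective (X := A) (by rwa [Cardinal.lift_id'.{0, u + 1}])
  obtain ⟨x, hx⟩ := P.exists_code hκ hι'
  choose c hc using fun i => P.exists_codeBase hκ hι (τ i) (fun y => y.1 i) fun y => hA y.1 y.2 i
  refine ⟨x, c, fun y => ⟨?_, fun hy => ?_⟩⟩
  · rintro ⟨j, hj, h⟩
    obtain ⟨z, rfl⟩ := (hx j).1 hj
    have : y = z.1 := funext fun i => (hc i z (y i)).1 (h i)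
    exact this ▸ z.2
  · exact ⟨ι ⟨y, hy⟩, (hx _).2 ⟨_, rfl⟩, fun i => (hc i ⟨y, hy⟩ (y i)).2 rfl⟩

end Triple

/-! ### Multiples of the powers of `Ω` -/

section Ordinals

variable {α β γ ν : Ordinal.{w}} {n : ℕ}

theorem Omega_pow_ne_zero (n : ℕ) : Omega.{w} ^ n ≠ 0 := pow_ne_zero _ Omega_ne_zero

theorem aleph0_le_succ_two_power : ℵ₀ ≤ Order.succ ((2 : Cardinal.{w}) ^ ℵ₀) :=
  Triple.aleph0_le_two_power.trans (Order.le_succ _)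

theorem add_Omega (h : α < Omega) : α + Omega = Omega :=
  (isPrincipal_add_iff_add_left_eq_self.1 (isPrincipal_add_ord aleph0_le_succ_two_power)) α h

theorem isSuccLimit_Omega : Order.IsSuccLimit Omega.{w} := isSuccLimit_ord aleph0_le_succ_two_power

/-- The quotient of `α` by the preceding power of `Ω` is less than `Ω`, and `Ω` absorbs smaller
ordinals on its left. -/
theorem add_Omega_pow (h : α < Omega ^ n) : α + Omega ^ n = Omega ^ n := by
  cases n with
  | zero =>
    rw [pow_zero, Order.lt_one_iff] at h
    rw [h, zero_add]
  | succ n =>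
    refine le_antisymm ?_ le_add_self
    have h1 : α / Omega ^ n < Omega := by
      rwa [← lt_mul_iff_div_lt (Omega_pow_ne_zero n), ← pow_succ]
    calc α + Omega ^ (n + 1) ≤ Omega ^ n * (α / Omega ^ n + 1) + Omega ^ (n + 1) := by
          gcongr
          rw [← Order.succ_eq_add_one]
          exact (Ordinal.lt_mul_succ_div _ (Omega_pow_ne_zero n)).le
      _ = Omega ^ (n + 1) := by
          rw [pow_succ, ← mul_add, add_Omega (add_lt_Omega h1 one_lt_Omega)]

theorem head_le (α : Ordinal.{w}) (n : ℕ) : head α n ≤ α := mul_div_le _ _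

/-- The next multiple of `Ω ^ n` after `β`. -/
theorem add_Omega_pow_eq (β : Ordinal.{w}) (n : ℕ) :
    β + Omega ^ n = Omega ^ n * (β / Omega ^ n + 1) := by
  conv_lhs => rw [← Ordinal.div_add_mod β (Omega ^ n)]
  rw [add_assoc, add_Omega_pow (Ordinal.mod_lt _ (Omega_pow_ne_zero n)), mul_add, mul_one]

theorem add_Omega_pow_le_iff : β + Omega ^ n ≤ α ↔ β / Omega ^ n < α / Omega ^ n := by
  rw [add_Omega_pow_eq, mul_le_iff_le_div (Omega_pow_ne_zero n), ← Order.succ_eq_add_one,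
    Order.succ_le_iff]

theorem add_Omega_pow_le_iff_lt_head : β + Omega ^ (n + 1) ≤ α ↔ β < head α n := by
  rw [add_Omega_pow_le_iff, head, lt_mul_iff_div_lt (Omega_pow_ne_zero _)]

theorem dvd_head (α : Ordinal.{w}) (n : ℕ) : Omega ^ n ∣ head α n := by
  rw [head, pow_succ, mul_assoc]
  exact dvd_mul_right _ _

/-- The negated condition says $\beta\ge\alpha[n]$. What remains are the starting points of the full
blocks of length $\Omega^n$ between $\alpha[n]$ and $\alpha$, and there are $\alpha_{[n]}$ of these.
-/
theorem exists_eq_head_add_iff : (Omega ^ n ∣ β ∧ β + Omega ^ n ≤ α ∧ ¬ β + Omega ^ (n + 1) ≤ α) ↔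
    ∃ i < coeff α n, β = head α n + Omega ^ n * i := by
  have hw := Omega_pow_ne_zero.{w} n
  have h1 : head α n = Omega ^ n * (Omega * (α / Omega ^ n / Omega)) := by
    rw [head, pow_succ, div_mul_eq _ _ _ hw, mul_assoc]
  have h2 : α / Omega ^ n = Omega * (α / Omega ^ n / Omega) + coeff α n :=
    (Ordinal.div_add_mod _ _).symm
  rw [add_Omega_pow_le_iff_lt_head, add_Omega_pow_le_iff, not_lt]
  constructor
  · rintro ⟨⟨d, rfl⟩, h3, h4⟩
    rw [h1, mul_le_mul_iff_right₀ (_root_.pos_iff_ne_zero.2 hw)] at h4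
    rw [Ordinal.mul_div_cancel _ hw] at h3
    obtain ⟨i, rfl⟩ := exists_add_of_le h4
    have h3 := h3.trans_eq h2
    rw [add_lt_add_iff_left] at h3
    exact ⟨i, h3, by rw [h1, mul_add]⟩
  · rintro ⟨i, hi, rfl⟩
    refine ⟨dvd_add (dvd_head _ _) (dvd_mul_right _ _), ?_, le_self_add⟩
    rw [h1, ← mul_add, Ordinal.mul_div_cancel _ hw]
    conv_rhs => rw [h2]
    rwa [add_lt_add_iff_left]

theorem head_isSuccLimit (h : head α n ≠ 0) : Order.IsSuccLimit (head α n) := by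
  rw [head, pow_succ, mul_assoc] at h ⊢
  have h1 : α / (Omega ^ n * Omega) ≠ 0 := fun h' => h (by rw [h', mul_zero, mul_zero])
  exact isSuccLimit_mul_right (_root_.pos_iff_ne_zero.2 (Omega_pow_ne_zero n))
    (isSuccLimit_mul_left isSuccLimit_Omega (_root_.pos_iff_ne_zero.2 h1))

theorem Omega_le_head (h : head α n ≠ 0) : Omega ≤ head α n := by
  rw [head, pow_succ', mul_assoc] at h ⊢
  exact le_mul_of_one_le_right' (Order.one_le_iff_ne_zero.2 fun h' => h (by rw [h', mul_zero]))

theorem cofCoeff_of_head_eq_zero (h : head α n = 0) : cofCoeff α n = 1 := by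
  rw [cofCoeff, h, cof_zero, ord_zero, if_pos (_root_.pos_iff_ne_zero.2 Omega_ne_zero), add_zero]

/-- A non-zero multiple of `Ω` is a limit, so its cofinality is infinite and absorbs the summand
`1`. -/
theorem cofCoeff_of_cof_le (h : head α n ≠ 0) (hc : (head α n).cof ≤ 2 ^ ℵ₀) :
    cofCoeff α n = (head α n).cof.ord := by
  have h1 : (head α n).cof.ord < Omega := lt_Omega_of_card_le (by rwa [card_ord])
  rw [cofCoeff, if_pos h1, one_add_of_omega0_le]
  rw [Cardinal.omega0_le_ord, Ordinal.aleph0_le_cof_iff, Ordinal.one_lt_cof_iff]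
  exact head_isSuccLimit h

theorem cofCoeff_of_lt_cof (hc : 2 ^ ℵ₀ < (head α n).cof) : cofCoeff α n = 0 := by
  rw [cofCoeff, if_neg (not_lt.2 (Omega_le_of_lt_card (by rwa [card_ord])))]

theorem lt_Omega_mul_iff : ν / Omega ^ n < γ / Omega ^ n + Omega ↔
    ¬ γ + Omega ^ (n + 1) ≤ ν := by
  have hw := Omega_pow_ne_zero.{w} n
  rw [add_Omega_pow_le_iff, pow_succ, div_mul_eq _ _ _ hw, div_mul_eq _ _ _ hw]
  generalize ν / Omega ^ n = a
  generalize γ / Omega ^ n = b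
  rw [← not_le, not_iff_not]
  simpa using add_Omega_pow_le_iff (α := a) (β := b) (n := 1)

theorem coe_toTypeMk_symm_lt (a : α.ToType) : (ToType.mk.symm a).1 < α :=
  (ToType.mk.symm a).2

end Ordinals

/-! ### Counting multiples of the powers of `Ω`, and defining the coefficients -/

namespace Triple

variable (P : Triple.{u}) {n : ℕ}

/-- Division by $\Omega^k$ turns the multiples in question into ordinals between the quotients of
$\gamma$ and $\beta$. There are more than continuum many of them iff the distance of the quotients
is at least $\Omega$. -/
theorem mk_multiples_le_iff (k : ℕ) (γ : P.CardMinus) {β : Ordinal.{u + 1}} (hβ : β ≤ P.alpha) :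
    #{δ : P.CardMinus // Omega ^ k ∣ P.rk δ ∧ γ ≤ δ ∧ P.rk δ < β} ≤ 2 ^ ℵ₀ ↔
      ¬ P.rk γ + Omega ^ (k + 1) ≤ β := by
  have hw := Omega_pow_ne_zero.{u + 1} k
  constructor
  · intro h hle
    refine absurd h (not_le.2 ?_)
    have h1 : (2 : Cardinal.{u + 1}) ^ ℵ₀ < #(Omega.{u + 1}).ToType := by
      rw [mk_toType, Omega, card_ord]
      exact Order.lt_succ _
    refine h1.trans_le ?_
    set q := P.rk γ / Omega ^ k with hq
    -- The summand `1` is needed because $\Omega^k q$ itself may lie below the rank of `γ`.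
    have hlt : ∀ i : Omega.{u + 1}.ToType, Omega ^ k * (q + 1 + (ToType.mk.symm i).1) < β := by
      intro i
      refine lt_of_lt_of_le ?_ hle
      have : Omega ^ k * q + Omega ^ (k + 1) ≤ P.rk γ + Omega ^ (k + 1) := by
        gcongr
        exact mul_div_le _ _
      refine lt_of_lt_of_le ?_ this
      rw [pow_succ, ← mul_add, mul_lt_mul_iff_right₀ (_root_.pos_iff_ne_zero.2 hw), add_assoc,
        add_lt_add_iff_left]
      exact add_lt_Omega one_lt_Omega (coe_toTypeMk_symm_lt i)
    choose g hg using fun i => exists_rk ((hlt i).trans_le hβ)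
    refine mk_le_of_injective (f := fun i => ⟨g i, ?_, ?_, ?_⟩) ?_
    · rw [hg]
      exact dvd_mul_right _ _
    · rw [← rk_le_rk, hg]
      refine (Ordinal.lt_mul_succ_div (P.rk γ) hw).le.trans ?_
      rw [← hq, Order.succ_eq_add_one]
      exact mul_le_mul_right le_self_add _
    · rw [hg]
      exact hlt i
    · intro i j hij
      have := congrArg P.rk (congrArg Subtype.val hij)
      simp only [hg] at this
      have := (mul_right_injective₀ hw) this
      exact ToType.mk.symm.injective (Subtype.ext (by simpa using this))
  · intro h
    rw [← lt_Omega_mul_iff] at h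
    set q := P.rk γ / Omega ^ k with hq
    set r := β / Omega ^ k with hr
    have h1 : ∀ δ : {δ : P.CardMinus // Omega ^ k ∣ P.rk δ ∧ γ ≤ δ ∧ P.rk δ < β},
        ∃ i ≤ r - q, P.rk δ.1 = Omega ^ k * (q + i) := by
      rintro ⟨δ, ⟨d, hd⟩, h1, h2⟩
      have h3 : q ≤ d := by
        have := div_le_left (rk_le_rk.2 h1) (Omega ^ k)
        rwa [hd, Ordinal.mul_div_cancel _ hw] at this
      have h4 : d ≤ r := by
        have := div_le_left h2.le (Omega ^ k)
        rwa [hd, Ordinal.mul_div_cancel _ hw] at this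
      refine ⟨d - q, ?_, ?_⟩
      · rw [Ordinal.sub_le, Ordinal.add_sub_cancel_of_le (h3.trans h4)]
        exact h4
      · rw [Ordinal.add_sub_cancel_of_le h3, hd]
    choose g hg1 hg2 using h1
    have h2 : Order.succ (r - q) < Omega := by
      exact isSuccLimit_Omega.succ_lt
        (Ordinal.sub_lt_of_lt_add h (_root_.pos_iff_ne_zero.2 Omega_ne_zero))
    refine le_trans ?_ (card_le_of_lt_Omega h2)
    rw [← mk_toType]
    refine mk_le_of_injective (f := fun δ => ToType.mk ⟨g δ, Order.lt_succ_iff.2 (hg1 δ)⟩) fun δ ε h => ?_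
    have h := congrArg Subtype.val (ToType.mk.injective h)
    refine Subtype.ext (rk_injective ?_)
    rw [hg2, hg2]
    exact congrArg (fun i => Omega ^ k * (q + i)) h

theorem mk_range_app_le (x : P.F n) : #{ν // ∃ t, P.app x t = ν} ≤ 2 ^ ℵ₀ := by
  refine (mk_le_of_surjective (α := ULift.{u + 1} (P.IS n)) (f := fun t => ⟨_, t.down, rfl⟩) ?_).trans ?_
  · rintro ⟨_, t, rfl⟩
    exact ⟨⟨t⟩, rfl⟩
  · rw [mk_uLift]
    have := Cardinal.lift_le.{u + 1}.2 (P.mk_IS_le (n := n))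
    simpa using this

/-- A set of elements of `Card⁻` of cardinality at most the continuum and its images under two
functions to `Card⁻` are represented by elements of `F_2`. -/
theorem exists_code_pair (hκ : (2 : Cardinal.{u}) ^ ℵ₀ < P.kappa.ord.cof) {X : Type (u + 1)}
    (hX : #X ≤ 2 ^ ℵ₀) (f g : X → P.CardMinus) (hf : ∃ b, ∀ a, f a ≤ b) (hg : ∃ b, ∀ a, g a ≤ b) :
    ∃ (d x y : P.F 2) (ι : X → P.IS 2), (∀ t, P.CodeMem d t ↔ ∃ a, ι a = t) ∧
      (∀ a, P.app x (ι a) = f a) ∧ ∀ a, P.app y (ι a) = g a := by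
  obtain ⟨ι, hι, hι'⟩ := P.exists_injective (X := X) (by rwa [Cardinal.lift_id'.{0, u + 1}])
  obtain ⟨d, hd⟩ := P.exists_code hκ hι'
  have key : ∀ f : X → P.CardMinus, (∃ b, ∀ a, f a ≤ b) → ∃ x : P.F 2, ∀ a, P.app x (ι a) = f a := by
    rintro f ⟨b, hb⟩
    obtain ⟨x, hx, -⟩ := P.exists_app_eqOn hκ hι' (Function.extend ι f fun _ => b)
      ⟨b, by rintro _ ⟨a, rfl⟩; rw [hι.extend_apply]; exact hb a⟩
    exact ⟨x, fun a => by rw [hx _ ⟨a, rfl⟩, hι.extend_apply]⟩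
  obtain ⟨x, hx⟩ := key f hf
  obtain ⟨y, hy⟩ := key g hg
  exact ⟨d, x, y, ι, fun t => hd t, hx, hy⟩

/-- The first-order expression of having at most continuum many elements: an element of $F_2$ takes
no more values than that, and any bounded set of this size is covered by one. -/
theorem exists_cover_iff (hκ : (2 : Cardinal.{u}) ^ ℵ₀ < P.kappa.ord.cof) {S : P.CardMinus → Prop}
    (hS : #{ν // S ν} ≤ 2 ^ ℵ₀ → ∃ b, ∀ ν, S ν → ν ≤ b) :
    (∃ x : P.F 2, ∀ δ, S δ → ∃ t, P.app x t = δ) ↔ #{ν // S ν} ≤ 2 ^ ℵ₀ := by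
  constructor
  · rintro ⟨x, hx⟩
    exact (mk_subtype_mono fun ν hν => hx ν hν).trans (P.mk_range_app_le x)
  · intro h
    obtain ⟨b, hb⟩ := hS h
    obtain ⟨_, x, -, ι, -, hx, -⟩ := P.exists_code_pair hκ h Subtype.val Subtype.val
      ⟨b, fun a => hb a.1 a.2⟩ ⟨b, fun a => hb a.1 a.2⟩
    exact ⟨x, fun δ hδ => ⟨_, hx ⟨δ, hδ⟩⟩⟩

/-- The rank of `ν` is divisible by `Ω ^ k`. -/
def Mult : ℕ → P.CardMinus → Prop
  | 0, _ => True
  | k + 1, ν => ∀ γ, γ < ν → ¬ ∃ x : P.F 2, ∀ δ, Mult k δ ∧ ¬ δ < γ ∧ δ < ν → ∃ t, P.app x t = δ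

/-- An ordinal $\nu$ is divisible by $\Omega^{k+1}$ iff $\gamma+\Omega^{k+1}\le\nu$ for all
$\gamma<\nu$, and this is expressed by counting multiples of $\Omega^k$ in $[\gamma,\nu)$. -/
theorem mult_iff (hκ : (2 : Cardinal.{u}) ^ ℵ₀ < P.kappa.ord.cof) (k : ℕ) (ν : P.CardMinus) :
    P.Mult k ν ↔ Omega ^ k ∣ P.rk ν := by
  induction k generalizing ν with
  | zero => simp [Mult]
  | succ k ih =>
    have h1 : P.Mult (k + 1) ν ↔ ∀ γ, γ < ν → P.rk γ + Omega ^ (k + 1) ≤ P.rk ν := by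
      rw [Mult]
      refine forall_congr' fun γ => imp_congr_right fun _ => ?_
      rw [P.exists_cover_iff hκ fun _ => ⟨ν, fun _ h => h.2.2.le⟩, ← not_iff_not, not_not,
        ← P.mk_multiples_le_iff k γ (rk_lt_alpha ν).le]
      simp only [ih, not_lt, rk_lt_rk]
    rw [h1]
    constructor
    · intro h
      by_contra hd
      -- The last multiple of $\Omega^{k+1}$ below $\nu$ violates the hypothesis, as the next one is
      -- beyond $\nu$.
      have h2 : Omega ^ (k + 1) * (P.rk ν / Omega ^ (k + 1)) < P.rk ν := by
        refine lt_of_le_of_ne (mul_div_le _ _) fun h' => hd ⟨_, h'.symm⟩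
      obtain ⟨γ, hγ⟩ := exists_rk (h2.trans (rk_lt_alpha ν))
      have h3 := h γ (rk_lt_rk.1 (hγ ▸ h2))
      rw [add_Omega_pow_le_iff, hγ, Ordinal.mul_div_cancel _ (Omega_pow_ne_zero _)] at h3
      exact lt_irrefl _ h3
    · rintro ⟨d, hd⟩ γ hγ
      rw [← rk_lt_rk, hd, lt_mul_iff_div_lt (Omega_pow_ne_zero _)] at hγ
      rw [add_Omega_pow_le_iff, hd, Ordinal.mul_div_cancel _ (Omega_pow_ne_zero _)]
      exact hγ

/-- There is a further block of length `Ω ^ k` from `ν` on. -/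
def Big (k : ℕ) (ν : P.CardMinus) : Prop := P.rk ν + Omega ^ k ≤ P.alpha

/-- `ν` is the beginning of one of the blocks counted by the coefficient `α_[n]`. -/
def Block (n : ℕ) (ν : P.CardMinus) : Prop := P.Mult n ν ∧ P.Big n ν ∧ ¬ P.Big (n + 1) ν

theorem block_iff (hκ : (2 : Cardinal.{u}) ^ ℵ₀ < P.kappa.ord.cof) (n : ℕ) (ν : P.CardMinus) :
    P.Block n ν ↔ ∃ i < coeff P.alpha n, P.rk ν = head P.alpha n + Omega ^ n * i := by
  rw [Block, P.mult_iff hκ, Big, Big, exists_eq_head_add_iff]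

theorem big_succ_iff (n : ℕ) (ν : P.CardMinus) : P.Big (n + 1) ν ↔ P.rk ν < head P.alpha n :=
  add_Omega_pow_le_iff_lt_head

/-- The rank of `ν` is less than `α_[n]`. -/
def InCoeff (n : ℕ) (ν : P.CardMinus) : Prop :=
  ∃ d x y : P.F 2, (∀ t, P.CodeMem d t → P.Block n (P.app y t)) ∧
    (∀ t t', P.CodeMem d t → P.CodeMem d t' → P.app x t < P.app x t' → P.app y t < P.app y t') ∧
    ∀ ξ, ¬ ν < ξ → ∃ t, P.CodeMem d t ∧ P.app x t = ξ

/-- The codes describe an increasing correspondence from $\{\xi\le\nu\}$ to the set of blocks, which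
has order type $\alpha_{[n]}$. Such a correspondence cannot lower ranks, so the block belonging to
$\nu$ has an index at least the rank of $\nu$. Conversely, $\xi$ is sent to the block whose index is
the rank of $\xi$; these blocks are bounded by the one for $\nu$. -/
theorem inCoeff_iff (hκ : (2 : Cardinal.{u}) ^ ℵ₀ < P.kappa.ord.cof) (n : ℕ) (ν : P.CardMinus) :
    P.InCoeff n ν ↔ P.rk ν < coeff P.alpha n := by
  constructor
  · rintro ⟨d, x, y, h1, h2, h3⟩
    simp only [P.block_iff hκ] at h1
    have key : ∀ ξ, ξ ≤ ν → ∀ t, P.CodeMem d t → P.app x t = ξ → ∀ i,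
        P.rk (P.app y t) = head P.alpha n + Omega ^ n * i → P.rk ξ ≤ i := by
      intro ξ
      induction ξ using WellFoundedLT.induction with
      | ind ξ ih =>
        intro hξ t ht hxt i hi
        by_contra! hlt
        obtain ⟨ζ, hζ⟩ := exists_rk (hlt.trans (rk_lt_alpha ξ))
        have hζξ : ζ < ξ := rk_lt_rk.1 (hζ ▸ hlt)
        obtain ⟨t', ht', hxt'⟩ := h3 ζ (not_lt.2 (hζξ.le.trans hξ))
        obtain ⟨j, -, hj⟩ := h1 t' ht'
        have h4 := ih ζ hζξ (hζξ.le.trans hξ) t' ht' hxt' j hj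
        have h5 := rk_lt_rk.2 (h2 t' t ht' ht (by rwa [hxt, hxt']))
        rw [hi, hj, add_lt_add_iff_left,
          mul_lt_mul_iff_right₀ (_root_.pos_iff_ne_zero.2 (Omega_pow_ne_zero n)), ← hζ] at h5
        exact absurd h4 (not_le.2 h5)
    obtain ⟨t, ht, hxt⟩ := h3 ν (lt_irrefl ν)
    obtain ⟨i, hi, hi'⟩ := h1 t ht
    exact (key ν le_rfl t ht hxt i hi').trans_lt hi
  · intro h
    have hX : #{ξ : P.CardMinus // ξ ≤ ν} ≤ 2 ^ ℵ₀ :=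
      (mk_subtype_mono fun ξ hξ => (rk_le_rk.2 hξ).trans_lt h).trans (mk_rk_lt_le (coeff_lt _ n))
    have h1 : ∀ i, i < coeff P.alpha n → ∃ β, P.rk β = head P.alpha n + Omega ^ n * i := by
      intro i hi
      refine exists_rk ?_
      refine lt_of_lt_of_le ?_ ((exists_eq_head_add_iff.2 ⟨i, hi, rfl⟩).2.1)
      exact lt_add_of_pos_right _ (_root_.pos_iff_ne_zero.2 (Omega_pow_ne_zero n))
    choose! g hg using fun ξ (hξ : ξ ≤ ν) => h1 _ ((rk_le_rk.2 hξ).trans_lt h)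
    have hgm : ∀ ξ ξ', ξ ≤ ν → ξ' ≤ ν → (g ξ < g ξ' ↔ ξ < ξ') := by
      intro ξ ξ' h h'
      rw [← rk_lt_rk, hg _ h, hg _ h', add_lt_add_iff_left,
        mul_lt_mul_iff_right₀ (_root_.pos_iff_ne_zero.2 (Omega_pow_ne_zero n)), rk_lt_rk]
    obtain ⟨d, x, y, ι, hd, hx, hy⟩ := P.exists_code_pair hκ hX Subtype.val (fun ξ => g ξ.1)
      ⟨ν, fun ξ => ξ.2⟩ ⟨g ν, fun ξ => not_lt.1 fun h => not_lt.2 ξ.2 ((hgm _ _ le_rfl ξ.2).1 h)⟩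
    refine ⟨d, x, y, fun t ht => ?_, fun t t' ht ht' => ?_, fun ξ hξ => ?_⟩
    · obtain ⟨ξ, rfl⟩ := (hd t).1 ht
      rw [P.block_iff hκ, hy]
      exact ⟨P.rk ξ.1, (rk_le_rk.2 ξ.2).trans_lt h, hg _ ξ.2⟩
    · obtain ⟨ξ, rfl⟩ := (hd t).1 ht
      obtain ⟨ξ', rfl⟩ := (hd t').1 ht'
      rw [hx, hx, hy, hy, hgm _ _ ξ.2 ξ'.2]
      exact id
    · exact ⟨ι ⟨ξ, not_lt.1 hξ⟩, (hd _).2 ⟨_, rfl⟩, hx _⟩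

/-! ### Cofinalities -/

/-- The initial segment `S` has a cofinal subset of cardinality at most the continuum. -/
def SmallCof (S : P.CardMinus → Prop) : Prop :=
  ∃ x : P.F 2, ∀ γ, S γ → ∃ t, S (P.app x t) ∧ ¬ P.app x t < γ

/-- The rank of `ν` is less than the cofinality of the initial segment `S`. -/
def CofLt (S : P.CardMinus → Prop) (ν : P.CardMinus) : Prop :=
  ∀ d x y : P.F 2, (∀ t t', P.CodeMem d t → P.CodeMem d t' → P.app x t = P.app x t' →
    P.app y t = P.app y t') → (∀ t, P.CodeMem d t → P.app x t < ν ∧ S (P.app y t)) →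
    ∃ γ, S γ ∧ ∀ t, P.CodeMem d t → P.app y t < γ

variable {P} in
theorem exists_cofinal {S : P.CardMinus → Prop} {σ : Ordinal.{u + 1}} (hS : ∀ γ, S γ ↔ P.rk γ < σ)
    (hσ : σ ≤ P.alpha) : ∃ (X : Type (u + 1)) (g : X → P.CardMinus), #X = σ.cof ∧ (∀ a, S (g a)) ∧
      ∀ γ, S γ → ∃ a, γ ≤ g a := by
  obtain ⟨s, hs, hs'⟩ := Order.exists_cof_eq σ.ToType
  choose g hg using fun a : s => exists_rk ((coe_toTypeMk_symm_lt a.1).trans_le hσ)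
  refine ⟨s, g, by rw [hs', cof_toType], fun a => ?_, fun γ hγ => ?_⟩
  · rw [hS, hg]
    exact (ToType.mk.symm a.1).2
  · obtain ⟨a, ha, hle⟩ := hs (ToType.mk ⟨P.rk γ, (hS γ).1 hγ⟩)
    refine ⟨⟨a, ha⟩, ?_⟩
    rw [← rk_le_rk, hg]
    rwa [← OrderIso.le_symm_apply] at hle

/-- Since $\sigma<\alpha$, a cofinal family in the segment is bounded in $Card^-$ and so is given by
an element of $F_2$ if it is small. -/
theorem smallCof_iff (hκ : (2 : Cardinal.{u}) ^ ℵ₀ < P.kappa.ord.cof) {S : P.CardMinus → Prop}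
    {σ : Ordinal.{u + 1}} (hS : ∀ γ, S γ ↔ P.rk γ < σ) (hσ : σ < P.alpha) :
    P.SmallCof S ↔ σ.cof ≤ 2 ^ ℵ₀ := by
  constructor
  · rintro ⟨x, hx⟩
    have hc : IsCofinal {a : σ.ToType | ∃ t, P.rk (P.app x t) = (ToType.mk.symm a).1} := by
      intro a
      obtain ⟨γ, hγ⟩ := exists_rk ((coe_toTypeMk_symm_lt a).trans hσ)
      obtain ⟨t, ht, hle⟩ := hx γ ((hS γ).2 (hγ ▸ (coe_toTypeMk_symm_lt a)))
      refine ⟨ToType.mk ⟨P.rk (P.app x t), (hS _).1 ht⟩, ⟨t, by simp⟩, ?_⟩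
      rw [not_lt, ← rk_le_rk, hγ] at hle
      rwa [← OrderIso.symm_apply_le]
    rw [← cof_toType]
    refine (Order.cof_le hc).trans (le_trans ?_ (P.mk_range_app_le x))
    refine mk_le_of_injective (f := fun a => ⟨P.app x a.2.choose, _, rfl⟩) fun a b h => ?_
    have h1 := congrArg P.rk (congrArg Subtype.val h)
    simp only [a.2.choose_spec, b.2.choose_spec] at h1
    exact Subtype.ext (ToType.mk.symm.injective (Subtype.ext h1))
  · intro h
    obtain ⟨X, g, hX, hg, hg'⟩ := exists_cofinal hS hσ.le
    obtain ⟨b, hb⟩ := exists_rk hσ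
    have hbd : ∃ b, ∀ a, g a ≤ b := ⟨b, fun a => rk_le_rk.1 (hb ▸ ((hS _).1 (hg a)).le)⟩
    obtain ⟨-, x, -, ι, -, hx, -⟩ := P.exists_code_pair hκ (hX ▸ h) g g hbd hbd
    refine ⟨x, fun γ hγ => ?_⟩
    obtain ⟨a, ha⟩ := hg' γ hγ
    exact ⟨ι a, by rw [hx]; exact hg a, by rw [hx]; exact not_lt.2 ha⟩

/-- If $cf(\sigma)\le\nu$, a cofinal family indexed by the elements of rank less than $cf(\sigma)$
is small and bounded, hence coded, and contradicts `CofLt`. If $\nu<cf(\sigma)$, no function defined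
on part of the predecessors of $\nu$ is cofinal. -/
theorem cofLt_iff (hκ : (2 : Cardinal.{u}) ^ ℵ₀ < P.kappa.ord.cof) {S : P.CardMinus → Prop}
    {σ : Ordinal.{u + 1}} (hS : ∀ γ, S γ ↔ P.rk γ < σ) (hσ : σ < P.alpha) (hc : σ.cof ≤ 2 ^ ℵ₀)
    (ν : P.CardMinus) : P.CofLt S ν ↔ P.rk ν < σ.cof.ord := by
  constructor
  · intro h
    by_contra! hle
    obtain ⟨X, g, hX, hg, hg'⟩ := exists_cofinal hS hσ.le
    obtain ⟨b, hb⟩ := exists_rk hσ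
    have he : #X = #(σ.cof.ord).ToType := by rw [hX, mk_toType, card_ord]
    obtain ⟨e⟩ := Cardinal.eq.1 he
    choose f hf using fun a => exists_rk
      ((coe_toTypeMk_symm_lt (e a)).trans_le (hle.trans (rk_lt_alpha ν).le))
    have hfν : ∀ a, f a < ν := fun a => rk_lt_rk.1 (by
      rw [hf]; exact (coe_toTypeMk_symm_lt (e a)).trans_le hle)
    obtain ⟨d, x, y, ι, hd, hx, hy⟩ := P.exists_code_pair hκ (hX ▸ hc) f g
      ⟨ν, fun a => (hfν a).le⟩ ⟨b, fun a => rk_le_rk.1 (hb ▸ ((hS _).1 (hg a)).le)⟩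
    obtain ⟨γ, hγ, hγ'⟩ := h d x y
      (by
        intro t t' ht ht' htt
        obtain ⟨a, rfl⟩ := (hd t).1 ht
        obtain ⟨a', rfl⟩ := (hd t').1 ht'
        rw [hx, hx] at htt
        have := congrArg P.rk htt
        rw [hf, hf] at this
        rw [e.injective (ToType.mk.symm.injective (Subtype.ext this))])
      (by
        intro t ht
        obtain ⟨a, rfl⟩ := (hd t).1 ht
        rw [hx, hy]
        exact ⟨hfν a, hg a⟩)
    obtain ⟨a, ha⟩ := hg' γ hγ
    have := hγ' (ι a) ((hd _).2 ⟨a, rfl⟩)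
    rw [hy] at this
    exact absurd ha (not_le.2 this)
  · intro h d x y h1 h2
    classical
    have hcard : #{ξ : P.CardMinus // P.rk ξ < P.rk ν} < σ.cof := by
      rw [Cardinal.lt_ord] at h
      refine lt_of_le_of_lt ?_ h
      rw [← mk_toType]
      exact mk_le_of_injective (f := fun ξ => ToType.mk ⟨P.rk ξ.1, ξ.2⟩) fun ξ ξ' hξ =>
        Subtype.ext (rk_injective (congrArg Subtype.val (ToType.mk.injective hξ)))
    -- The coded function is extended by `0` where it is undefined, so `0` must be below `σ`.
    have h0 : 0 < σ := by
      rw [← Ordinal.cof_pos]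
      exact zero_le.trans_lt hcard
    have key := Ordinal.iSup_add_one_lt_of_lt_cof
      (f := fun ξ : {ξ : P.CardMinus // P.rk ξ < P.rk ν} =>
        if H : ∃ t, P.CodeMem d t ∧ P.app x t = ξ.1 then P.rk (P.app y H.choose) else 0) hcard (by
          intro ξ
          split_ifs with H
          · exact (hS _).1 (h2 _ H.choose_spec.1).2
          · exact h0)
    obtain ⟨γ, hγ⟩ := exists_rk (key.trans hσ)
    refine ⟨γ, (hS γ).2 (hγ ▸ key), fun t ht => ?_⟩
    rw [← rk_lt_rk, hγ]
    have H : ∃ t', P.CodeMem d t' ∧ P.app x t' = P.app x t := ⟨t, ht, rfl⟩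
    have hle := Ordinal.le_iSup (fun ξ : {ξ : P.CardMinus // P.rk ξ < P.rk ν} =>
      (if H : ∃ t, P.CodeMem d t ∧ P.app x t = ξ.1 then P.rk (P.app y H.choose) else 0) + 1)
      ⟨P.app x t, rk_lt_rk.2 (h2 t ht).1⟩
    refine lt_of_lt_of_le ?_ hle
    dsimp only
    rw [dif_pos H, h1 _ t H.choose_spec.1 ht H.choose_spec.2]
    exact lt_add_one _

/-- The rank of `ν` is less than `α^[n]`; here `T` defines `α^[n]` in the case that
`α[n] = α`. -/
def InCof (T : P.CardMinus → Prop) (n : ℕ) (ν : P.CardMinus) : Prop :=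
  ((∃ γ, ¬ P.Big (n + 1) γ) ∧ (((∀ γ, ¬ P.Big (n + 1) γ) ∧ ∀ ξ, ¬ ξ < ν) ∨
    ((∃ γ, P.Big (n + 1) γ) ∧ P.SmallCof (P.Big (n + 1)) ∧ P.CofLt (P.Big (n + 1)) ν))) ∨
    ((∀ γ, P.Big (n + 1) γ) ∧ T ν)

/-- For $\alpha[n]=0$ the value is $1$, so that only the least element qualifies. For
$0<\alpha[n]<\alpha$ the segment is proper and its cofinality is definable, a large one giving the
value $0$. The case $\alpha[n]=\alpha$ is handed over to `T`. -/
theorem inCof_iff (hκ : (2 : Cardinal.{u}) ^ ℵ₀ < P.kappa.ord.cof) {T : P.CardMinus → Prop} {n : ℕ}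
    (hT : head P.alpha n = P.alpha → ∀ ν, T ν ↔ P.rk ν < cofCoeff P.alpha n) (ν : P.CardMinus) :
    P.InCof T n ν ↔ P.rk ν < cofCoeff P.alpha n := by
  rcases (head_le P.alpha n).lt_or_eq with hlt | heq
  · obtain ⟨b, hb⟩ := exists_rk hlt
    have h1 : ∃ γ, ¬ P.Big (n + 1) γ := ⟨b, by rw [big_succ_iff, hb]; exact lt_irrefl _⟩
    rw [InCof, or_iff_left fun h => h1.choose_spec (h.1 _), and_iff_right h1]
    by_cases h0 : head P.alpha n = 0
    · have h2 : ∀ γ, ¬ P.Big (n + 1) γ := fun γ => by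
        rw [big_succ_iff, h0]
        exact not_lt_zero
      rw [or_iff_left fun h => h2 _ h.1.choose_spec, and_iff_right h2, cofCoeff_of_head_eq_zero h0,
        Order.lt_one_iff]
      constructor
      · intro h
        by_contra hν
        obtain ⟨ξ, hξ⟩ := exists_rk (zero_le.trans_lt (rk_lt_alpha ν))
        exact h ξ (rk_lt_rk.1 (hξ ▸ _root_.pos_iff_ne_zero.2 hν))
      · intro h ξ hξ
        rw [← rk_lt_rk, h] at hξ
        exact not_lt_zero hξ
    · have h2 : ∃ γ, P.Big (n + 1) γ := by
        obtain ⟨ξ, hξ⟩ := exists_rk (zero_le.trans_lt (rk_lt_alpha ν))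
        exact ⟨ξ, by rw [big_succ_iff, hξ]; exact _root_.pos_iff_ne_zero.2 h0⟩
      rw [or_iff_right fun h => h.1 _ h2.choose_spec, and_iff_right h2,
        P.smallCof_iff hκ (P.big_succ_iff n) hlt]
      by_cases hc : (head P.alpha n).cof ≤ 2 ^ ℵ₀
      · rw [P.cofLt_iff hκ (P.big_succ_iff n) hlt hc, and_iff_right hc, cofCoeff_of_cof_le h0 hc]
      · rw [cofCoeff_of_lt_cof (not_le.1 hc), iff_false_right not_lt_zero]
        exact fun h => hc h.1
  · have h1 : ∀ γ, P.Big (n + 1) γ := fun γ => by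
      rw [big_succ_iff, heq]
      exact rk_lt_alpha γ
    rw [InCof, or_iff_right fun h => h.1.choose_spec (h1 _), and_iff_right h1, hT heq]

end Triple

/-! ### Cofinalities of ordinals in normal form -/

theorem cof_Omega : Omega.{w}.cof = Order.succ (2 ^ ℵ₀) := by
  rw [Omega]
  exact (isRegular_succ Triple.aleph0_le_two_power).cof_ord

/-- The cofinality is that of the last factor `Ω`, which is regular. If $cf(\alpha)\le
2^{\aleph_0}$, this excludes $\alpha=\gamma+\Omega^{k+1}$. -/
theorem two_power_lt_cof_add_Omega_pow (γ : Ordinal.{w}) (k : ℕ) :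
    2 ^ ℵ₀ < (γ + Omega ^ (k + 1)).cof := by
  rw [cof_add _ (Omega_pow_ne_zero _), pow_succ, cof_mul (Omega_pow_ne_zero _)
    isSuccLimit_Omega.isSuccPrelimit, cof_Omega]
  exact Order.lt_succ _

theorem head_add_coeff {α : Ordinal.{w}} : ∀ {m : ℕ}, (∀ k < m, coeff α k = 0) →
    head α m + Omega ^ m * coeff α m = α
  | 0, _ => by rw [pow_zero, one_mul, head_zero_add]
  | m + 1, h => by
    have h1 := head_add_coeff fun k hk => h k (Nat.lt_succ_of_lt hk)
    rw [h m (Nat.lt_succ_self m), mul_zero, add_zero] at h1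
    rw [head_succ_add, h1]

namespace Triple

variable (P : Triple.{u}) {n : ℕ}

theorem alpha_ne_zero : P.alpha ≠ 0 := fun h =>
  not_lt_zero (h ▸ rk_lt_alpha (⟨0, zero_le.trans_lt P.kappa_lt, Or.inl rfl⟩ : P.CardMinus))

theorem cof_alpha : P.alpha.cof = Order.cof P.CardMinus := cof_type P.CardMinus

/-! ### The case of large cofinality of `λ` -/

section LargeCof

variable {P}

theorem exists_bound (hl : (2 : Cardinal.{u}) ^ ℵ₀ < P.lam.ord.cof) {X : Type (u + 1)}
    (hX : #X ≤ 2 ^ ℵ₀) (f : X → P.CardMinus) : ∃ b, ∀ a, f a ≤ b := by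
  have h : ⨆ a, (f a).1 < P.lam := by
    refine Cardinal.lift_iSup_lt_of_lt_cof_ord ?_ fun a => (f a).2.1
    rw [Cardinal.lift_id'.{u, u + 1}]
    refine hX.trans_lt ?_
    have := Cardinal.lift_lt.{u, u + 1}.2 hl
    rw [Ordinal.lift_cof] at this
    simpa using this
  have hb : BddAbove (Set.range fun a => (f a).1) :=
    ⟨P.lam, by rintro _ ⟨a, rfl⟩; exact (f a).2.1.le⟩
  exact ⟨⟨max (⨆ a, (f a).1) P.kappa, max_lt h P.kappa_lt, Or.inr (le_max_right _ _)⟩,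
    fun a => (le_ciSup hb a).trans (le_max_left _ _)⟩

/-- Sets of at most continuum size are bounded here, so multiples can be counted in the whole final
segment from $\nu$ on. -/
theorem big_succ_iff_of_lt_cof (hκ : (2 : Cardinal.{u}) ^ ℵ₀ < P.kappa.ord.cof)
    (hl : (2 : Cardinal.{u}) ^ ℵ₀ < P.lam.ord.cof) (k : ℕ) (ν : P.CardMinus) :
    P.Big (k + 1) ν ↔ ¬ ∃ x : P.F 2, ∀ δ, P.Mult k δ ∧ ¬ δ < ν → ∃ t, P.app x t = δ := by
  rw [P.exists_cover_iff hκ, Big, ← not_iff_not, not_not, ← P.mk_multiples_le_iff k ν le_rfl]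
  · simp only [P.mult_iff hκ, not_lt, rk_lt_alpha, and_true]
  · intro h
    obtain ⟨b, hb⟩ := exists_bound hl h Subtype.val
    exact ⟨b, fun ν hν => hb ⟨ν, hν⟩⟩

/-- A cofinal set of size at most the continuum would be bounded by some element, but $\alpha$ is a
limit. -/
theorem cofCoeff_eq_zero_of_lt_cof (hl : (2 : Cardinal.{u}) ^ ℵ₀ < P.lam.ord.cof)
    (h : head P.alpha n = P.alpha) : cofCoeff P.alpha n = 0 := by
  refine cofCoeff_of_lt_cof (not_le.1 fun hc => ?_)
  rw [h, cof_alpha] at hc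
  obtain ⟨s, hs, hs'⟩ := Order.exists_cof_eq P.CardMinus
  obtain ⟨b, hb⟩ := exists_bound hl (hs'.trans_le hc) Subtype.val
  have hlim := head_isSuccLimit (h.trans_ne P.alpha_ne_zero)
  obtain ⟨c, hc⟩ := exists_rk (h ▸ hlim.succ_lt (h.symm ▸ rk_lt_alpha b))
  obtain ⟨a, ha, hca⟩ := hs c
  have h1 : P.rk c ≤ P.rk b := rk_le_rk.2 (hca.trans (hb ⟨a, ha⟩))
  rw [hc] at h1
  exact absurd (Order.lt_succ (P.rk b)) (not_lt.2 h1)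

end LargeCof

/-! ### The case of small cofinality of `λ` -/

section SmallCof

variable {P}

/-- An infinite successor cardinal is regular, whereas $cf(\lambda)\le 2^{\aleph_0}<\lambda$. -/
theorem succ_lt_lam (hκ : (2 : Cardinal.{u}) ^ ℵ₀ < P.kappa.ord.cof)
    (hl : P.lam.ord.cof ≤ 2 ^ ℵ₀) {ν : Cardinal.{u}} (h : ν < P.lam) : Order.succ ν < P.lam := by
  refine lt_of_le_of_ne (Order.succ_le_of_lt h) fun h' => ?_
  have h1 : P.kappa ≤ ν := Order.lt_succ_iff.1 (h' ▸ P.kappa_lt)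
  have h2 : P.lam.ord.cof = P.lam := by
    rw [← h']
    exact (isRegular_succ (P.aleph0_le.trans h1)).cof_ord
  rw [h2] at hl
  exact absurd ((P.two_power_lt hκ).trans P.kappa_lt) (not_lt.2 hl)

theorem cof_alpha_le (hl : P.lam.ord.cof ≤ 2 ^ ℵ₀) : P.alpha.cof ≤ 2 ^ ℵ₀ := by
  obtain ⟨s, hs, hs'⟩ := Order.exists_cof_eq P.lam.ord.ToType
  have hlt : ∀ a : P.lam.ord.ToType, (ToType.mk.symm a).1.card < P.lam := fun a =>
    Cardinal.lt_ord.1 (coe_toTypeMk_symm_lt a)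
  -- A cofinal set of ordinals below $\lambda$ yields a cofinal set of cardinals; the maximum with
  -- $\kappa$ puts them into $Card^-$.
  let f : s → P.CardMinus := fun a => ⟨max (ToType.mk.symm a.1).1.card P.kappa,
    max_lt (hlt a.1) P.kappa_lt, Or.inr (le_max_right _ _)⟩
  have hc : IsCofinal (Set.range f) := by
    intro ν
    obtain ⟨a, ha, hle⟩ := hs (ToType.mk ⟨ν.1.ord, Cardinal.ord_lt_ord.2 ν.2.1⟩)
    refine ⟨f ⟨a, ha⟩, ⟨_, rfl⟩, ?_⟩
    rw [← OrderIso.le_symm_apply] at hle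
    have h1 : ν.1 ≤ (ToType.mk.symm a).1.card := by
      rw [← card_ord ν.1]
      exact Ordinal.card_le_card hle
    exact h1.trans (le_max_left _ _)
  rw [cof_alpha]
  refine (Order.cof_le hc).trans ?_
  have h1 := Cardinal.mk_range_le_lift (f := f)
  rw [Cardinal.lift_id'.{u, u + 1}] at h1
  refine h1.trans ?_
  rw [hs', cof_toType]
  have := Cardinal.lift_le.{u + 1}.2 hl
  simpa using this

theorem alpha_isSuccLimit (hκ : (2 : Cardinal.{u}) ^ ℵ₀ < P.kappa.ord.cof)
    (hl : P.lam.ord.cof ≤ 2 ^ ℵ₀) : Order.IsSuccLimit P.alpha := by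
  rw [← one_lt_cof_iff, cof_alpha]
  have : Nonempty P.CardMinus := ⟨⟨0, zero_le.trans_lt P.kappa_lt, Or.inl rfl⟩⟩
  rw [Order.one_lt_cof_iff]
  refine ⟨fun ν => ⟨⟨max (Order.succ ν.1) P.kappa, max_lt (succ_lt_lam hκ hl ν.2.1) P.kappa_lt,
    Or.inr (le_max_right _ _)⟩, fun h => ?_⟩⟩
  exact absurd ((le_max_left _ _).trans h) (not_le.2 (Order.lt_succ ν.1))

/-- Small sets may be unbounded here, so only bounded intervals can be counted. These suffice
because $\nu+\Omega^{k+1}=\alpha$ is impossible: the left side has cofinality greater than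
$2^{\aleph_0}$. -/
theorem big_succ_iff_of_cof_le (hκ : (2 : Cardinal.{u}) ^ ℵ₀ < P.kappa.ord.cof)
    (hl : P.lam.ord.cof ≤ 2 ^ ℵ₀) (k : ℕ) (ν : P.CardMinus) :
    P.Big (k + 1) ν ↔ ∃ β, ¬ ∃ x : P.F 2, ∀ δ, P.Mult k δ ∧ ¬ δ < ν ∧ δ < β → ∃ t, P.app x t = δ := by
  have h1 : P.Big (k + 1) ν ↔ ∃ β, P.rk ν + Omega ^ (k + 1) ≤ P.rk β := by
    rw [Big, le_iff_lt_or_eq, or_iff_left]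
    · constructor
      · intro h
        obtain ⟨β, hβ⟩ := exists_rk h
        exact ⟨β, hβ.ge⟩
      · rintro ⟨β, hβ⟩
        exact hβ.trans_lt (rk_lt_alpha β)
    · intro h
      have := two_power_lt_cof_add_Omega_pow (P.rk ν) k
      rw [h] at this
      exact absurd this (not_lt.2 (cof_alpha_le hl))
  rw [h1]
  refine exists_congr fun β => ?_
  rw [P.exists_cover_iff hκ fun _ => ⟨β, fun _ h => h.2.2.le⟩, ← not_iff_not, not_not,
    ← P.mk_multiples_le_iff k ν (rk_lt_alpha β).le]
  simp only [P.mult_iff hκ, not_lt, rk_lt_rk]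

theorem cofCoeff_eq_of_cof_le (hl : P.lam.ord.cof ≤ 2 ^ ℵ₀) (h : head P.alpha n = P.alpha) :
    cofCoeff P.alpha n = P.alpha.cof.ord := by
  have h0 := P.alpha_ne_zero
  have hc := cof_alpha_le hl
  rw [← h] at h0 hc
  rw [cofCoeff_of_cof_le h0 hc, h]

theorem cof_ord_alpha_lt (hl : P.lam.ord.cof ≤ 2 ^ ℵ₀) (h : head P.alpha n = P.alpha) : P.alpha.cof.ord < P.alpha := by
  have h1 := Omega_le_head (h.trans_ne P.alpha_ne_zero)
  rw [h] at h1
  exact (lt_Omega_of_card_le (by rw [card_ord]; exact cof_alpha_le hl)).trans_le h1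

/-- Here $\alpha=\alpha[m]+\Omega^m\alpha_{[m]}$. If $\alpha_{[m]}$ were a successor, $\alpha$ would
end with a summand $\Omega^m$: for $m=0$ it would be a successor, for $m>0$ its cofinality would be
too large. So $\alpha_{[m]}$ is a limit and passes its cofinality on to $\alpha$. -/
theorem cof_alpha_eq (hκ : (2 : Cardinal.{u}) ^ ℵ₀ < P.kappa.ord.cof)
    (hl : P.lam.ord.cof ≤ 2 ^ ℵ₀) {m : ℕ} (hm : coeff P.alpha m ≠ 0)
    (hm' : ∀ k < m, coeff P.alpha k = 0) : P.alpha.cof = (coeff P.alpha m).cof := by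
  have h := head_add_coeff hm'
  have hpre : Order.IsSuccPrelimit (coeff P.alpha m) := by
    by_contra hpre
    obtain ⟨j, -, hj⟩ := Order.not_isSuccPrelimit_iff_succ_eq.1 hpre
    rw [← hj, Order.succ_eq_add_one, mul_add, mul_one, ← add_assoc] at h
    cases m with
    | zero =>
      rw [pow_zero, one_mul, ← Order.succ_eq_add_one] at h
      exact Order.not_isSuccPrelimit_succ _ (h ▸ (alpha_isSuccLimit hκ hl).isSuccPrelimit)
    | succ m =>
      have := two_power_lt_cof_add_Omega_pow (head P.alpha (m + 1) + Omega ^ (m + 1) * j) m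
      rw [h] at this
      exact absurd this (not_lt.2 (cof_alpha_le hl))
  conv_lhs => rw [← h]
  rw [cof_add _ (mul_ne_zero (Omega_pow_ne_zero _) hm), cof_mul (Omega_pow_ne_zero _) hpre]

/-- Families cofinal in $\alpha$ are not represented in $F_2$, but $\alpha_{[m]}<\Omega\le\alpha$ is
a proper initial segment with the same cofinality. -/
theorem cofLt_inCoeff_iff (hκ : (2 : Cardinal.{u}) ^ ℵ₀ < P.kappa.ord.cof)
    (hl : P.lam.ord.cof ≤ 2 ^ ℵ₀) {m : ℕ} (hm : coeff P.alpha m ≠ 0)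
    (hm' : ∀ k < m, coeff P.alpha k = 0) (h : head P.alpha n = P.alpha) (ν : P.CardMinus) :
    P.CofLt (P.InCoeff m) ν ↔ P.rk ν < cofCoeff P.alpha n := by
  have h1 := Omega_le_head (h.trans_ne P.alpha_ne_zero)
  rw [h] at h1
  rw [P.cofLt_iff hκ (P.inCoeff_iff hκ m) ((coeff_lt _ m).trans_le h1)
    ((cof_le_card _).trans (card_le_of_lt_Omega (coeff_lt _ m))), cofCoeff_eq_of_cof_le hl h,
    cof_alpha_eq hκ hl hm hm']

end SmallCof

end Triple

/-! ### Definability in `M*` -/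

section DefinableM

variable {I : Type*} {P : I → Triple.{u}} {ι : Type} {σ : ι → MSort}

/-- The assignments in `M*` to the variables of a context. -/
abbrev MEnv (P : Triple.{u}) (σ : ι → MSort) : Type (u + 1) := P.MStar.Env (L := langM) σ

/-- Uniform definability in the structures `M*` of a family of triples. -/
abbrev DefM (P : I → Triple.{u}) {σ : ι → MSort} (S : ∀ i, MEnv (P i) σ → Prop) : Prop :=
  Definable (L := langM) (fun i => (P i).MStar) S

/-- Variables for the structures `M*` of a family of triples. -/
abbrev VarM (P : I → Triple.{u}) {σ : ι → MSort} (s : MSort)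
    (t : ∀ i, MEnv (P i) σ → (P i).MCarrier s) : Prop :=
  IsVar (L := langM) (fun i => (P i).MStar) s t

namespace DefM

theorem allCard {Q : ∀ i, MEnv (P i) σ → (P i).CardMinus → Prop}
    (h : DefM P (σ := extend σ .card) fun i e => Q i (fun j => e (some j)) (e none)) :
    DefM P fun i e => ∀ a, Q i e a := Definable.all (L := langM) MSort.card h

theorem exCard {Q : ∀ i, MEnv (P i) σ → (P i).CardMinus → Prop}
    (h : DefM P (σ := extend σ .card) fun i e => Q i (fun j => e (some j)) (e none)) :
    DefM P fun i e => ∃ a, Q i e a := Definable.ex (L := langM) MSort.card h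

theorem allF {n : ℕ} {Q : ∀ i, MEnv (P i) σ → (P i).F (n + 1) → Prop}
    (h : DefM P (σ := extend σ (.f n)) fun i e => Q i (fun j => e (some j)) (e none)) :
    DefM P fun i e => ∀ a, Q i e a := Definable.all (L := langM) (MSort.f n) h

theorem exF {n : ℕ} {Q : ∀ i, MEnv (P i) σ → (P i).F (n + 1) → Prop}
    (h : DefM P (σ := extend σ (.f n)) fun i e => Q i (fun j => e (some j)) (e none)) :
    DefM P fun i e => ∃ a, Q i e a := Definable.ex (L := langM) (MSort.f n) h

theorem allIS {n : ℕ} {Q : ∀ i, MEnv (P i) σ → (P i).IS (n + 1) → Prop}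
    (h : DefM P (σ := extend σ (.is n)) fun i e => Q i (fun j => e (some j)) (ULift.down (e none))) :
    DefM P fun i e => ∀ a, Q i e a :=
  (Definable.all (L := langM) (MSort.is n)
    (Q := fun i e (a : ULift.{u + 1} ((P i).IS (n + 1))) => Q i e a.down) h).congr
      fun _ _ => ⟨fun H a => H ⟨a⟩, fun H a => H a.down⟩

theorem exIS {n : ℕ} {Q : ∀ i, MEnv (P i) σ → (P i).IS (n + 1) → Prop}
    (h : DefM P (σ := extend σ (.is n)) fun i e => Q i (fun j => e (some j)) (ULift.down (e none))) :
    DefM P fun i e => ∃ a, Q i e a :=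
  (Definable.ex (L := langM) (MSort.is n)
    (Q := fun i e (a : ULift.{u + 1} ((P i).IS (n + 1))) => Q i e a.down) h).congr
      fun _ _ => ⟨fun ⟨a, H⟩ => ⟨a.down, H⟩, fun ⟨a, H⟩ => ⟨⟨a⟩, H⟩⟩

theorem eqIS {n : ℕ} {x y : ∀ i, MEnv (P i) σ → ULift.{u + 1} ((P i).IS (n + 1))}
    (hx : VarM P (.is n) x) (hy : VarM P (.is n) y) :
    DefM P fun i e => (x i e).down = (y i e).down :=
  (Definable.eq (L := langM) (s := MSort.is n) hx hy).congr fun _ _ => ULift.down_inj.symm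

theorem ltCard {x y : ∀ i, MEnv (P i) σ → (P i).CardMinus} (hx : VarM P .card x)
    (hy : VarM P .card y) : DefM P fun i e => x i e < y i e :=
  Definable.rel (L := langM) MRel.lt (x := Fin.cons x (Fin.cons y fun a => a.elim0))
    (Fin.cases hx (Fin.cases hy fun a => a.elim0))

theorem eq1 {x : ∀ i, MEnv (P i) σ → ULift.{u + 1} ((P i).IS 2)} (hx : VarM P (.is 1) x) :
    DefM P fun i e => (P i).Eq1 (x i e).down :=
  Definable.rel (L := langM) MRel.eq1 (x := Fin.cons x fun a => a.elim0)
    (Fin.cases hx fun a => a.elim0)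

theorem prod1 {x : ∀ i, MEnv (P i) σ → ULift.{u + 1} ((P i).IS 3)} (hx : VarM P (.is 2) x) :
    DefM P fun i e => (P i).Prod1 (x i e).down :=
  Definable.rel (L := langM) MRel.prod1 (x := Fin.cons x fun a => a.elim0)
    (Fin.cases hx fun a => a.elim0)

theorem proj1 {n : ℕ} {x : ∀ i, MEnv (P i) σ → ULift.{u + 1} ((P i).IS (n + 2))}
    {y : ∀ i, MEnv (P i) σ → ULift.{u + 1} ((P i).IS (n + 1))}
    (hx : VarM P (.is (n + 1)) x) (hy : VarM P (.is n) y) :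
    DefM P fun i e => (P i).Proj1 (x i e).down (y i e).down :=
  Definable.rel (L := langM) (MRel.proj1 n) (x := Fin.cons x (Fin.cons y fun a => a.elim0))
    (Fin.cases hx (Fin.cases hy fun a => a.elim0))

theorem app_eq {n : ℕ} {x : ∀ i, MEnv (P i) σ → (P i).F (n + 1)}
    {t : ∀ i, MEnv (P i) σ → ULift.{u + 1} ((P i).IS (n + 1))}
    {y : ∀ i, MEnv (P i) σ → (P i).CardMinus}
    (hx : VarM P (.f n) x) (ht : VarM P (.is n) t) (hy : VarM P .card y) :
    DefM P fun i e => (P i).app (x i e) (t i e).down = y i e :=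
  Definable.rel (L := langM) (MRel.app n)
    (x := Fin.cons x (Fin.cons t (Fin.cons y fun a => a.elim0)))
    (Fin.cases hx (Fin.cases ht (Fin.cases hy fun a => a.elim0)))

/-- Only variables may be substituted into a formula and $App_n$ is given by its graph, so its value
is introduced by an existential quantifier. -/
theorem of_app {n : ℕ} {x : ∀ i, MEnv (P i) σ → (P i).F (n + 1)}
    {t : ∀ i, MEnv (P i) σ → ULift.{u + 1} ((P i).IS (n + 1))}
    {Q : ∀ i, MEnv (P i) σ → (P i).CardMinus → Prop}
    (hx : VarM P (.f n) x) (ht : VarM P (.is n) t)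
    (h : DefM P (σ := extend σ .card) fun i e => Q i (fun j => e (some j)) (e none)) :
    DefM P fun i e => Q i e ((P i).app (x i e) (t i e).down) :=
  (exCard (Q := fun i e z => (P i).app (x i e) (t i e).down = z ∧ Q i e z)
    ((app_eq hx.weaken ht.weaken .last).and h)).congr fun _ _ =>
      ⟨fun ⟨_, h1, h2⟩ => h1 ▸ h2, fun h => ⟨_, rfl, h⟩⟩

theorem codeMem {n : ℕ} {x : ∀ i, MEnv (P i) σ → (P i).F (n + 1)}
    {t : ∀ i, MEnv (P i) σ → ULift.{u + 1} ((P i).IS (n + 1))}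
    (hx : VarM P (.f n) x) (ht : VarM P (.is n) t) :
    DefM P fun i e => (P i).CodeMem (x i e) (t i e).down :=
  exCard ((app_eq hx.weaken ht.weaken .last).and (allCard (ltCard .last (IsVar.last.weaken)).not))

theorem projIter : ∀ {m n : ℕ} {ι : Type} {σ : ι → MSort}
    {x : ∀ i, MEnv (P i) σ → ULift.{u + 1} ((P i).IS (m + 1))}
    {y : ∀ i, MEnv (P i) σ → ULift.{u + 1} ((P i).IS (n + 1))},
    VarM P (.is m) x → VarM P (.is n) y →
    DefM P fun i e => (P i).ProjIter m n (x i e).down (y i e).down := by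
  have heq : ∀ {m n : ℕ} {ι : Type} {σ : ι → MSort}
      {x : ∀ i, MEnv (P i) σ → ULift.{u + 1} ((P i).IS (m + 1))}
      {y : ∀ i, MEnv (P i) σ → ULift.{u + 1} ((P i).IS (n + 1))},
      VarM P (.is m) x → VarM P (.is n) y →
      DefM P fun i e => m = n ∧ (x i e).down ≍ (y i e).down := by
    intro m n ι σ x y hx hy
    -- The levels are not part of the formula: whether they agree decides which formula is taken.
    by_cases h : m = n
    · subst h
      exact (eqIS hx hy).congr fun _ _ => by simp
    · exact Definable.false.congr fun _ _ => by simp [h]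
  intro m
  induction m with
  | zero => intro n ι σ x y hx hy; exact heq hx hy
  | succ m ih =>
    intro n ι σ x y hx hy
    exact (heq hx hy).or (exIS ((proj1 hx.weaken .last).and (ih .last hy.weaken)))

theorem codeRel {m p q : ℕ} {l r : ∀ i, MEnv (P i) σ → (P i).F (m + 2)}
    {c : ∀ i, MEnv (P i) σ → (P i).F (m + 3)}
    {x : ∀ i, MEnv (P i) σ → ULift.{u + 1} ((P i).IS (p + 1))}
    {y : ∀ i, MEnv (P i) σ → ULift.{u + 1} ((P i).IS (q + 1))}
    (hl : VarM P (.f (m + 1)) l) (hr : VarM P (.f (m + 1)) r) (hc : VarM P (.f (m + 2)) c)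
    (hx : VarM P (.is p) x) (hy : VarM P (.is q) y) :
    DefM P fun i e => (P i).CodeRel m p q (l i e) (r i e) (c i e) (x i e).down (y i e).down :=
  exIS <| exIS <| exIS <| (codeMem hl.weaken.weaken.weaken IsVar.last.weaken.weaken).and <|
    (codeMem hr.weaken.weaken.weaken IsVar.last.weaken).and <|
    (codeMem hc.weaken.weaken.weaken .last).and <|
    (proj1 .last IsVar.last.weaken.weaken).and <| (proj1 .last IsVar.last.weaken).and <|
    (projIter IsVar.last.weaken.weaken hx.weaken.weaken.weaken).and
      (projIter IsVar.last.weaken hy.weaken.weaken.weaken)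

theorem codeOrd {l r l' r' : ∀ i, MEnv (P i) σ → (P i).F 3}
    {c c' : ∀ i, MEnv (P i) σ → (P i).F 4} {x : ∀ i, MEnv (P i) σ → ULift.{u + 1} ((P i).IS 2)}
    {ν : ∀ i, MEnv (P i) σ → (P i).CardMinus}
    (hl : VarM P (.f 2) l) (hr : VarM P (.f 2) r) (hc : VarM P (.f 3) c)
    (hl' : VarM P (.f 2) l') (hr' : VarM P (.f 2) r') (hc' : VarM P (.f 3) c')
    (hx : VarM P (.is 1) x) (hν : VarM P .card ν) :
    DefM P fun i e => (P i).CodeOrd (l i e) (r i e) (c i e) (l' i e) (r' i e) (c' i e)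
      (x i e).down (ν i e) := by
  refine exF (Definable.and ?_ ?_)
  · refine allIS (allIS (Definable.imp ?_ (Definable.imp ?_ (Definable.imp ?_ ?_))))
    · exact codeRel hl.weaken.weaken.weaken hr.weaken.weaken.weaken hc.weaken.weaken.weaken
        hx.weaken.weaken.weaken IsVar.last.weaken
    · exact codeRel hl.weaken.weaken.weaken hr.weaken.weaken.weaken hc.weaken.weaken.weaken
        hx.weaken.weaken.weaken .last
    · exact codeRel hl'.weaken.weaken.weaken hr'.weaken.weaken.weaken hc'.weaken.weaken.weaken
        IsVar.last.weaken .last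
    · refine of_app IsVar.last.weaken.weaken IsVar.last.weaken (Q := fun i e a => a < _) ?_
      refine of_app IsVar.last.weaken.weaken.weaken IsVar.last.weaken (Q := fun i e a => _ < a) ?_
      exact ltCard IsVar.last.weaken .last
  · refine allCard (Definable.iff (ltCard .last hν.weaken.weaken) (exIS (Definable.and ?_ ?_)))
    · exact codeRel hl.weaken.weaken.weaken hr.weaken.weaken.weaken hc.weaken.weaken.weaken
        hx.weaken.weaken.weaken .last
    · exact app_eq IsVar.last.weaken.weaken .last IsVar.last.weaken

theorem mult : ∀ {k : ℕ} {ι : Type} {σ : ι → MSort} {ν : ∀ i, MEnv (P i) σ → (P i).CardMinus},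
    VarM P .card ν → DefM P fun i e => (P i).Mult k (ν i e)
  | 0, _, _, _, _ => Definable.true
  | _ + 1, _, _, _, hν =>
    allCard <| (ltCard .last hν.weaken).imp <| Definable.not <| exF <| allCard <|
      ((mult .last).and ((ltCard .last IsVar.last.weaken.weaken).not.and
        (ltCard .last hν.weaken.weaken.weaken))).imp <|
      exIS (app_eq IsVar.last.weaken.weaken .last IsVar.last.weaken)

end DefM

/-- The predicates `Big k` are definable in the structures `M*` of a family of triples. -/
def BigDefinable (P : I → Triple.{u}) : Prop :=
  ∀ (k : ℕ) {ι : Type} {σ : ι → MSort} {ν : ∀ i, MEnv (P i) σ → (P i).CardMinus},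
    VarM P .card ν → DefM P fun i e => (P i).Big k (ν i e)

theorem bigDefinable_of_lt_cof (hκ : ∀ i, (2 : Cardinal.{u}) ^ ℵ₀ < (P i).kappa.ord.cof)
    (hl : ∀ i, (2 : Cardinal.{u}) ^ ℵ₀ < (P i).lam.ord.cof) : BigDefinable P := by
  rintro (_ | k) ι σ ν hν
  · refine Definable.true.congr fun i e => iff_of_true trivial ?_
    rw [Triple.Big, pow_zero, ← Order.succ_eq_add_one, Order.succ_le_iff]
    exact Triple.rk_lt_alpha _
  · exact Definable.congr (Definable.not (DefM.exF (DefM.allCard (((DefM.mult .last).and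
      (DefM.ltCard .last hν.weaken.weaken).not).imp (DefM.exIS
        (DefM.app_eq IsVar.last.weaken.weaken .last IsVar.last.weaken)))))) fun i e =>
          (Triple.big_succ_iff_of_lt_cof (hκ i) (hl i) k (ν i e)).symm

theorem bigDefinable_of_cof_le (hκ : ∀ i, (2 : Cardinal.{u}) ^ ℵ₀ < (P i).kappa.ord.cof)
    (hl : ∀ i, (P i).lam.ord.cof ≤ (2 : Cardinal.{u}) ^ ℵ₀) : BigDefinable P := by
  rintro (_ | k) ι σ ν hν
  · refine Definable.true.congr fun i e => iff_of_true trivial ?_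
    rw [Triple.Big, pow_zero, ← Order.succ_eq_add_one, Order.succ_le_iff]
    exact Triple.rk_lt_alpha _
  · exact Definable.congr (DefM.exCard (Definable.not (DefM.exF (DefM.allCard
      (((DefM.mult .last).and ((DefM.ltCard .last hν.weaken.weaken.weaken).not.and
        (DefM.ltCard .last IsVar.last.weaken.weaken))).imp (DefM.exIS
        (DefM.app_eq IsVar.last.weaken.weaken .last IsVar.last.weaken))))))) fun i e =>
          (Triple.big_succ_iff_of_cof_le (hκ i) (hl i) k (ν i e)).symm

namespace BigDefinable

variable (hB : BigDefinable P) {n : ℕ} {ν : ∀ i, MEnv (P i) σ → (P i).CardMinus}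
include hB

theorem block (hν : VarM P .card ν) : DefM P fun i e => (P i).Block n (ν i e) :=
  (DefM.mult hν).and ((hB n hν).and (hB (n + 1) hν).not)

theorem inCoeff (hν : VarM P .card ν) : DefM P fun i e => (P i).InCoeff n (ν i e) := by
  refine DefM.exF (DefM.exF (DefM.exF (Definable.and ?_ (Definable.and ?_ ?_))))
  · refine DefM.allIS (Definable.imp (DefM.codeMem IsVar.last.weaken.weaken.weaken .last) ?_)
    exact DefM.of_app IsVar.last.weaken .last (Q := fun i e a => (P i).Block n a) (hB.block .last)
  · refine DefM.allIS (DefM.allIS (Definable.imp ?_ (Definable.imp ?_ (Definable.imp ?_ ?_))))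
    · exact DefM.codeMem IsVar.last.weaken.weaken.weaken.weaken IsVar.last.weaken
    · exact DefM.codeMem IsVar.last.weaken.weaken.weaken.weaken .last
    · refine DefM.of_app IsVar.last.weaken.weaken.weaken IsVar.last.weaken
        (Q := fun i e a => a < _) ?_
      refine DefM.of_app IsVar.last.weaken.weaken.weaken.weaken IsVar.last.weaken
        (Q := fun i e a => _ < a) ?_
      exact DefM.ltCard IsVar.last.weaken .last
    · refine DefM.of_app IsVar.last.weaken.weaken IsVar.last.weaken
        (Q := fun i e a => a < _) ?_
      refine DefM.of_app IsVar.last.weaken.weaken.weaken IsVar.last.weaken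
        (Q := fun i e a => _ < a) ?_
      exact DefM.ltCard IsVar.last.weaken .last
  · exact DefM.allCard (Definable.imp (DefM.ltCard hν.weaken.weaken.weaken.weaken .last).not
      (DefM.exIS ((DefM.codeMem IsVar.last.weaken.weaken.weaken.weaken .last).and
        (DefM.app_eq IsVar.last.weaken.weaken.weaken .last IsVar.last.weaken))))

end BigDefinable

theorem DefM.smallCof {S : ∀ i, (P i).CardMinus → Prop}
    (hS : ∀ {ι : Type} {σ : ι → MSort} {ν : ∀ i, MEnv (P i) σ → (P i).CardMinus},
      VarM P .card ν → DefM P fun i e => S i (ν i e)) :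
    DefM P (σ := σ) fun i _ => (P i).SmallCof (S i) := by
  refine DefM.exF (DefM.allCard (Definable.imp (hS .last) (DefM.exIS (Definable.and ?_ ?_))))
  · exact DefM.of_app IsVar.last.weaken.weaken .last (Q := fun i e a => S i a) (hS .last)
  · refine Definable.not (DefM.of_app IsVar.last.weaken.weaken .last (Q := fun i e a => a < _) ?_)
    exact DefM.ltCard .last IsVar.last.weaken.weaken

theorem DefM.cofLt {S : ∀ i, (P i).CardMinus → Prop}
    (hS : ∀ {ι : Type} {σ : ι → MSort} {ν : ∀ i, MEnv (P i) σ → (P i).CardMinus},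
      VarM P .card ν → DefM P fun i e => S i (ν i e))
    {ν : ∀ i, MEnv (P i) σ → (P i).CardMinus} (hν : VarM P .card ν) :
    DefM P fun i e => (P i).CofLt (S i) (ν i e) := by
  refine DefM.allF (DefM.allF (DefM.allF (Definable.imp ?_ (Definable.imp ?_ ?_))))
  · refine DefM.allIS (DefM.allIS (Definable.imp ?_ (Definable.imp ?_ (Definable.imp ?_ ?_))))
    · exact DefM.codeMem IsVar.last.weaken.weaken.weaken.weaken IsVar.last.weaken
    · exact DefM.codeMem IsVar.last.weaken.weaken.weaken.weaken .last
    · refine DefM.of_app IsVar.last.weaken.weaken.weaken IsVar.last (Q := fun i e a => _ = a) ?_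
      exact DefM.app_eq IsVar.last.weaken.weaken.weaken.weaken IsVar.last.weaken.weaken .last
    · refine DefM.of_app IsVar.last.weaken.weaken IsVar.last (Q := fun i e a => _ = a) ?_
      exact DefM.app_eq IsVar.last.weaken.weaken.weaken IsVar.last.weaken.weaken .last
  · refine DefM.allIS (Definable.imp (DefM.codeMem IsVar.last.weaken.weaken.weaken .last)
      (Definable.and ?_ ?_))
    · refine DefM.of_app IsVar.last.weaken.weaken .last (Q := fun i e a => a < _) ?_
      exact DefM.ltCard .last hν.weaken.weaken.weaken.weaken.weaken
    · exact DefM.of_app IsVar.last.weaken .last (Q := fun i e a => S i a) (hS .last)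
  · refine DefM.exCard ((hS .last).and (DefM.allIS (Definable.imp
      (DefM.codeMem IsVar.last.weaken.weaken.weaken.weaken .last) ?_)))
    refine DefM.of_app IsVar.last.weaken.weaken .last (Q := fun i e a => a < _) ?_
    exact DefM.ltCard .last IsVar.last.weaken.weaken

theorem BigDefinable.inCof (hB : BigDefinable P) {n : ℕ}
    {T : ∀ i, MEnv (P i) σ → (P i).CardMinus → Prop}
    {ν : ∀ i, MEnv (P i) σ → (P i).CardMinus} (hν : VarM P .card ν)
    (hT : DefM P fun i e => T i e (ν i e)) : DefM P fun i e => (P i).InCof (T i e) n (ν i e) :=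
  ((DefM.exCard (hB _ .last).not).and (((DefM.allCard (hB _ .last).not).and
    (DefM.allCard (DefM.ltCard .last hν.weaken).not)).or
    ((DefM.exCard (hB _ .last)).and ((DefM.smallCof (hB _)).and (DefM.cofLt (hB _) hν))))).or
    ((DefM.allCard (hB _ .last)).and hT)

end DefinableM

/-! ### The coordinate maps on the basic sorts -/

theorem coeff_le (α : Ordinal.{w}) (n : ℕ) : coeff α n ≤ α :=
  (Ordinal.mod_le _ _).trans (div_le_of_le_mul (le_mul_of_one_le_left'
    (Order.one_le_iff_ne_zero.2 (Omega_pow_ne_zero n))))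

/-- Needed to find $\alpha^{[n]}$ as an initial segment of $Card^-$; the possible value $1$ requires
$\alpha\ne0$. -/
theorem cofCoeff_le {α : Ordinal.{w}} (h : α ≠ 0) (n : ℕ) : cofCoeff α n ≤ α := by
  by_cases h0 : head α n = 0
  · rw [cofCoeff_of_head_eq_zero h0]
    exact Order.one_le_iff_ne_zero.2 h
  · by_cases hc : (head α n).cof ≤ 2 ^ ℵ₀
    · rw [cofCoeff_of_cof_le h0 hc]
      exact (ord_cof_le _).trans (head_le α n)
    · rw [cofCoeff_of_lt_cof (not_le.1 hc)]
      exact zero_le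

namespace Triple

variable (P : Triple.{u})

/-- The element of a basic sort of `N²` represented by an element of `M*`. -/
noncomputable def baseVal : (b : NBase) → {y // P.InBase b y} → P.NBaseCarrier b
  | .is _, y => y.1
  | .coeff _, y => ToType.mk ⟨P.rk y.1, y.2⟩
  | .cof _, y => ToType.mk ⟨P.rk y.1, y.2⟩

theorem toTypeMk_rk_bijective {o : Ordinal.{u + 1}} (ho : o ≤ P.alpha) :
    Function.Bijective fun y : {ν // P.rk ν < o} => ToType.mk ⟨P.rk y.1, y.2⟩ := by
  refine ⟨fun y z h => Subtype.ext (rk_injective (congrArg Subtype.val (ToType.mk.injective h))),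
    fun a => ?_⟩
  obtain ⟨ν, hν⟩ := exists_rk ((coe_toTypeMk_symm_lt a).trans_le ho)
  refine ⟨⟨ν, hν ▸ coe_toTypeMk_symm_lt a⟩, ?_⟩
  rw [← OrderIso.eq_symm_apply]
  exact Subtype.ext hν

theorem baseVal_bijective : ∀ b, Function.Bijective (P.baseVal b)
  | .is _ => ⟨Subtype.val_injective, fun a => ⟨⟨a, trivial⟩, rfl⟩⟩
  | .coeff n => P.toTypeMk_rk_bijective (coeff_le _ n)
  | .cof n => P.toTypeMk_rk_bijective (cofCoeff_le P.alpha_ne_zero n)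

/-- The element of `M*` which represents an element of a basic sort of `N²`. -/
noncomputable def baseRep (b : NBase) : P.NBaseCarrier b ≃ {y // P.InBase b y} :=
  (Equiv.ofBijective _ (P.baseVal_bijective b)).symm

theorem baseRep_baseVal (b : NBase) (y : {y // P.InBase b y}) :
    P.baseRep b (P.baseVal b y) = y :=
  (Equiv.ofBijective _ (P.baseVal_bijective b)).symm_apply_apply y

end Triple

/-! ### The interpretation -/

/-- The places of the tuples representing the elements of a sort of `N²`. -/
def NSort.Ix : NSort → Type
  | .base _ => Unit
  | .rel k _ => Option (Fin k × Fin 6)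

instance (s : NSort) : Finite s.Ix := by
  cases s
  · exact inferInstanceAs (Finite Unit)
  · exact inferInstanceAs (Finite (Option _))

/-- The sorts of the places of the tuples representing the elements of a sort of `N²`. -/
def NSort.ixSrt : (s : NSort) → s.Ix → MSort
  | .base b, _ => b.srt
  | .rel _ _, none => .f 1
  | .rel _ τ, some x => (τ x.1).codeSrt x.2

/-- A numbering of the places. -/
noncomputable def NSort.ixEquiv (s : NSort) : s.Ix ≃ Fin (Nat.card s.Ix) := Finite.equivFin _

/-- The sorts of the numbered places. -/
noncomputable def NSort.dimSrt (s : NSort) (j : Fin (Nat.card s.Ix)) : MSort :=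
  s.ixSrt (s.ixEquiv.symm j)

theorem NSort.dimSrt_ixEquiv (s : NSort) (k : s.Ix) : s.dimSrt (s.ixEquiv k) = s.ixSrt k := by
  rw [dimSrt, Equiv.symm_apply_apply]

namespace Triple

variable (P : Triple.{u})

/-- The family of elements given by a numbered tuple. -/
noncomputable def read (s : NSort) (x : MEnv P s.dimSrt) (k : s.Ix) : P.MCarrier (s.ixSrt k) :=
  cast (congrArg P.MCarrier (s.dimSrt_ixEquiv k)) (x (s.ixEquiv k))

theorem read_surjective (s : NSort) : Function.Surjective (P.read s) := by
  intro z
  refine ⟨fun j => z (s.ixEquiv.symm j), funext fun k => ?_⟩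
  have : ∀ k' (h : k' = k), cast (congrArg (fun k => P.MCarrier (s.ixSrt k)) h) (z k') = z k := by
    rintro _ rfl
    rfl
  exact this _ (s.ixEquiv.symm_apply_apply k)

/-- The families of elements representing an element of a sort of `N²`. -/
def InSort : (s : NSort) → (∀ k, P.MCarrier (s.ixSrt k)) → Prop
  | .base b, z => P.InBase b (z ())
  | .rel _ _, _ => True

/-- The element of a sort of `N²` represented by a family of elements. -/
noncomputable def sortVal : (s : NSort) → {z // P.InSort s z} → P.NCarrier s
  | .base b, z => P.baseVal b ⟨z.1 (), z.2⟩
  | .rel _ τ, z => {a | P.CodeTuple τ (z.1 none) (fun i c => z.1 (some (i, c)))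
      fun i => (P.baseRep (τ i) (a i)).1}

theorem sortVal_surjective (hκ : (2 : Cardinal.{u}) ^ ℵ₀ < P.kappa.ord.cof) :
    ∀ s, Function.Surjective (P.sortVal s)
  | .base b => fun a => by
    obtain ⟨y, rfl⟩ := (P.baseVal_bijective b).2 a
    exact ⟨⟨fun _ => y.1, y.2⟩, rfl⟩
  | .rel k τ => fun (A : Set (∀ i, P.NBaseCarrier (τ i))) => by
    obtain ⟨x, c, h⟩ := P.exists_codeTuple hκ τ
      {y | ∃ a : ∀ i, P.NBaseCarrier (τ i), a ∈ A ∧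
        ∀ i, (P.baseRep (τ i) (a i)).1 = y i} (by
          rintro y ⟨a, -, ha⟩ i
          exact ha i ▸ (P.baseRep (τ i) (a i)).2)
    refine ⟨⟨fun
      | none => x
      | some (i, a) => c i a, trivial⟩, Set.ext fun a => (h _).trans ⟨?_, fun ha => ?_⟩⟩
    · rintro ⟨a', ha', h'⟩
      have : a' = a := funext fun i => (P.baseRep (τ i)).injective (Subtype.ext (h' i))
      exact this ▸ ha'
    · exact ⟨a, ha, fun _ => rfl⟩

end Triple

section Interpretation

variable {I : Type*} {P : I → Triple.{u}} {np : ℕ} {π : Fin np → MSort}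

/-- The families of elements representing an element of a sort of `N²`, as defined by means of a
definition `T` of the families representing an element of a basic sort. -/
def SortDom (T : ∀ (b : NBase) i, MEnv (P i) π → (P i).MCarrier b.srt → Prop) :
    (s : NSort) → ∀ i, MEnv (P i) π → (∀ k, (P i).MCarrier (s.ixSrt k)) → Prop
  | .base b, i, p, z => T b i p (z ())
  | .rel _ _, _, _, _ => True

/-- Equality of the represented elements of a sort. -/
def SortEqv (T : ∀ (b : NBase) i, MEnv (P i) π → (P i).MCarrier b.srt → Prop) :
    (s : NSort) → ∀ i, MEnv (P i) π → (∀ k, (P i).MCarrier (s.ixSrt k)) →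
      (∀ k, (P i).MCarrier (s.ixSrt k)) → Prop
  | .base .., _, _, z, z' => z () = z' ()
  | .rel _ τ, i, p, z, z' => ∀ y : ∀ j, (P i).MCarrier (τ j).srt, (∀ j, T (τ j) i p (y j)) →
      ((P i).CodeTuple τ (z none) (fun i c => z (some (i, c))) y ↔
        (P i).CodeTuple τ (z' none) (fun i c => z' (some (i, c))) y)

/-- The basic relations between the represented elements. -/
def SortRel (P : Triple.{u}) : (R : NRel) →
    (∀ a : Fin (langN.arity R), ∀ k, P.MCarrier ((langN.relSort R a).ixSrt k)) → Prop
  | .eq1, z => P.Eq1 (show ULift (P.IS 2) from z (0 : Fin 1) ()).down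
  | .prod1, z => P.Prod1 (show ULift (P.IS 3) from z (0 : Fin 1) ()).down
  | .proj1 n, z => P.Proj1 (show ULift (P.IS (n + 2)) from z (0 : Fin 2) ()).down
      (show ULift (P.IS (n + 1)) from z (1 : Fin 2) ()).down
  | .ltCoeff _, z => (show P.CardMinus from z (0 : Fin 2) ()) <
      (show P.CardMinus from z (1 : Fin 2) ())
  | .ltCof _, z => (show P.CardMinus from z (0 : Fin 2) ()) <
      (show P.CardMinus from z (1 : Fin 2) ())
  | .mem k τ, z => P.CodeTuple τ (z (0 : Fin (k + 1)) none)
      (fun i c => z (0 : Fin (k + 1)) (some (i, c))) fun i => z (Fin.succ i : Fin (k + 1)) ()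

variable {T : ∀ (b : NBase) i, MEnv (P i) π → (P i).MCarrier b.srt → Prop}

/-- The predicate `T b` is definable for every `b`. -/
def BaseDefinable (T : ∀ (b : NBase) i, MEnv (P i) π → (P i).MCarrier b.srt → Prop) : Prop :=
  ∀ (b : NBase) {ι : Type} {σ : ι → MSort} {q : ∀ k, ∀ i, MEnv (P i) σ → (P i).MCarrier (π k)}
    {y : ∀ i, MEnv (P i) σ → (P i).MCarrier b.srt}, (∀ k, VarM P (π k) (q k)) → VarM P b.srt y →
    DefM P fun i e => T b i (fun k => q k i e) (y i e)

section

variable {ι : Type} {σ : ι → MSort} {q : ∀ k, ∀ i, MEnv (P i) σ → (P i).MCarrier (π k)}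

theorem DefM.codeBase : ∀ {b : NBase} {c : ∀ a, ∀ i, MEnv (P i) σ → (P i).MCarrier (b.codeSrt a)}
    {j : ∀ i, MEnv (P i) σ → ULift.{u + 1} ((P i).IS 2)}
    {y : ∀ i, MEnv (P i) σ → (P i).MCarrier b.srt} (_ : ∀ a, VarM P (b.codeSrt a) (c a))
    (_ : VarM P (.is 1) j) (_ : VarM P b.srt y),
    DefM P fun i e => (P i).CodeBase b (fun a => c a i e) (j i e).down (y i e)
  | .is _, _, _, _, hc, hj, hy => DefM.codeRel (hc 0) (hc 1) (hc 2) hj hy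
  | .coeff _, _, _, _, hc, hj, hy =>
    DefM.codeOrd (hc 0) (hc 1) (hc 2) (hc 3) (hc 4) (hc 5) hj hy
  | .cof _, _, _, _, hc, hj, hy =>
    DefM.codeOrd (hc 0) (hc 1) (hc 2) (hc 3) (hc 4) (hc 5) hj hy

theorem DefM.codeTuple {k : ℕ} {τ : Fin k → NBase} {x : ∀ i, MEnv (P i) σ → (P i).F 2}
    {c : ∀ j a, ∀ i, MEnv (P i) σ → (P i).MCarrier ((τ j).codeSrt a)}
    {y : ∀ j, ∀ i, MEnv (P i) σ → (P i).MCarrier (τ j).srt} (hx : VarM P (.f 1) x)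
    (hc : ∀ j a, VarM P ((τ j).codeSrt a) (c j a)) (hy : ∀ j, VarM P (τ j).srt (y j)) :
    DefM P fun i e => (P i).CodeTuple τ (x i e) (fun j a => c j a i e) fun j => y j i e :=
  DefM.exIS ((DefM.codeMem hx.weaken .last).and (Definable.forall_fin fun j =>
    DefM.codeBase (c := fun a i (e : MEnv (P i) (extend σ (.is 1))) => c j a i fun v => e (some v))
      (y := fun i e => y j i fun v => e (some v)) (fun a => (hc j a).weaken) .last
      (hy j).weaken))

theorem BaseDefinable.sortDom (hT : BaseDefinable T) (hq : ∀ k, VarM P (π k) (q k)) :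
    ∀ {s : NSort} {z : ∀ k, ∀ i, MEnv (P i) σ → (P i).MCarrier (s.ixSrt k)}
    (_ : ∀ k, VarM P (s.ixSrt k) (z k)),
    DefM P fun i e => SortDom T s i (fun k => q k i e) fun k => z k i e
  | .base b, _, hz => hT b hq (hz ())
  | .rel _ _, _, _ => Definable.true

theorem BaseDefinable.sortEqv (hT : BaseDefinable T) (hq : ∀ k, VarM P (π k) (q k)) :
    ∀ {s : NSort} {z z' : ∀ k, ∀ i, MEnv (P i) σ → (P i).MCarrier (s.ixSrt k)}
    (_ : ∀ k, VarM P (s.ixSrt k) (z k)) (_ : ∀ k, VarM P (s.ixSrt k) (z' k)),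
    DefM P fun i e => SortEqv T s i (fun k => q k i e) (fun k => z k i e) fun k => z' k i e
  | .base b, _, _, hz, hz' => Definable.eq (L := langM) (s := b.srt) (hz ()) (hz' ())
  | .rel k τ, z, z', hz, hz' => by
    have hw : ∀ {s : MSort} {t : ∀ i, MEnv (P i) σ → (P i).MCarrier s}, VarM P s t →
        VarM P (σ := Sum.elim σ fun j => (τ j).srt) s fun i e => t i fun v => e (.inl v) := by
      rintro s t ⟨j, h, hj⟩
      exact ⟨.inl j, h, fun i e => hj i _⟩
    have hy : ∀ j, VarM P (σ := Sum.elim σ fun j => (τ j).srt) (τ j).srt fun i e => e (.inr j) :=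
      fun j => ⟨.inr j, rfl, fun _ _ => rfl⟩
    refine Definable.all_pi (L := langM) (A := fun i => (P i).MStar) (fun j => (τ j).srt)
      (Definable.imp (Definable.forall_fin fun j => ?_) (Definable.iff ?_ ?_))
    · exact hT (τ j) (q := fun k i e => q k i fun v => e (.inl v)) (fun k => hw (hq k)) (hy j)
    · exact DefM.codeTuple (c := fun j a i (e : MEnv (P i) (Sum.elim σ fun j => (τ j).srt)) =>
          z (some (j, a)) i fun v => e (.inl v))
        (y := fun j i (e : MEnv (P i) (Sum.elim σ fun j => (τ j).srt)) => e (.inr j)) (hw (hz none)) (fun j a => hw (hz (some (j, a)))) hy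
    · exact DefM.codeTuple (c := fun j a i (e : MEnv (P i) (Sum.elim σ fun j => (τ j).srt)) =>
          z' (some (j, a)) i fun v => e (.inl v))
        (y := fun j i (e : MEnv (P i) (Sum.elim σ fun j => (τ j).srt)) => e (.inr j)) (hw (hz' none)) (fun j a => hw (hz' (some (j, a)))) hy

theorem DefM.sortRel : ∀ {R : NRel} {z : ∀ a : Fin (langN.arity R), ∀ k, ∀ i, MEnv (P i) σ →
      (P i).MCarrier ((langN.relSort R a).ixSrt k)}
    (_ : ∀ a k, VarM P ((langN.relSort R a).ixSrt k) (z a k)),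
    DefM P fun i e => SortRel (P i) R fun a k => z a k i e
  | .eq1, _, hz => DefM.eq1 (hz (0 : Fin 1) ())
  | .prod1, _, hz => DefM.prod1 (hz (0 : Fin 1) ())
  | .proj1 _, _, hz => DefM.proj1 (hz (0 : Fin 2) ()) (hz (1 : Fin 2) ())
  | .ltCoeff _, _, hz => DefM.ltCard (hz (0 : Fin 2) ()) (hz (1 : Fin 2) ())
  | .ltCof _, _, hz => DefM.ltCard (hz (0 : Fin 2) ()) (hz (1 : Fin 2) ())
  | .mem k _, z, hz => DefM.codeTuple (c := fun j a => z (0 : Fin (k + 1)) (some (j, a)))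
      (y := fun j => z (Fin.succ j : Fin (k + 1)) ())
      (hz (0 : Fin (k + 1)) none) (fun j a => hz (0 : Fin (k + 1)) (some (j, a)))
      fun j => hz (Fin.succ j : Fin (k + 1)) ()

end

namespace Triple

variable {P : Triple.{u}}

theorem sortRel_iff : ∀ (R : NRel) (z : ∀ a : Fin (langN.arity R),
      {z : ∀ k, P.MCarrier ((langN.relSort R a).ixSrt k) // P.InSort (langN.relSort R a) z}),
    SortRel P R (fun a => (z a).1) ↔ P.NTwo.rel R fun a => P.sortVal (langN.relSort R a) (z a)
  | .eq1, _ => Iff.rfl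
  | .prod1, _ => Iff.rfl
  | .proj1 _, _ => Iff.rfl
  | .ltCoeff n, z => (rk_lt_rk (P := P)).symm.trans
      ((ToType.mk (o := coeff P.alpha n)).lt_iff_lt (x := ⟨_, (z (0 : Fin 2)).2⟩)
        (y := ⟨_, (z (1 : Fin 2)).2⟩)).symm
  | .ltCof n, z => (rk_lt_rk (P := P)).symm.trans
      ((ToType.mk (o := cofCoeff P.alpha n)).lt_iff_lt (x := ⟨_, (z (0 : Fin 2)).2⟩)
        (y := ⟨_, (z (1 : Fin 2)).2⟩)).symm
  | .mem k τ, z => by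
    change P.CodeTuple τ ((z (0 : Fin (k + 1))).1 none) _ _ ↔ P.CodeTuple τ ((z (0 : Fin (k + 1))).1 none) _ _
    refine iff_of_eq (congrArg _ (funext fun i => ?_))
    exact congrArg Subtype.val (P.baseRep_baseVal (τ i) ⟨(z (Fin.succ i : Fin (k + 1))).1 (), (z (Fin.succ i : Fin (k + 1))).2⟩).symm

end Triple

/-- Codes may also hold of tuples that represent nothing, so two codes are compared only on tuples
of representatives, which correspond bijectively to tuples of elements. -/
theorem sortEqv_iff {p : ∀ i, MEnv (P i) π} (hp : ∀ b i y, T b i (p i) y ↔ (P i).InBase b y)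
    {i : I} : ∀ {s : NSort} (z z' : {z // (P i).InSort s z}),
    SortEqv T s i (p i) z.1 z'.1 ↔ (P i).sortVal s z = (P i).sortVal s z'
  | .base b, z, z' => by
    change z.1 () = z'.1 () ↔ (P i).baseVal b ⟨z.1 (), z.2⟩ = (P i).baseVal b ⟨z'.1 (), z'.2⟩
    exact ⟨fun h => congrArg _ (Subtype.ext h),
      fun h => congrArg Subtype.val (((P i).baseVal_bijective b).1 h)⟩
  | .rel k τ, z, z' => by
    constructor
    · intro h
      refine Set.ext fun a => h _ fun j => ?_
      rw [hp]
      exact ((P i).baseRep (τ j) (a j)).2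
    · intro h y hy
      have h1 := Set.ext_iff.1 h fun j => (P i).baseVal (τ j) ⟨y j, (hp _ _ _).1 (hy j)⟩
      have h2 : ∀ j, ((P i).baseRep (τ j) ((P i).baseVal (τ j) ⟨y j, (hp _ _ _).1 (hy j)⟩)).1 =
          y j := fun j => congrArg Subtype.val ((P i).baseRep_baseVal (τ j) _)
      have h3 := funext h2
      change (P i).CodeTuple τ _ _ _ ↔ (P i).CodeTuple τ _ _ _ at h1
      rwa [h3] at h1

theorem exists_scheme (hκ : ∀ i, (2 : Cardinal.{u}) ^ ℵ₀ < (P i).kappa.ord.cof)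
    (hT : BaseDefinable T) (p : ∀ i, MEnv (P i) π)
    (hp : ∀ b i y, T b i (p i) y ↔ (P i).InBase b y) :
    ∃ S : Scheme langN langM π, ∀ i, S.Interprets (P i).NTwo (P i).MStar (p i) := by
  have hl : ∀ {κ : Type} {τ : κ → MSort} (k : Fin np),
      VarM P (σ := Sum.elim π τ) (π k) fun i e => e (.inl k) :=
    fun k => ⟨.inl k, rfl, fun _ _ => rfl⟩
  choose dom hdom using fun s : NSort => hT.sortDom (σ := Sum.elim π s.dimSrt) hl (s := s)
    (z := fun k i e => (P i).read s (fun j => e (.inr j)) k)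
    fun k => ⟨.inr (s.ixEquiv k), s.dimSrt_ixEquiv k, fun _ _ => rfl⟩
  choose eqv heqv using fun s : NSort => hT.sortEqv
    (σ := Sum.elim π (Sum.elim s.dimSrt s.dimSrt)) hl (s := s)
    (z := fun k i e => (P i).read s (fun j => e (.inr (.inl j))) k)
    (z' := fun k i e => (P i).read s (fun j => e (.inr (.inr j))) k)
    (fun k => ⟨.inr (.inl (s.ixEquiv k)), s.dimSrt_ixEquiv k, fun _ _ => rfl⟩)
    fun k => ⟨.inr (.inr (s.ixEquiv k)), s.dimSrt_ixEquiv k, fun _ _ => rfl⟩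
  choose rel hrel using fun R : NRel => DefM.sortRel (P := P) (R := R)
    (σ := Sum.elim π fun x : (a : Fin (langN.arity R)) × Fin (Nat.card (langN.relSort R a).Ix) =>
      NSort.dimSrt (langN.relSort R x.1) x.2)
    (z := fun a k i e => (P i).read (langN.relSort R a) (fun j => e (.inr ⟨a, j⟩)) k)
    fun a k => ⟨.inr ⟨a, NSort.ixEquiv _ k⟩, NSort.dimSrt_ixEquiv _ k, fun _ _ => rfl⟩
  have hdom' : ∀ s i z, SortDom T s i (p i) z ↔ (P i).InSort s z := by
    rintro (b | ⟨k, τ⟩) i z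
    · exact hp b i _
    · exact Iff.rfl
  have hread : ∀ s i (x : MEnv (P i) s.dimSrt),
      (P i).MStar.Sat (dom s) ((P i).MStar.append (p i) x) ↔
        (P i).InSort s ((P i).read s x) := fun s i x => (hdom s i _).trans (hdom' s i _)
  refine ⟨⟨fun s => Nat.card (NSort.Ix s), NSort.dimSrt, dom, eqv, rel⟩, fun i =>
    ⟨fun s x => (P i).sortVal s ⟨(P i).read s x.1, (hread s i x.1).1 x.2⟩, fun s a => ?_,
      fun s x y => (heqv s i _).trans ?_, fun R x => (hrel R i _).trans ?_⟩⟩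
  · obtain ⟨⟨z, hz⟩, rfl⟩ := (P i).sortVal_surjective (hκ i) s a
    obtain ⟨x, rfl⟩ := (P i).read_surjective s z
    exact ⟨⟨x, (hread s i x).2 hz⟩, rfl⟩
  · exact sortEqv_iff hp (i := i) ⟨(P i).read s x.1, (hread s i x.1).1 x.2⟩
      ⟨(P i).read s y.1, (hread s i y.1).1 y.2⟩
  · exact Triple.sortRel_iff R fun a => ⟨(P i).read _ (x a).1, (hread _ i _).1 (x a).2⟩

/-- A definition of the representatives of the elements of the basic sorts; `C` defines `α^[n]` in
the case that `α[n] = α`. -/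
def baseDef (P : I → Triple.{u}) (C : ∀ i, MEnv (P i) π → (P i).CardMinus → Prop) :
    ∀ (b : NBase) i, MEnv (P i) π → (P i).MCarrier b.srt → Prop
  | .is _, _, _, _ => True
  | .coeff n, i, _, ν => (P i).InCoeff n ν
  | .cof n, i, e, ν => (P i).InCof (C i e) n ν

/-- `N²` is interpretable in `M*`, uniformly in a family of triples, if the predicates `Big k` are
definable and the cofinality of `α` is definable where needed. -/
theorem exists_scheme_of_bigDefinable
    (hκ : ∀ i, (2 : Cardinal.{u}) ^ ℵ₀ < (P i).kappa.ord.cof) (hB : BigDefinable P)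
    (p : ∀ i, MEnv (P i) π) (C : ∀ i, MEnv (P i) π → (P i).CardMinus → Prop)
    (hC : ∀ {ι : Type} {σ : ι → MSort} {q : ∀ k, ∀ i, MEnv (P i) σ → (P i).MCarrier (π k)}
      {ν : ∀ i, MEnv (P i) σ → (P i).CardMinus}, (∀ k, VarM P (π k) (q k)) → VarM P .card ν →
      DefM P fun i e => C i (fun k => q k i e) (ν i e))
    (hCp : ∀ i n, head (P i).alpha n = (P i).alpha →
      ∀ ν, C i (p i) ν ↔ (P i).rk ν < cofCoeff (P i).alpha n) :
    ∃ S : Scheme langN langM π, ∀ i, S.Interprets (P i).NTwo (P i).MStar (p i) := by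
  refine exists_scheme (T := baseDef P C) hκ ?_ p ?_
  · rintro (n | n | n) ι σ q y hq hy
    · exact Definable.true
    · exact hB.inCoeff hy
    · exact hB.inCof (T := fun i e => C i fun k => q k i e) hy (hC hq hy)
  · rintro (n | n | n) i y
    · exact Iff.rfl
    · exact (P i).inCoeff_iff (hκ i) n y
    · exact (P i).inCof_iff (hκ i) (hCp i n) y

end Interpretation

/-! ### The three claims, according to how $cf(\alpha)$ is obtained -/

theorem exists_scheme_of_lt_cof {I : Type*} {P : I → Triple.{u}} {np : ℕ} {π : Fin np → MSort}
    (hκ : ∀ i, (2 : Cardinal.{u}) ^ ℵ₀ < (P i).kappa.ord.cof)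
    (hl : ∀ i, (2 : Cardinal.{u}) ^ ℵ₀ < (P i).lam.ord.cof) (p : ∀ i, MEnv (P i) π) :
    ∃ S : Scheme langN langM π, ∀ i, S.Interprets (P i).NTwo (P i).MStar (p i) :=
  exists_scheme_of_bigDefinable hκ (bigDefinable_of_lt_cof hκ hl) p (fun _ _ _ => False)
    (fun _ _ => Definable.false) fun i n h ν => by
      rw [Triple.cofCoeff_eq_zero_of_lt_cof (hl i) h]
      exact iff_of_false id not_lt_zero

theorem Triple.interpretable (P : Triple.{u}) (hκ : (2 : Cardinal.{u}) ^ ℵ₀ < P.kappa.ord.cof)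
    (hn : ∃ n, coeff P.alpha n ≠ 0) : Interpretable P.NTwo P.MStar := by
  classical
  rcases lt_or_ge ((2 : Cardinal.{u}) ^ ℵ₀) P.lam.ord.cof with hl | hl
  · obtain ⟨S, hS⟩ := exists_scheme_of_lt_cof (I := Unit) (P := fun _ => P) (fun _ => hκ)
      (fun _ => hl) fun _ => noArg P.MStar
    exact ⟨S, hS ()⟩
  · have hB := bigDefinable_of_cof_le (I := Unit) (P := fun _ => P) (fun _ => hκ) fun _ => hl
    -- The lowest non-zero coefficient computes $cf(\alpha)$; its index enters the formulas, so they
    -- depend on the triple.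
    obtain ⟨S, hS⟩ := exists_scheme_of_bigDefinable (I := Unit) (P := fun _ => P) (fun _ => hκ) hB
      (fun _ => noArg P.MStar) (fun _ _ => P.CofLt (P.InCoeff (Nat.find hn)))
      (fun _ hν => DefM.cofLt (S := fun _ => P.InCoeff (Nat.find hn)) (fun hν => hB.inCoeff hν) hν)
      fun _ n h ν => Triple.cofLt_inCoeff_iff hκ hl (Nat.find_spec hn)
        (fun k hk => not_not.1 (Nat.find_min hn hk)) h ν
    exact ⟨S, hS ()⟩

theorem Triple.interpretableWithParams (P : Triple.{u})
    (hκ : (2 : Cardinal.{u}) ^ ℵ₀ < P.kappa.ord.cof) :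
    InterpretableWithParams P.NTwo P.MStar := by
  rcases lt_or_ge ((2 : Cardinal.{u}) ^ ℵ₀) P.lam.ord.cof with hl | hl
  · obtain ⟨S, hS⟩ := exists_scheme_of_lt_cof (I := Unit) (P := fun _ => P) (fun _ => hκ)
      (fun _ => hl) fun _ => noArg P.MStar
    exact ⟨0, _, S, _, hS ()⟩
  · have hc : ∃ c : P.CardMinus, ∀ n, head P.alpha n = P.alpha → P.rk c = P.alpha.cof.ord := by
      by_cases h : ∃ n, head P.alpha n = P.alpha
      · obtain ⟨n, h⟩ := h
        obtain ⟨c, hc⟩ := Triple.exists_rk (Triple.cof_ord_alpha_lt hl h)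
        exact ⟨c, fun _ _ => hc⟩
      · exact ⟨⟨0, zero_le.trans_lt P.kappa_lt, Or.inl rfl⟩, fun n h' => absurd ⟨n, h'⟩ h⟩
    obtain ⟨c, hc⟩ := hc
    obtain ⟨S, hS⟩ := exists_scheme_of_bigDefinable (I := Unit) (P := fun _ => P)
      (π := fun _ : Fin 1 => MSort.card) (fun _ => hκ)
      (bigDefinable_of_cof_le (fun _ => hκ) fun _ => hl) (fun _ _ => c)
      (fun _ e ν => ν < (e 0 : P.CardMinus)) (fun hq hν => DefM.ltCard hν (hq 0)) fun _ n h ν => by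
        rw [Triple.cofCoeff_eq_of_cof_le hl h, ← hc n h]
        exact Triple.rk_lt_rk.symm
    exact ⟨1, _, S, _, hS ()⟩

end PermQuot

theorem theorem5p5 :
    (∃ I : PermQuot.Scheme PermQuot.langN PermQuot.langM (PermQuot.noParam PermQuot.langM),
      ∀ P : PermQuot.Triple.{u}, (2 : Cardinal.{u}) ^ Cardinal.aleph0.{u} < P.kappa.ord.cof →
        (2 : Cardinal.{u}) ^ Cardinal.aleph0.{u} < P.lam.ord.cof →
        I.Interprets P.NTwo P.MStar (PermQuot.noArg P.MStar)) ∧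
    (∀ P : PermQuot.Triple.{u}, (2 : Cardinal.{u}) ^ Cardinal.aleph0.{u} < P.kappa.ord.cof →
      (∃ n, PermQuot.coeff P.alpha n ≠ 0) →
      PermQuot.Interpretable P.NTwo P.MStar) ∧
    (∀ P : PermQuot.Triple.{u}, (2 : Cardinal.{u}) ^ Cardinal.aleph0.{u} < P.kappa.ord.cof →
      PermQuot.InterpretableWithParams P.NTwo P.MStar) := by
  refine ⟨?_, fun P hκ hn => P.interpretable hκ hn, fun P hκ => P.interpretableWithParams hκ⟩
  -- Taking all admissible triples as one family yields formulas that do not depend on the triple.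
  obtain ⟨S, hS⟩ := PermQuot.exists_scheme_of_lt_cof
    (I := {P : PermQuot.Triple.{u} // (2 : Cardinal.{u}) ^ Cardinal.aleph0.{u} < P.kappa.ord.cof ∧
      (2 : Cardinal.{u}) ^ Cardinal.aleph0.{u} < P.lam.ord.cof})
    (P := Subtype.val) (fun P => P.2.1) (fun P => P.2.2) fun P => PermQuot.noArg P.1.MStar
  exact ⟨S, fun P hκ hl => hS ⟨P, hκ, hl⟩⟩
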